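/- **Setting.** Let $N\ge 1$, let $\lambda\in\mathbb C$ with $\Im\lambda<0$, and let $\frac{2}{N+2}<\alpha<\frac2N$. Fix integers $k,m,n$ with $$k>\tfrac N2+4,\qquad n>\max\Bigl\{\tfrac{20}{\alpha^2},\ \tfrac{N(2-N\alpha)(k+4)}{\alpha},\ \tfrac{2N(k+2)(2-N\alpha)}{(N+2)\alpha-2}\Bigr\},\qquad m>\max\Bigl\{\tfrac{k+n+1}{2},\ \tfrac{5n\alpha|\lambda|(1+\alpha|\Im\lambda|)}{N(2-N\alpha)|\Im\lambda|}\Bigr\},$$ put $J=2m+2+k+n$, and fix $\sigma$ with $$\tfrac{N(2-N\alpha)}{n\alpha}<\sigma<\min\Bigl\{\tfrac{N\alpha}{10},\ \tfrac{2-N\alpha}{2},\ \tfrac1{k+4},\ \tfrac{(N+2)\alpha-2}{2\alpha(k+2)}\Bigr\}.$$ Let $\langle x\rangle=(1+|x|^2)^{1/2}$, and let $\mu(p)=n$ for $0\le p\le J-n$, $\mu(p)=J-p$ for $J-n\le p\le J$. For multi-indices $\beta$, $D^\beta$ denotes weak derivatives. Set $$\|u\|_{1,\ell}=\sup_{|\beta|\le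 \ell}\|\langle\cdot\rangle^nD^\beta u\|_{L^\infty}\ (0\le\ell\le 2m),\qquad \|u\|_{2,\ell}=\sup_{2m+1\le|\beta|\le\ell}\|\langle\cdot\rangle^{\mu(|\beta|)}D^\beta u\|_{L^2}\ (2m+1\le\ell\le J),$$ and let $\mathcal S$ be the space of all $u\in H^J(\mathbb R^N)$ with $\langle\cdot\rangle^nD^\beta u\in L^\infty$ for $|\beta|\le 2m$ and $\langle\cdot\rangle^{\mu(|\beta|)}D^\beta u\in L^2$ for $2m+1\le|\beta|\le J$, with norm $\|u\|_{\mathcal S}=\|u\|_{1,2m}+\|u\|_{2,J}$. Let $\sigma_j=j\sigma$ for $0\le j\le 2m$, $\sigma_{2m+1}=(2m+2)\sigma$, $\sigma_j=(j+2)\sigma$ for $2m+2\le j\le J-2$, $\sigma_{J-1}=(J+2)\sigma$, $\sigma_J=(J+4)\sigma$. For $b>0$ and $0<T_{\max}\le\frac1b$, let $v\in C([0,T_{\max}),\mathcal S)$ be a solution of $$i\partial_tv+\Delta v=\lambda(1-bt)^{-\frac{4-N\alpha}2}|v|^\alpha v,\qquad v(0)=v_0, \tag{NLS$_b$}$$ such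 that $\inf_{0\le s\le t}\inf_{x}\langle x\rangle^n|v(s,x)|>0$ for all $0\le t<T_{\max}$. For $0\le t<T_{\max}$ let $\Psi_t=\max\{\Phi_{1,t},\Phi_{2,t},\Phi_{3,t},\Phi_{4,t}\}$, where $$\Phi_{1,t}=\sup_{0\le s\le t}\sup_{0\le j\le 2m}(1-bs)^{\sigma_j}\|v(s)\|_{1,j},\qquad \Phi_{2,t}=\sup_{0\le s\le t}\sup_{2m+1\le j\le J}(1-bs)^{\sigma_j}\|v(s)\|_{2,j},$$ $$\Phi_{3,t}=\sup_{0\le s\le t}\frac{(1-bs)^{\frac{2-N\alpha}{2\alpha}}}{\inf_x\langle x\rangle^n|v(s,x)|},\qquad \Phi_{4,t}=\sup_{0\le s\le t}\sup_{0\le j\le 2m+2}(1-bs)^{\sigma_j}\sup_{|\beta|=j}\Bigl\|\frac{D^\beta v(s)}{|v(s)|}\Bigr\|_{L^\infty}.$$ Finally, for $0\le t<\frac1b$ let $$G(t)=\frac{(1-bt)^{\frac{2-N\alpha}2}}{1-(1-bt)^{\frac{2-N\alpha}2}},\qquad G(0)=+\infty .$$ **Proposition.** Given $K>1$ and $K_1\ge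 K$, there exist $b_0>1$ and $C_0>0$, depending only on $N,\alpha,\lambda,k,m,n,\sigma,K,K_1$, with the following property. Let $b\ge b_0$, let $v_0\in\mathcal S$ satisfy $$\|v_0\|_{\mathcal S}+\Bigl(\inf_{x\in\mathbb R^N}\langle x\rangle^n|v_0(x)|\Bigr)^{-1}\le K,$$ let $v$ be a solution of (NLS$_b$) on $[0,T_{\max})$ as above, and suppose that $\Psi_T\le K_1$ for some $0<T<T_{\max}$. Then for all $0\le t\le T$ and $x\in\mathbb R^N$: 1. $|v(t,x)|\le 2|v_0(x)|$; 2. $|v(t,x)|^\alpha\le\bigl(1+\frac{2-N\alpha}{2\alpha|\Im\lambda|}\bigr)\min\{2K^\alpha\langle x\rangle^{-n\alpha},\ bG(t)\}$; 3. $\||v(t)|^\alpha\|_{L^2}\le C_0\min\{1,(bG(t))^{1-\frac{2\sigma}{2-N\alpha}}\}$; 4. for all $1\le|\beta|\le 2m$, $$\bigl\|\langle\cdot\rangle^{\frac{2n\alpha\sigma}{2-N\alpha}}D^\beta(|v(t)|^\alpha)\bigr\|_{L^\infty}\le C_0\min\{1,(bG(t))^{1-\frac{2\sigma}{2-N\alpha}}\}(1-bt)^{-(|\beta|-1)\sigma};$$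 5. for all $2m+1\le|\beta|\le J-2$, $$\bigl\|\langle\cdot\rangle^{\mu(|\beta|)}v(t)D^\beta(|v(t)|^\alpha)\bigr\|_{L^2}\le C_0(1-bt)^{-(|\beta|-1)\sigma}\min\{1,(bG(t))^{1-\frac{2\sigma}{2-N\alpha}}\}.$$ In 4 and 5 the weak derivatives $D^\beta(|v(t)|^\alpha)$ exist as locally integrable functions. -/

import Mathlib

open MeasureTheory
open scoped ENNReal ContDiff

noncomputable section

namespace DissipativeNLS

/-- The space `ℝ^N` with its Euclidean norm. -/
abbrev Sp (N : ℕ) : Type := EuclideanSpace ℝ (Fin N)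

/-- The bracket `⟨x⟩ = (1 + |x|²)^{1/2}`. -/
def bracket {N : ℕ} (x : Sp N) : ℝ := Real.sqrt (1 + ‖x‖ ^ 2)

/-! ### Multi-indices and weak derivatives -/

/-- The order `|β|` of a multi-index `β ∈ ℕ^N`. -/
def order {N : ℕ} (β : Fin N → ℕ) : ℕ := ∑ i, β i

/-- The classical partial derivative `∂_i φ`. -/
def partialDeriv {N : ℕ} (i : Fin N) (φ : Sp N → ℝ) : Sp N → ℝ :=
  fun x => fderiv ℝ φ x (EuclideanSpace.single i 1)

/-- The classical derivative `D^β φ = ∂_1^{β_1} ⋯ ∂_N^{β_N} φ`; it is only applied to smooth `φ`. -/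
def iterPartial {N : ℕ} (β : Fin N → ℕ) (φ : Sp N → ℝ) : Sp N → ℝ :=
  (List.finRange N).foldr (fun i g => (partialDeriv i)^[β i] g) φ

/-- `w = D^β u` in the sense of distributions on `ℝ^N`, with `u` and `w` locally integrable. -/
def IsWeakDeriv {N : ℕ} {F : Type*} [NormedAddCommGroup F] [NormedSpace ℝ F]
    (β : Fin N → ℕ) (u w : Sp N → F) : Prop :=
  LocallyIntegrable u volume ∧ LocallyIntegrable w volume ∧
    ∀ φ : Sp N → ℝ, ContDiff ℝ ∞ φ → HasCompactSupport φ →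
      ∫ x, iterPartial β φ x • u x = (-1 : ℝ) ^ order β • ∫ x, φ x • w x

/-- `u` has a locally integrable weak derivative `D^β u`. -/
def HasWeakDeriv {N : ℕ} {F : Type*} [NormedAddCommGroup F] [NormedSpace ℝ F]
    (β : Fin N → ℕ) (u : Sp N → F) : Prop :=
  ∃ w, IsWeakDeriv β u w

open Classical in
/-- The weak derivative `D^β u` (unique up to a null set; `0` if there is none). -/
def weakDeriv {N : ℕ} {F : Type*} [NormedAddCommGroup F] [NormedSpace ℝ F]
    (β : Fin N → ℕ) (u : Sp N → F) : Sp N → F :=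
  if h : HasWeakDeriv β u then h.choose else 0

theorem isWeakDeriv_weakDeriv {N : ℕ} {F : Type*} [NormedAddCommGroup F] [NormedSpace ℝ F]
    {β : Fin N → ℕ} {u : Sp N → F} (h : HasWeakDeriv β u) :
    IsWeakDeriv β u (weakDeriv β u) := by
  unfold weakDeriv
  rw [dif_pos h]
  exact h.choose_spec

/-! ### The space `S` -/

/-- `J = 2m + 2 + k + n`. -/
def topOrder (k m n : ℕ) : ℕ := 2 * m + 2 + k + n

/-- The weight exponent: `n` for `0 ≤ p ≤ J - n` and `J - p` for `J - n ≤ p ≤ J`. -/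
def weightExp (k m n p : ℕ) : ℕ :=
  if p ≤ topOrder k m n - n then n else topOrder k m n - p

/-- The weighted derivative `⟨x⟩^a D^β u`. -/
def weighted {N : ℕ} (a : ℕ) (β : Fin N → ℕ) (u : Sp N → ℂ) : Sp N → ℂ :=
  fun x => ((bracket x ^ a : ℝ) : ℂ) * weakDeriv β u x

/-- `u ∈ S`: `u ∈ H^J`, `⟨x⟩^n D^β u ∈ L^∞` for `|β| ≤ 2m`, and `⟨x⟩^{μ(|β|)} D^β u ∈ L²` for
`2m + 1 ≤ |β| ≤ J`, where `μ` is `weightExp`. -/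
structure MemS {N : ℕ} (k m n : ℕ) (u : Sp N → ℂ) : Prop where
  hasWeakDeriv : ∀ β : Fin N → ℕ, order β ≤ topOrder k m n → HasWeakDeriv β u
  memLp : ∀ β : Fin N → ℕ, order β ≤ topOrder k m n → MemLp (weakDeriv β u) 2 volume
  low : ∀ β : Fin N → ℕ, order β ≤ 2 * m → MemLp (weighted n β u) ∞ volume
  high : ∀ β : Fin N → ℕ, 2 * m + 1 ≤ order β → order β ≤ topOrder k m n →
    MemLp (weighted (weightExp k m n (order β)) β u) 2 volume

/-- `‖u‖_{1,ℓ} = sup_{|β| ≤ ℓ} ‖⟨·⟩^n D^β u‖_{L^∞}`. -/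
def normOne {N : ℕ} (n ℓ : ℕ) (u : Sp N → ℂ) : ℝ≥0∞ :=
  ⨆ (β : Fin N → ℕ) (_ : order β ≤ ℓ), eLpNorm (weighted n β u) ∞ volume

/-- `‖u‖_{2,ℓ} = sup_{2m+1 ≤ |β| ≤ ℓ} ‖⟨·⟩^{μ(|β|)} D^β u‖_{L²}`. -/
def normTwo {N : ℕ} (k m n ℓ : ℕ) (u : Sp N → ℂ) : ℝ≥0∞ :=
  ⨆ (β : Fin N → ℕ) (_ : 2 * m + 1 ≤ order β ∧ order β ≤ ℓ),
    eLpNorm (weighted (weightExp k m n (order β)) β u) 2 volume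

/-- The norm of `S`. -/
def normS {N : ℕ} (k m n : ℕ) (u : Sp N → ℂ) : ℝ≥0∞ :=
  normOne n (2 * m) u + normTwo k m n (topOrder k m n) u

/-- `inf_x ⟨x⟩^n |u(x)|`. -/
def lowerBound {N : ℕ} (n : ℕ) (u : Sp N → ℂ) : ℝ≥0∞ :=
  ⨅ x : Sp N, ENNReal.ofReal (bracket x ^ n * ‖u x‖)

/-! ### The equation -/

/-- `v ∈ C([0, T), S)` is a solution on `[0, T)` of
`i ∂_t v + Δ v = λ (1 - b t)^{-(4 - N α)/2} |v|^α v`, `v(0) = v₀`, such that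
`inf_{0 ≤ s ≤ t} inf_x ⟨x⟩^n |v(s, x)| > 0` for all `0 ≤ t < T`.
Elements of `S` have a (unique) representative of class `C²`, and `v t` stands for it; the equation
then holds pointwise. The time derivative is one-sided at `t = 0`. -/
structure IsSolution (N k m n : ℕ) (α : ℝ) (lam : ℂ) (b T : ℝ) (v₀ : Sp N → ℂ)
    (v : ℝ → Sp N → ℂ) : Prop where
  initial : v 0 = v₀
  contDiff : ∀ t ∈ Set.Ico 0 T, ContDiff ℝ 2 (v t)
  memS : ∀ t ∈ Set.Ico 0 T, MemS k m n (v t)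
  continuous : ∀ t ∈ Set.Ico 0 T,
    Filter.Tendsto (fun s => normS k m n (v s - v t)) (nhdsWithin t (Set.Ico 0 T)) (nhds 0)
  equation : ∀ t ∈ Set.Ico 0 T, ∀ x : Sp N, ∃ dv : ℂ,
    HasDerivWithinAt (fun s => v s x) dv (Set.Ico 0 T) t ∧
      Complex.I * dv + Laplacian.laplacian (v t) x =
        lam * (((1 - b * t) ^ (-(4 - N * α) / 2) * ‖v t x‖ ^ α : ℝ) : ℂ) * v t x
  bounded_below : ∀ t ∈ Set.Ico 0 T, 0 < ⨅ s ∈ Set.Icc 0 t, lowerBound n (v s)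

/-! ### The quantities `Φ_{i,t}` and `Ψ_t`, with values in `[0, ∞]` -/

/-- The exponents `σ_j`, `0 ≤ j ≤ J`. -/
def sigmaExp (k m n : ℕ) (σ : ℝ) (j : ℕ) : ℝ :=
  if j ≤ 2 * m then j * σ
  else if j = 2 * m + 1 then (j + 1) * σ
  else if j + 2 ≤ topOrder k m n then (j + 2) * σ
  else if j + 1 = topOrder k m n then (j + 3) * σ
  else (j + 4) * σ

def Phi1 {N : ℕ} (k m n : ℕ) (σ b : ℝ) (v : ℝ → Sp N → ℂ) (t : ℝ) : ℝ≥0∞ :=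
  ⨆ s ∈ Set.Icc 0 t, ⨆ j ∈ Set.Icc 0 (2 * m),
    ENNReal.ofReal ((1 - b * s) ^ sigmaExp k m n σ j) * normOne n j (v s)

def Phi2 {N : ℕ} (k m n : ℕ) (σ b : ℝ) (v : ℝ → Sp N → ℂ) (t : ℝ) : ℝ≥0∞ :=
  ⨆ s ∈ Set.Icc 0 t, ⨆ j ∈ Set.Icc (2 * m + 1) (topOrder k m n),
    ENNReal.ofReal ((1 - b * s) ^ sigmaExp k m n σ j) * normTwo k m n j (v s)

def Phi3 {N : ℕ} (n : ℕ) (α b : ℝ) (v : ℝ → Sp N → ℂ) (t : ℝ) : ℝ≥0∞ :=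
  ⨆ s ∈ Set.Icc 0 t,
    ENNReal.ofReal ((1 - b * s) ^ ((2 - N * α) / (2 * α))) / lowerBound n (v s)

def Phi4 {N : ℕ} (k m n : ℕ) (σ b : ℝ) (v : ℝ → Sp N → ℂ) (t : ℝ) : ℝ≥0∞ :=
  ⨆ s ∈ Set.Icc 0 t, ⨆ j ∈ Set.Icc 0 (2 * m + 2),
    ENNReal.ofReal ((1 - b * s) ^ sigmaExp k m n σ j) *
      ⨆ (β : Fin N → ℕ) (_ : order β = j),
        eLpNorm (fun x => weakDeriv β (v s) x / (‖v s x‖ : ℂ)) ∞ volume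

def Psi {N : ℕ} (k m n : ℕ) (α σ b : ℝ) (v : ℝ → Sp N → ℂ) (t : ℝ) : ℝ≥0∞ :=
  max (max (Phi1 k m n σ b v t) (Phi2 k m n σ b v t)) (max (Phi3 n α b v t) (Phi4 k m n σ b v t))

/-- `G(t) = (1 - b t)^{(2 - N α)/2} / (1 - (1 - b t)^{(2 - N α)/2})` for `0 ≤ t < 1/b`, with values
in `[0, ∞]`: `G(0) = ∞`. -/
def G (N : ℕ) (α b t : ℝ) : ℝ≥0∞ :=
  ENNReal.ofReal ((1 - b * t) ^ ((2 - N * α) / 2)) /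
    ENNReal.ofReal (1 - (1 - b * t) ^ ((2 - N * α) / 2))

/-- The decay factor `min {1, (b G(t))^{1 - 2σ/(2 - N α)}}`; it equals `1` at `t = 0`. -/
def decay (N : ℕ) (α σ b t : ℝ) : ℝ≥0∞ :=
  min 1 ((ENNReal.ofReal b * G N α b t) ^ (1 - 2 * σ / (2 - N * α)))

/-- The function `|u|^α`. -/
def absPow {N : ℕ} (α : ℝ) (u : Sp N → ℂ) : Sp N → ℝ := fun x => ‖u x‖ ^ α

end DissipativeNLS

end

/-! At a fixed point `x` the equation is an ordinary differential equation with the Laplacian as a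
forcing term. With `L = -Im (v̄ Δv) / |v|²`, `A(t) = α ∫₀ᵗ L`, `h(s) = (1 - bs)^{-(4-Nα)/2}` and `c
= -α Im λ > 0`, it gives `∂ₜ(|v|^{-α} e^A) = c h e^A` (`amplitude_formula`), hence `|v(t)|^α =
e^{A(t)} / (|v₀|^{-α} + c ∫₀ᵗ h e^A)`. The control of `Ψ` yields `|L(s)| ≤ C (1 - bs)^{-2σ}`, so `A
= O(1/b)`. For large `b` the formula is therefore within a factor close to `1` of its value at `A =
0`, where `∫ h` is explicit and equals `(bG)⁻¹` up to a constant. This is `IsSolution.absPow_le`,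
the source of items 1 and 2. Since `|v₀|^{-α}` dominates `⟨x⟩^{nα}`, an interpolation between the
two terms of the denominator with weight `θ = 2σ/(2-Nα)` (`inv_add_le_interpolate`) gives `decay ·
⟨x⟩^{-τ}`, `τ = 2nασ/(2-Nα)`. As `τ > N/2`, item 3 follows.

For items 4 and 5 the formula is differentiated in `x`. Logarithmic sizes `|D^j v| / |v|` are
submultiplicative majorants, stable under products, inverses, logarithms and exponentials
(`HasMaj`). Since `L` contains two derivatives of `v`, order `j` of `|v|^α` uses order `j + 2` of
`v`. Up to order `2m + 2` these sizes are bounded pointwise; above, they are only known in weighted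
`L²`. Because `J ≤ 4m + 1`, a product of derivatives of total order at most `J` has at most one
factor of order above `2m`, so the unbounded sizes enter linearly (`subMul_lossSeq`) and their `L²`
norms may be summed over time. The time weight is `(1 - bs)^{-(7σ+γ)}` with `γ = (2-Nα)/(2α)`,
integrable since `7σ + γ < 1`.

The solution has only weak derivatives of high order and is only continuous in time with values in
`S`. The calculus is therefore done on a regularization: time integrals become Riemann sums with `M`
terms, and each time slice is mollified (`regAmp_hasMaj`, `regAmp_mollify_bounds`). The bounds do
not depend on the mollification or on `M`, so one removes the mollification at fixed `M`
(`regAmp_bounds`), then lets `M → ∞` (`exists_weakDeriv_absPow_bounds`). Both limits are bounded and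
pointwise, and the bounds on weak derivatives survive them by weak compactness in `L²`. -/

namespace DissipativeNLS

/-! ### Majorants of iterated derivatives at a point -/

section Majorant

variable {E F G H : Type*} [NormedAddCommGroup E] [NormedSpace ℝ E]
  [NormedAddCommGroup F] [NormedSpace ℝ F] [NormedAddCommGroup G] [NormedSpace ℝ G]
  [NormedAddCommGroup H] [NormedSpace ℝ H]

/-- A sequence of reals `≥ 1` which is submultiplicative up to total order `P`. -/
structure SubMul (P : ℕ) (a : ℕ → ℝ) : Prop where
  one_le : ∀ j, 1 ≤ a j
  mul_le : ∀ i j, i + j ≤ P → a i * a j ≤ a (i + j)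

theorem SubMul.mono {P P' : ℕ} {a : ℕ → ℝ} (h : SubMul P a) (hP : P' ≤ P) : SubMul P' a :=
  ⟨h.one_le, fun i j hij => h.mul_le i j (hij.trans hP)⟩

theorem SubMul.nonneg {P : ℕ} {a : ℕ → ℝ} (h : SubMul P a) (j : ℕ) : 0 ≤ a j :=
  zero_le_one.trans (h.one_le j)

/-- The derivatives of `g` at `x` up to order `P` are bounded by `B a_j`. -/
def HasMaj (P : ℕ) (a : ℕ → ℝ) (B : ℝ) (g : E → F) (x : E) : Prop :=
  ∀ j ≤ P, ‖iteratedFDeriv ℝ j g x‖ ≤ B * a j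

theorem HasMaj.mono_order {P P' : ℕ} {a : ℕ → ℝ} {B : ℝ} {g : E → F} {x : E}
    (h : HasMaj P a B g x) (hP : P' ≤ P) : HasMaj P' a B g x := fun j hj => h j (hj.trans hP)

theorem HasMaj.mono {P : ℕ} {a a' : ℕ → ℝ} {B B' : ℝ} {g : E → F} {x : E}
    (h : HasMaj P a B g x) (hB : B ≤ B') (ha : ∀ j ≤ P, a j ≤ a' j) (ha0 : ∀ j, 0 ≤ a j)
    (hB0 : 0 ≤ B') : HasMaj P a' B' g x := fun j hj =>
  (h j hj).trans ((mul_le_mul_of_nonneg_right hB (ha0 j)).trans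
    (mul_le_mul_of_nonneg_left (ha j hj) hB0))

/-- Leibniz rule, with `2 ^ P` bounding the sum of the binomial coefficients. Three different
sequences are allowed so that one factor may carry a shifted majorant `a_{j+1}` or `a_{j+2}`. -/
theorem HasMaj.bilin (Bl : F →L[ℝ] G →L[ℝ] H) (hBl : ‖Bl‖ ≤ 1) {P : ℕ} {a b c : ℕ → ℝ}
    {B B' : ℝ} {f : E → F} {g : E → G} {x : E} (hf : ContDiff ℝ ∞ f) (hg : ContDiff ℝ ∞ g)
    (hB : 0 ≤ B) (hB' : 0 ≤ B') (ha : ∀ j, 0 ≤ a j)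
    (habc : ∀ i j, i + j ≤ P → a i * b j ≤ c (i + j)) (hc : ∀ j, 0 ≤ c j)
    (h : HasMaj P a B f x) (h' : HasMaj P b B' g x) :
    HasMaj P c (2 ^ P * B * B') (fun y => Bl (f y) (g y)) x := by
  intro j hj
  refine (Bl.norm_iteratedFDeriv_le_of_bilinear_of_le_one hf hg x (n := j)
    (by exact_mod_cast le_top) hBl).trans ?_
  have key : ∀ i ∈ Finset.range (j + 1),
      (j.choose i : ℝ) * ‖iteratedFDeriv ℝ i f x‖ * ‖iteratedFDeriv ℝ (j - i) g x‖
        ≤ (j.choose i : ℝ) * (B * B' * c j) := by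
    intro i hi
    have hi' : i ≤ j := Nat.lt_succ_iff.mp (Finset.mem_range.mp hi)
    have e : i + (j - i) = j := by omega
    rw [mul_assoc]
    refine mul_le_mul_of_nonneg_left ?_ (Nat.cast_nonneg _)
    calc _ ≤ (B * a i) * (B' * b (j - i)) :=
          mul_le_mul (h i (hi'.trans hj)) (h' (j - i) (by omega)) (norm_nonneg _)
            (mul_nonneg hB (ha i))
      _ = B * B' * (a i * b (j - i)) := by ring
      _ ≤ B * B' * c j := by
          refine mul_le_mul_of_nonneg_left ?_ (mul_nonneg hB hB')
          have := habc i (j - i) (by omega)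
          rwa [e] at this
  refine (Finset.sum_le_sum key).trans ?_
  rw [← Finset.sum_mul]
  have h2 : (∑ i ∈ Finset.range (j + 1), (j.choose i : ℝ)) = 2 ^ j := by
    exact_mod_cast Nat.sum_range_choose j
  rw [h2]
  have h3 : (2 : ℝ) ^ j ≤ 2 ^ P := pow_le_pow_right₀ (by norm_num) hj
  have h4 : 0 ≤ B * B' * c j := mul_nonneg (mul_nonneg hB hB') (hc j)
  nlinarith [mul_le_mul_of_nonneg_right h3 h4]

theorem norm_lsmul_real_le : ‖(ContinuousLinearMap.lsmul ℝ ℝ : ℝ →L[ℝ] F →L[ℝ] F)‖ ≤ 1 :=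
  ContinuousLinearMap.opNorm_lsmul_le

theorem HasMaj.smul {P : ℕ} {a b c : ℕ → ℝ}
    {B B' : ℝ} {f : E → ℝ} {g : E → G} {x : E} (hf : ContDiff ℝ ∞ f) (hg : ContDiff ℝ ∞ g)
    (hB : 0 ≤ B) (hB' : 0 ≤ B') (ha : ∀ j, 0 ≤ a j)
    (habc : ∀ i j, i + j ≤ P → a i * b j ≤ c (i + j)) (hc : ∀ j, 0 ≤ c j)
    (h : HasMaj P a B f x) (h' : HasMaj P b B' g x) :
    HasMaj P c (2 ^ P * B * B') (fun y => f y • g y) x :=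
  HasMaj.bilin (ContinuousLinearMap.lsmul ℝ ℝ) norm_lsmul_real_le hf hg hB hB' ha habc hc h h'

theorem HasMaj.add {P : ℕ} {a : ℕ → ℝ} {B B' : ℝ} {f g : E → F} {x : E}
    (hf : ContDiff ℝ ∞ f) (hg : ContDiff ℝ ∞ g) (h : HasMaj P a B f x) (h' : HasMaj P a B' g x) :
    HasMaj P a (B + B') (fun y => f y + g y) x := by
  intro j hj
  have : (fun y => f y + g y) = f + g := rfl
  rw [this, iteratedFDeriv_add (hf.of_le (by exact_mod_cast le_top))
    (hg.of_le (by exact_mod_cast le_top)), Pi.add_apply]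
  refine (norm_add_le _ _).trans ?_
  rw [add_mul]
  exact add_le_add (h j hj) (h' j hj)

theorem norm_iteratedFDeriv_sum_mul_le {ι : Type*} (s : Finset ι) (w : ι → ℝ) (hw : ∀ i, 0 ≤ w i)
    (g : ι → E → F) (hg : ∀ i, ContDiff ℝ ∞ (g i)) (j : ℕ) (x : E) :
    ‖iteratedFDeriv ℝ j (fun y => ∑ i ∈ s, w i • g i y) x‖
      ≤ ∑ i ∈ s, w i * ‖iteratedFDeriv ℝ j (g i) x‖ := by
  have hg' : ∀ i, ContDiff ℝ j (g i) := fun i => (hg i).of_le (by exact_mod_cast le_top)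
  rw [iteratedFDeriv_sum (fun i _ => (hg' i).const_smul (w i)), Finset.sum_apply]
  refine (norm_sum_le _ _).trans (Finset.sum_le_sum fun i _ => ?_)
  have : (fun y => w i • g i y) = w i • g i := rfl
  rw [this, iteratedFDeriv_const_smul_apply (hg' i).contDiffAt, norm_smul, Real.norm_eq_abs,
    abs_of_nonneg (hw i)]

theorem HasMaj.fderiv {P : ℕ} {a : ℕ → ℝ} {B : ℝ} {g : E → F} {x : E}
    (h : HasMaj (P + 1) a B g x) : HasMaj P (fun j => a (j + 1)) B (fderiv ℝ g) x := by
  intro j hj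
  rw [norm_iteratedFDeriv_fderiv]
  exact h (j + 1) (by omega)

theorem HasMaj.succ {P : ℕ} {a : ℕ → ℝ} {B B' C : ℝ} {g : E → F} {x : E} (ha : ∀ j, 0 ≤ a j)
    (h : HasMaj P a B g x) (h' : HasMaj P (fun j => a (j + 1)) B' (_root_.fderiv ℝ g) x)
    (hB : B ≤ C) (hB' : B' ≤ C) : HasMaj (P + 1) a C g x := by
  intro j hj
  rcases Nat.eq_or_lt_of_le hj with rfl | hlt
  · rw [← norm_iteratedFDeriv_fderiv]
    exact (h' P le_rfl).trans (mul_le_mul_of_nonneg_right hB' (ha _))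
  · exact (h j (by omega)).trans (mul_le_mul_of_nonneg_right hB (ha _))

theorem contDiff_fderiv_infty {g : E → F} (hg : ContDiff ℝ ∞ g) :
    ContDiff ℝ ∞ (_root_.fderiv ℝ g) :=
  hg.fderiv_right (by simp)

/-- Induction on the order through `D(1/g) = -g⁻² Dg`: the right side needs `1/g` to one order less.
Measuring everything relative to the value at `x` makes the powers of `g x` cancel, so the constant
depends on `P` and `C` only. -/
theorem HasMaj.inv (P : ℕ) (C : ℝ) (hC : 0 ≤ C) : ∃ C', 0 ≤ C' ∧ ∀ (a : ℕ → ℝ) (g : E → ℝ) (x : E),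
    SubMul P a → ContDiff ℝ ∞ g → (∀ y, 0 < g y) → HasMaj P a (C * g x) g x →
    HasMaj P a (C' * (g x)⁻¹) (fun y => (g y)⁻¹) x := by
  induction P with
  | zero =>
    refine ⟨1, zero_le_one, fun a g x ha hg hpos h => ?_⟩
    intro j hj
    obtain rfl : j = 0 := by omega
    rw [norm_iteratedFDeriv_zero, Real.norm_eq_abs, abs_of_pos (inv_pos.mpr (hpos x)), one_mul]
    exact le_mul_of_one_le_right (inv_pos.mpr (hpos x)).le (ha.one_le 0)
  | succ P ih =>
    obtain ⟨C', hC', H⟩ := ih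
    refine ⟨max C' (2 ^ P * (2 ^ P * C' * C') * C), le_max_of_le_left hC',
      fun a g x ha hg hpos h => ?_⟩
    have hgi : ContDiff ℝ ∞ (fun y => (g y)⁻¹) := hg.inv fun y => (hpos y).ne'
    have h1 := H a g x (ha.mono (Nat.le_succ P)) hg hpos (h.mono_order (Nat.le_succ P))
    have hp := inv_pos.mpr (hpos x)
    have hb : 0 ≤ C' * (g x)⁻¹ := mul_nonneg hC' hp.le
    have h2 : HasMaj P a (2 ^ P * (C' * (g x)⁻¹) * (C' * (g x)⁻¹))
        (fun y => (g y)⁻¹ • (g y)⁻¹) x :=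
      HasMaj.smul hgi hgi hb hb ha.nonneg (fun i j hij => ha.mul_le i j (by omega)) ha.nonneg h1 h1
    have h3 := h.fderiv
    have h4 := HasMaj.smul (c := fun j => a (j + 1)) (hgi.smul hgi) (contDiff_fderiv_infty hg)
      (by positivity) (mul_nonneg hC (hpos x).le) ha.nonneg
      (fun i j hij => (ha.mul_le i (j + 1) (by omega))) (fun j => ha.nonneg _) h2 h3
    have e : _root_.fderiv ℝ (fun y => (g y)⁻¹) =
        fun y => -(((g y)⁻¹ • (g y)⁻¹) • _root_.fderiv ℝ g y) := by
      funext y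
      have hd := ((hg.differentiable (by simp)) y).hasFDerivAt
      have := (hasDerivAt_inv (hpos y).ne').comp_hasFDerivAt y hd
      rw [show (fun y => (g y)⁻¹) = Inv.inv ∘ g from rfl, this.fderiv, ← neg_smul]
      congr 1
      have := (hpos y).ne'
      simp [sq]
    have h5 : HasMaj P (fun j => a (j + 1))
        (2 ^ P * (2 ^ P * (C' * (g x)⁻¹) * (C' * (g x)⁻¹)) * (C * g x))
        (_root_.fderiv ℝ (fun y => (g y)⁻¹)) x := by
      intro j hj
      rw [e]
      have := h4 j hj
      have e2 : (fun y => -(((g y)⁻¹ • (g y)⁻¹) • _root_.fderiv ℝ g y)) =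
        -(fun y => (((g y)⁻¹ • (g y)⁻¹) • _root_.fderiv ℝ g y)) := rfl
      rw [e2, iteratedFDeriv_neg, Pi.neg_apply, norm_neg]
      exact this
    refine HasMaj.succ ha.nonneg h1 h5 (mul_le_mul_of_nonneg_right (le_max_left _ _) hp.le) ?_
    have : 2 ^ P * (2 ^ P * (C' * (g x)⁻¹) * (C' * (g x)⁻¹)) * (C * g x)
        = (2 ^ P * (2 ^ P * C' * C') * C) * (g x)⁻¹ := by
      have := (hpos x).ne'
      field_simp
    rw [this]
    exact mul_le_mul_of_nonneg_right (le_max_right _ _) hp.le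

/-- From `D log g = g⁻¹ Dg` and the bound for `g⁻¹`. Order `0` is left out because the logarithm
itself is not controlled by relative sizes. -/
theorem HasMaj.log (P : ℕ) (C : ℝ) (hC : 0 ≤ C) : ∃ C', 0 ≤ C' ∧ ∀ (a : ℕ → ℝ) (g : E → ℝ) (x : E),
    SubMul P a → ContDiff ℝ ∞ g → (∀ y, 0 < g y) → HasMaj P a (C * g x) g x →
    ∀ j, 1 ≤ j → j ≤ P → ‖iteratedFDeriv ℝ j (fun y => Real.log (g y)) x‖ ≤ C' * a j := by
  obtain ⟨C', hC', H⟩ := HasMaj.inv (E := E) P C hC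
  refine ⟨2 ^ P * C' * C, by positivity, fun a g x ha hg hpos h => ?_⟩
  intro j hj1 hjP
  obtain ⟨i, rfl⟩ : ∃ i, j = i + 1 := ⟨j - 1, by omega⟩
  obtain ⟨P, rfl⟩ : ∃ P', P = P' + 1 := ⟨P - 1, by omega⟩
  have hgi : ContDiff ℝ ∞ (fun y => (g y)⁻¹) := hg.inv fun y => (hpos y).ne'
  have hp := inv_pos.mpr (hpos x)
  have h1 := (H a g x ha hg hpos h).mono_order (Nat.le_succ P)
  have h4 := HasMaj.smul (c := fun j => a (j + 1)) hgi (contDiff_fderiv_infty hg)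
      (mul_nonneg hC' hp.le) (mul_nonneg hC (hpos x).le) ha.nonneg
      (fun i j hij => (ha.mul_le i (j + 1) (by omega))) (fun j => ha.nonneg _) h1 h.fderiv
  have e : _root_.fderiv ℝ (fun y => Real.log (g y)) = fun y => (g y)⁻¹ • _root_.fderiv ℝ g y := by
    funext y
    exact (((hg.differentiable (by simp)) y).hasFDerivAt.log (hpos y).ne').fderiv
  rw [← norm_iteratedFDeriv_fderiv, e]
  refine (h4 i (by omega)).trans (mul_le_mul_of_nonneg_right ?_ (ha.nonneg _))
  have : 2 ^ P * (C' * (g x)⁻¹) * (C * g x) = 2 ^ P * C' * C := by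
    have := (hpos x).ne'
    field_simp
  rw [this, pow_succ]
  have : 0 ≤ 2 ^ P * C' * C := by positivity
  nlinarith

/-- Induction on the order through `D e^A = e^A DA`. The value of `A` enters only through the factor
`exp (A x)`, so only orders at least `1` need a bound; this matches what `HasMaj.log` provides. -/
theorem HasMaj.exp (P : ℕ) (C : ℝ) (hC : 0 ≤ C) : ∃ C', 0 ≤ C' ∧ ∀ (a : ℕ → ℝ) (A : E → ℝ) (x : E),
    SubMul P a → ContDiff ℝ ∞ A → (∀ j, 1 ≤ j → j ≤ P → ‖iteratedFDeriv ℝ j A x‖ ≤ C * a j) →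
    HasMaj P a (C' * Real.exp (A x)) (fun y => Real.exp (A y)) x := by
  induction P with
  | zero =>
    refine ⟨1, zero_le_one, fun a g x ha hg h => ?_⟩
    intro j hj
    obtain rfl : j = 0 := by omega
    rw [norm_iteratedFDeriv_zero, Real.norm_eq_abs, abs_of_pos (Real.exp_pos _), one_mul]
    exact le_mul_of_one_le_right (Real.exp_pos _).le (ha.one_le 0)
  | succ P ih =>
    obtain ⟨C', hC', H⟩ := ih
    refine ⟨max C' (2 ^ P * C' * C), le_max_of_le_left hC', fun a A x ha hA h => ?_⟩
    have hE : ContDiff ℝ ∞ (fun y => Real.exp (A y)) := Real.contDiff_exp.comp hA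
    have h1 := H a A x (ha.mono (Nat.le_succ P)) hA (fun j h1 h2 => h j h1 (by omega))
    have hp := Real.exp_pos (A x)
    have h3 : HasMaj P (fun j => a (j + 1)) C (_root_.fderiv ℝ A) x := by
      intro j hj
      rw [norm_iteratedFDeriv_fderiv]
      exact h (j + 1) (by omega) (by omega)
    have h4 := HasMaj.smul (c := fun j => a (j + 1)) hE (contDiff_fderiv_infty hA)
      (by positivity) hC ha.nonneg
      (fun i j hij => (ha.mul_le i (j + 1) (by omega))) (fun j => ha.nonneg _) h1 h3
    have e : _root_.fderiv ℝ (fun y => Real.exp (A y)) =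
        fun y => Real.exp (A y) • _root_.fderiv ℝ A y := by
      funext y
      exact (((hA.differentiable (by simp)) y).hasFDerivAt.exp).fderiv
    rw [← e] at h4
    refine HasMaj.succ ha.nonneg h1 h4 (mul_le_mul_of_nonneg_right (le_max_left _ _) hp.le) ?_
    have : 2 ^ P * (C' * Real.exp (A x)) * C = (2 ^ P * C' * C) * Real.exp (A x) := by ring
    rw [this]
    exact mul_le_mul_of_nonneg_right (le_max_right _ _) hp.le

end Majorant

/-! ### Partial derivatives -/

section Partial

variable {N : ℕ} {F : Type*} [NormedAddCommGroup F] [NormedSpace ℝ F]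

/-- The partial derivative `∂_i g` of a vector-valued function. -/
noncomputable def pd (i : Fin N) (g : Sp N → F) : Sp N → F :=
  fun x => fderiv ℝ g x (EuclideanSpace.single i 1)

/-- The Laplacian `∑ ∂_i² g`. -/
noncomputable def lap (g : Sp N → F) : Sp N → F := fun x => ∑ i, pd i (pd i g) x

theorem norm_single_one (i : Fin N) : ‖(EuclideanSpace.single i (1 : ℝ) : Sp N)‖ = 1 := by simp

theorem contDiff_pd (i : Fin N) {g : Sp N → F} (hg : ContDiff ℝ ∞ g) : ContDiff ℝ ∞ (pd i g) :=
  (contDiff_fderiv_infty hg).clm_apply contDiff_const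

theorem contDiff_lap {g : Sp N → F} (hg : ContDiff ℝ ∞ g) : ContDiff ℝ ∞ (lap g) :=
  ContDiff.sum fun i _ => contDiff_pd i (contDiff_pd i hg)

theorem norm_iteratedFDeriv_pd_le (i : Fin N) {g : Sp N → F} (hg : ContDiff ℝ ∞ g) (j : ℕ)
    (x : Sp N) : ‖iteratedFDeriv ℝ j (pd i g) x‖ ≤ ‖iteratedFDeriv ℝ (j + 1) g x‖ := by
  rw [← norm_iteratedFDeriv_fderiv]
  have h := (ContinuousLinearMap.apply ℝ F (EuclideanSpace.single i (1 : ℝ) : Sp N)).norm_iteratedFDeriv_comp_left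
    (x := x) (contDiff_fderiv_infty hg).contDiffAt (n := j) (by exact_mod_cast le_top)
  refine h.trans ?_
  refine mul_le_of_le_one_left (norm_nonneg _) ?_
  refine ContinuousLinearMap.opNorm_le_bound _ zero_le_one fun T => ?_
  have := T.le_opNorm (EuclideanSpace.single i (1 : ℝ) : Sp N)
  rw [norm_single_one] at this
  simpa [one_mul] using this

theorem norm_iteratedFDeriv_lap_le {g : Sp N → F} (hg : ContDiff ℝ ∞ g) (j : ℕ)
    (x : Sp N) : ‖iteratedFDeriv ℝ j (lap g) x‖ ≤ N * ‖iteratedFDeriv ℝ (j + 2) g x‖ := by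
  have h := norm_iteratedFDeriv_sum_mul_le (Finset.univ) (fun _ : Fin N => (1 : ℝ))
    (fun _ => zero_le_one) (fun i => pd i (pd i g))
    (fun i => contDiff_pd i (contDiff_pd i hg)) j x
  simp only [one_smul, one_mul] at h
  refine h.trans ?_
  refine (Finset.sum_le_card_nsmul _ _ (‖iteratedFDeriv ℝ (j + 2) g x‖) fun i _ => ?_).trans ?_
  · exact (norm_iteratedFDeriv_pd_le i (contDiff_pd i hg) j x).trans
      (norm_iteratedFDeriv_pd_le i hg (j + 1) x)
  · simp

theorem eq_sum_single (x : Sp N) : x = ∑ i, x i • (EuclideanSpace.single i (1 : ℝ) : Sp N) := by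
  have := (EuclideanSpace.basisFun (Fin N) ℝ).sum_repr x
  simpa using this.symm

/-- The differential is the sum of the `∂_i g` tensored with the coordinate forms, and tensoring
with a form of norm at most one is a contraction. -/
theorem norm_iteratedFDeriv_succ_le {g : Sp N → F} (hg : ContDiff ℝ ∞ g) (j : ℕ) (x : Sp N) :
    ‖iteratedFDeriv ℝ (j + 1) g x‖ ≤ ∑ i, ‖iteratedFDeriv ℝ j (pd i g) x‖ := by
  rw [← norm_iteratedFDeriv_fderiv]
  have e : fderiv ℝ g = fun y => ∑ i, (1 : ℝ) •
      (ContinuousLinearMap.smulRightL ℝ (Sp N) F (EuclideanSpace.proj i) (pd i g y)) := by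
    funext y
    ext z
    simp only [one_smul, _root_.sum_apply,
      ContinuousLinearMap.smulRightL_apply_apply]
    conv_lhs => rw [eq_sum_single z, map_sum]
    exact Finset.sum_congr rfl fun i _ => by simp [pd]
  rw [e]
  refine (norm_iteratedFDeriv_sum_mul_le Finset.univ (fun _ => (1 : ℝ)) (fun _ => zero_le_one) _
    (fun i => (ContinuousLinearMap.contDiff _).comp (contDiff_pd i hg)) j x).trans ?_
  refine Finset.sum_le_sum fun i _ => ?_
  rw [one_mul]
  refine ((ContinuousLinearMap.smulRightL ℝ (Sp N) F (EuclideanSpace.proj i)).norm_iteratedFDeriv_comp_left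
    (contDiff_pd i hg).contDiffAt (n := j) (by exact_mod_cast le_top)).trans ?_
  refine mul_le_of_le_one_left (norm_nonneg _) ?_
  refine ContinuousLinearMap.opNorm_le_bound _ zero_le_one fun c => ?_
  rw [one_mul]
  refine ContinuousLinearMap.opNorm_le_bound _ (norm_nonneg _) fun z => ?_
  rw [ContinuousLinearMap.smulRightL_apply_apply, ContinuousLinearMap.smulRight_apply, norm_smul,
    mul_comm]
  exact mul_le_mul_of_nonneg_left (PiLp.norm_apply_le z i) (norm_nonneg _)

theorem two_le_infty : (2 : ℕ∞ω) ≤ (∞ : ℕ∞ω) :=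
  WithTop.coe_le_coe.mpr (le_top : (2 : ℕ∞) ≤ ⊤)

theorem pd_comm (i j : Fin N) {g : Sp N → F} (hg : ContDiff ℝ 2 g) :
    pd i (pd j g) = pd j (pd i g) := by
  funext x
  have hd : DifferentiableAt ℝ (fderiv ℝ g) x :=
    ((hg.fderiv_right (m := 1) (by norm_num)).differentiable (by norm_num)) x
  have h : ∀ v : Sp N, fderiv ℝ (fun y => fderiv ℝ g y v) x = (fderiv ℝ (fderiv ℝ g) x).flip v := by
    intro v
    have := (hd.hasFDerivAt.clm_apply (hasFDerivAt_const v x)).fderiv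
    rw [this]; ext z; simp
  have hs : IsSymmSndFDerivAt ℝ g x := hg.contDiffAt.isSymmSndFDerivAt (by simp)
  change fderiv ℝ (fun y => fderiv ℝ g y _) x _ = fderiv ℝ (fun y => fderiv ℝ g y _) x _
  rw [h, h, ContinuousLinearMap.flip_apply, ContinuousLinearMap.flip_apply]
  exact hs _ _

/-! ### Iterated partial derivatives of smooth real functions -/

/-- `D^β` taken along a list of coordinates. -/
noncomputable def foldPartial (l : List (Fin N)) (β : Fin N → ℕ) (φ : Sp N → ℝ) : Sp N → ℝ :=
  l.foldr (fun i g => (partialDeriv i)^[β i] g) φ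

theorem contDiff_partialDeriv_iterate (i : Fin N) (p : ℕ) {φ : Sp N → ℝ} (h : ContDiff ℝ ∞ φ) :
    ContDiff ℝ ∞ ((partialDeriv i)^[p] φ) := by
  induction p with
  | zero => exact h
  | succ p ih => rw [Function.iterate_succ_apply']; exact contDiff_pd i ih

theorem contDiff_foldPartial (l : List (Fin N)) (β : Fin N → ℕ) {φ : Sp N → ℝ}
    (h : ContDiff ℝ ∞ φ) : ContDiff ℝ ∞ (foldPartial l β φ) := by
  induction l with
  | nil => exact h
  | cons i l ih => exact contDiff_partialDeriv_iterate i _ ih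

theorem contDiff_iterPartial (β : Fin N → ℕ) {φ : Sp N → ℝ} (h : ContDiff ℝ ∞ φ) :
    ContDiff ℝ ∞ (iterPartial β φ) := contDiff_foldPartial _ β h

theorem partialDeriv_iterate_comm (i j : Fin N) (p : ℕ) {φ : Sp N → ℝ} (h : ContDiff ℝ ∞ φ) :
    (partialDeriv i)^[p] (partialDeriv j φ) = partialDeriv j ((partialDeriv i)^[p] φ) := by
  induction p with
  | zero => rfl
  | succ p ih =>
    rw [Function.iterate_succ_apply', ih, Function.iterate_succ_apply']
    exact pd_comm i j ((contDiff_partialDeriv_iterate i p h).of_le two_le_infty)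

theorem foldPartial_comm (l : List (Fin N)) (β : Fin N → ℕ) (j : Fin N) {φ : Sp N → ℝ}
    (h : ContDiff ℝ ∞ φ) : foldPartial l β (partialDeriv j φ) = partialDeriv j (foldPartial l β φ) := by
  induction l with
  | nil => rfl
  | cons i l ih =>
    change (partialDeriv i)^[β i] (foldPartial l β (partialDeriv j φ)) = _
    rw [ih, partialDeriv_iterate_comm i j _ (contDiff_foldPartial l β h)]
    rfl

/-- `D^β` is a fold in a fixed order of the coordinates. Symmetry of second derivatives moves one
extra `∂_j` to the innermost place, which opens the way to induction on multi-indices. Without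
repetition in the list, the extra derivative is counted once. -/
theorem foldPartial_add_single (l : List (Fin N)) (hl : l.Nodup) (β : Fin N → ℕ) (j : Fin N)
    {φ : Sp N → ℝ} (h : ContDiff ℝ ∞ φ) : foldPartial l (β + Pi.single j 1) φ =
      if j ∈ l then foldPartial l β (partialDeriv j φ) else foldPartial l β φ := by
  induction l with
  | nil => simp [foldPartial]
  | cons i l ih =>
    have hi : i ∉ l := (List.nodup_cons.mp hl).1
    have e : foldPartial (i :: l) (β + Pi.single j 1) φ =
      (partialDeriv i)^[β i + (Pi.single j 1 : Fin N → ℕ) i] (foldPartial l (β + Pi.single j 1) φ) := rfl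
    have e' : ∀ ψ, foldPartial (i :: l) β ψ = (partialDeriv i)^[β i] (foldPartial l β ψ) :=
      fun _ => rfl
    rw [e, ih (List.nodup_cons.mp hl).2]
    by_cases hij : j = i
    · subst hij
      simp only [hi, if_false, List.mem_cons, true_or, if_true, Pi.single_eq_same]
      rw [Function.iterate_succ_apply, e', foldPartial_comm l β j h]
    · simp only [List.mem_cons, hij, false_or, Pi.single_eq_of_ne (Ne.symm hij), add_zero]
      by_cases hj : j ∈ l <;> simp [hj, e']

theorem iterPartial_add_single (β : Fin N → ℕ) (j : Fin N) {φ : Sp N → ℝ} (h : ContDiff ℝ ∞ φ) :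
    iterPartial (β + Pi.single j 1) φ = iterPartial β (partialDeriv j φ) := by
  have := foldPartial_add_single (List.finRange N) (List.nodup_finRange N) β j h
  rw [if_pos (List.mem_finRange j)] at this
  exact this

theorem iterPartial_partialDeriv (β : Fin N → ℕ) (j : Fin N) {φ : Sp N → ℝ} (h : ContDiff ℝ ∞ φ) :
    iterPartial β (partialDeriv j φ) = partialDeriv j (iterPartial β φ) :=
  foldPartial_comm _ β j h

theorem iterPartial_zero (φ : Sp N → ℝ) : iterPartial (0 : Fin N → ℕ) φ = φ := by
  unfold iterPartial
  induction List.finRange N with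
  | nil => rfl
  | cons i l ih => exact ih

theorem order_add_single (β : Fin N → ℕ) (j : Fin N) : order (β + Pi.single j 1) = order β + 1 := by
  simp [order, Finset.sum_add_distrib]

theorem order_zero : order (0 : Fin N → ℕ) = 0 := by simp [order]

theorem exists_eq_add_single {β : Fin N → ℕ} {p : ℕ} (h : order β = p + 1) :
    ∃ γ : Fin N → ℕ, ∃ j, β = γ + Pi.single j 1 ∧ order γ = p := by
  obtain ⟨j, hj⟩ : ∃ j, β j ≠ 0 := by
    by_contra hne
    push Not at hne
    have : order β = 0 := by simp [order, hne]
    omega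
  refine ⟨β - Pi.single j 1, j, ?_, ?_⟩
  · funext i
    by_cases hij : i = j
    · subst hij; simp; omega
    · simp [hij]
  · have e : β = (β - Pi.single j 1) + Pi.single j 1 := by
      funext i
      by_cases hij : i = j
      · subst hij; simp; omega
      · simp [hij]
    have := order_add_single (β - Pi.single j 1) j
    rw [← e] at this
    omega

/-- Induction on multi-indices by adding a unit vector. -/
theorem order_induction {p : (Fin N → ℕ) → Prop} (h0 : p 0)
    (hs : ∀ β j, p β → p (β + Pi.single j 1)) (β : Fin N → ℕ) : p β := by
  generalize hq : order β = q
  induction q generalizing β with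
  | zero =>
    have : β = 0 := by
      funext i
      have := (Finset.sum_eq_zero_iff.mp hq) i (Finset.mem_univ i)
      simpa using this
    rw [this]; exact h0
  | succ q ih =>
    obtain ⟨γ, j, rfl, hγ⟩ := exists_eq_add_single hq
    exact hs _ _ (ih γ hγ)

theorem norm_iteratedFDeriv_iterPartial_le (β : Fin N → ℕ) :
    ∀ {φ : Sp N → ℝ}, ContDiff ℝ ∞ φ → ∀ (j : ℕ) (x : Sp N),
      ‖iteratedFDeriv ℝ j (iterPartial β φ) x‖ ≤ ‖iteratedFDeriv ℝ (j + order β) φ x‖ := by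
  induction β using order_induction with
  | h0 => intro φ _ j x; rw [iterPartial_zero, order_zero]; rfl
  | hs β i ih =>
    intro φ h j x
    rw [iterPartial_add_single β i h, order_add_single]
    refine (ih (contDiff_pd i h) j x).trans ?_
    exact norm_iteratedFDeriv_pd_le i h _ x

theorem norm_iterPartial_le (β : Fin N → ℕ) {φ : Sp N → ℝ} (h : ContDiff ℝ ∞ φ) (x : Sp N) :
    ‖iterPartial β φ x‖ ≤ ‖iteratedFDeriv ℝ (order β) φ x‖ := by
  have := norm_iteratedFDeriv_iterPartial_le β h 0 x
  rwa [norm_iteratedFDeriv_zero, zero_add] at this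

theorem hasCompactSupport_iterPartial (β : Fin N → ℕ) :
    ∀ {φ : Sp N → ℝ}, ContDiff ℝ ∞ φ → HasCompactSupport φ →
      HasCompactSupport (iterPartial β φ) := by
  induction β using order_induction with
  | h0 => intro φ _ h; rwa [iterPartial_zero]
  | hs β i ih =>
    intro φ h hc
    rw [iterPartial_add_single β i h]
    exact ih (contDiff_pd i h) (hc.fderiv_apply ℝ _)

end Partial

/-! ### Pointwise estimates for the regularized amplitude -/

section Core

variable {N : ℕ}

/-- `-Im (ū Δu) / |u|²`: the rate of growth of `log |u|` under the free Schrödinger flow. -/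
noncomputable def phaseRate (u : Sp N → ℂ) : Sp N → ℝ :=
  fun y => (‖u y‖ ^ 2)⁻¹ • inner ℝ ((-Complex.I) • u y) (lap u y)

theorem norm_innerSL_real_le : ‖(innerSL ℝ : ℂ →L[ℝ] ℂ →L[ℝ] ℝ)‖ ≤ 1 := by
  refine ContinuousLinearMap.opNorm_le_bound _ zero_le_one fun z => ?_
  rw [innerSL_apply_norm, one_mul]

theorem HasMaj.norm_sq {P : ℕ} {a : ℕ → ℝ} {C₀ : ℝ} (hC₀ : 0 ≤ C₀) {u : Sp N → ℂ} {x : Sp N}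
    (ha : SubMul P a) (hu : ContDiff ℝ ∞ u) (h : HasMaj P a (C₀ * ‖u x‖) u x) :
    HasMaj P a ((2 ^ P * C₀ * C₀) * ‖u x‖ ^ 2) (fun y => ‖u y‖ ^ 2) x := by
  have hb : 0 ≤ C₀ * ‖u x‖ := by positivity
  have := HasMaj.bilin (innerSL ℝ : ℂ →L[ℝ] ℂ →L[ℝ] ℝ) norm_innerSL_real_le hu hu hb hb ha.nonneg
    ha.mul_le ha.nonneg h h
  have e : (fun y => ‖u y‖ ^ 2) = fun y => innerSL ℝ (u y) (u y) :=
    funext fun y => (real_inner_self_eq_norm_sq (u y)).symm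
  rw [e]
  convert! this using 1
  ring

theorem HasMaj.const_smul_norm {F : Type*} [NormedAddCommGroup F] [NormedSpace ℝ F]
    [NormedSpace ℂ F] [SMulCommClass ℝ ℂ F] {P : ℕ} {a : ℕ → ℝ} {B : ℝ}
    (c : ℂ) {u : Sp N → F} {x : Sp N} (hu : ContDiff ℝ ∞ u) (h : HasMaj P a B u x) :
    HasMaj P a (‖c‖ * B) (fun y => c • u y) x := by
  intro j hj
  have e : (fun y => c • u y) = c • u := rfl
  rw [e, iteratedFDeriv_const_smul_apply (hu.contDiffAt.of_le (by exact_mod_cast le_top)),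
    norm_smul, mul_assoc]
  exact mul_le_mul_of_nonneg_left (h j hj) (norm_nonneg _)

theorem contDiff_norm_sq' {u : Sp N → ℂ} (hu : ContDiff ℝ ∞ u) :
    ContDiff ℝ ∞ (fun y => ‖u y‖ ^ 2) := hu.norm_sq ℝ

theorem contDiff_phaseRate {u : Sp N → ℂ} (hu : ContDiff ℝ ∞ u) (hne : ∀ y, u y ≠ 0) :
    ContDiff ℝ ∞ (phaseRate u) :=
  ((contDiff_norm_sq' hu).inv fun y => pow_ne_zero 2 (norm_ne_zero_iff.mpr (hne y))).smul
    ((hu.const_smul (-Complex.I)).inner ℝ (contDiff_lap hu))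

/-- The quotient `Im(ū Δu)/|u|²` is homogeneous of degree zero in `u`, so the factors `‖u x‖`
cancel. The Laplacian costs two orders, whence the shift of the majorant. -/
theorem HasMaj.phaseRate (P : ℕ) (C₀ : ℝ) (hC₀ : 0 ≤ C₀) : ∃ C, 0 ≤ C ∧
    ∀ (a : ℕ → ℝ) (u : Sp N → ℂ) (x : Sp N), SubMul (P + 2) a → ContDiff ℝ ∞ u →
      (∀ y, u y ≠ 0) → HasMaj (P + 2) a (C₀ * ‖u x‖) u x →
      HasMaj P (fun j => a (j + 2)) C (DissipativeNLS.phaseRate u) x := by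
  obtain ⟨C', hC', H⟩ := HasMaj.inv (E := Sp N) P (2 ^ P * C₀ * C₀) (by positivity)
  refine ⟨2 ^ P * C' * (2 ^ P * C₀ * (N * C₀)), by positivity, fun a u x ha hu hne h => ?_⟩
  have hpos : ∀ y, 0 < ‖u y‖ ^ 2 := fun y => pow_pos (norm_pos_iff.mpr (hne y)) 2
  have ha' : SubMul P a := ha.mono (by omega)
  have hP := h.mono_order (show P ≤ P + 2 by omega)
  have h1 := H a _ x ha' (contDiff_norm_sq' hu) hpos (hP.norm_sq hC₀ ha' hu)
  have h2 : HasMaj P a (C₀ * ‖u x‖) (fun y => (-Complex.I) • u y) x := by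
    have := hP.const_smul_norm (-Complex.I) hu
    simpa using this
  have h3 : HasMaj P (fun j => a (j + 2)) (N * (C₀ * ‖u x‖)) (lap u) x := by
    intro j hj
    refine (norm_iteratedFDeriv_lap_le hu j x).trans ?_
    rw [mul_assoc]
    exact mul_le_mul_of_nonneg_left (h (j + 2) (by omega)) (Nat.cast_nonneg _)
  have hmul : ∀ i j, i + j ≤ P → a i * a (j + 2) ≤ a (i + j + 2) :=
    fun i j hij => ha.mul_le i (j + 2) (by omega)
  have h4 := HasMaj.bilin (c := fun j => a (j + 2)) (innerSL ℝ : ℂ →L[ℝ] ℂ →L[ℝ] ℝ)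
    norm_innerSL_real_le (hu.const_smul (-Complex.I)) (contDiff_lap hu) (by positivity)
    (by positivity) ha.nonneg hmul (fun j => ha.nonneg _) h2 h3
  have h5 := HasMaj.smul (c := fun j => a (j + 2))
    ((contDiff_norm_sq' hu).inv fun y => (hpos y).ne')
    ((hu.const_smul (-Complex.I)).inner ℝ (contDiff_lap hu))
    (by positivity) (by positivity) ha.nonneg hmul (fun j => ha.nonneg _) h1 h4
  convert! h5 using 1
  have := norm_ne_zero_iff.mpr (hne x)
  field_simp

theorem rpow_neg_eq_exp_log {r : ℝ} (hr : 0 < r) (α : ℝ) :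
    r ^ (-α) = Real.exp ((-α / 2) * Real.log (r ^ 2)) := by
  rw [Real.rpow_def_of_pos hr, Real.log_pow]
  congr 1
  push_cast
  ring

theorem contDiff_norm_rpow_neg {u : Sp N → ℂ} (hu : ContDiff ℝ ∞ u) (hne : ∀ y, u y ≠ 0) (α : ℝ) :
    ContDiff ℝ ∞ (fun y => ‖u y‖ ^ (-α)) := by
  have e : (fun y => ‖u y‖ ^ (-α)) = fun y => Real.exp ((-α / 2) * Real.log (‖u y‖ ^ 2)) :=
    funext fun y => rpow_neg_eq_exp_log (norm_pos_iff.mpr (hne y)) α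
  rw [e]
  exact Real.contDiff_exp.comp (contDiff_const.mul
    ((contDiff_norm_sq' hu).log fun y => pow_ne_zero 2 (norm_ne_zero_iff.mpr (hne y))))

/-- Writing `|u|^{-α} = exp(-(α/2) log |u|²)` reduces the power to the smooth function `|u|²` and to
the bounds for `log` and `exp`. -/
theorem HasMaj.norm_rpow_neg (P : ℕ) (α C₀ : ℝ) (hC₀ : 0 ≤ C₀) : ∃ C, 0 ≤ C ∧
    ∀ (a : ℕ → ℝ) (u : Sp N → ℂ) (x : Sp N), SubMul P a → ContDiff ℝ ∞ u →
      (∀ y, u y ≠ 0) → HasMaj P a (C₀ * ‖u x‖) u x →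
      HasMaj P a (C * ‖u x‖ ^ (-α)) (fun y => ‖u y‖ ^ (-α)) x := by
  obtain ⟨C₁, hC₁, H₁⟩ := HasMaj.log (E := Sp N) P (2 ^ P * C₀ * C₀) (by positivity)
  obtain ⟨C₂, hC₂, H₂⟩ := HasMaj.exp (E := Sp N) P (|-α / 2| * C₁) (by positivity)
  refine ⟨C₂, hC₂, fun a u x ha hu hne h => ?_⟩
  have hpos : ∀ y, 0 < ‖u y‖ ^ 2 := fun y => pow_pos (norm_pos_iff.mpr (hne y)) 2
  have h1 := H₁ a _ x ha (contDiff_norm_sq' hu) hpos (h.norm_sq hC₀ ha hu)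
  have hl : ContDiff ℝ ∞ (fun y => Real.log (‖u y‖ ^ 2)) :=
    (contDiff_norm_sq' hu).log fun y => (hpos y).ne'
  have h2 := H₂ a (fun y => (-α / 2) * Real.log (‖u y‖ ^ 2)) x ha (contDiff_const.mul hl) (by
    intro j hj1 hj
    have e : (fun y => (-α / 2) * Real.log (‖u y‖ ^ 2))
      = (-α / 2) • (fun y => Real.log (‖u y‖ ^ 2)) := rfl
    rw [e, iteratedFDeriv_const_smul_apply (hl.contDiffAt.of_le (by exact_mod_cast le_top)),
      norm_smul, mul_assoc]
    exact mul_le_mul_of_nonneg_left (h1 j hj1 hj) (norm_nonneg _))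
  simpa only [← rpow_neg_eq_exp_log (norm_pos_iff.mpr (hne _))] using h2

/-- The discretized phase `α δ ∑_{l<i} L_l`. -/
noncomputable def discPhase (α δ : ℝ) (L : ℕ → Sp N → ℝ) (i : ℕ) : Sp N → ℝ :=
  fun y => ∑ l ∈ Finset.range i, (α * δ) • L l y

/-- The discretized denominator `w₀ + c δ ∑_{l<K} h_l exp (A_l)`. -/
noncomputable def discDen (c δ : ℝ) (h : ℕ → ℝ) (w₀ : Sp N → ℝ) (A : ℕ → Sp N → ℝ) (K : ℕ) :
    Sp N → ℝ :=
  fun y => w₀ y + ∑ l ∈ Finset.range K, (c * δ * h l) • Real.exp (A l y)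

/-- The discretized amplitude `exp (A_K) / (w₀ + c δ ∑_{l<K} h_l exp (A_l))`. -/
noncomputable def discAmp (c δ : ℝ) (h : ℕ → ℝ) (w₀ : Sp N → ℝ) (A : ℕ → Sp N → ℝ) (K : ℕ) :
    Sp N → ℝ :=
  fun y => (discDen c δ h w₀ A K y)⁻¹ • Real.exp (A K y)

theorem contDiff_discPhase (α δ : ℝ) {L : ℕ → Sp N → ℝ} (hL : ∀ l, ContDiff ℝ ∞ (L l)) (i : ℕ) :
    ContDiff ℝ ∞ (discPhase α δ L i) :=
  ContDiff.sum fun l _ => (hL l).const_smul _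

theorem discDen_ge {c δ : ℝ} (hc : 0 ≤ c) (hδ : 0 ≤ δ) {h : ℕ → ℝ} (hh : ∀ l, 0 ≤ h l)
    {w₀ : Sp N → ℝ} {A : ℕ → Sp N → ℝ} {K : ℕ} {y : Sp N} : w₀ y ≤ discDen c δ h w₀ A K y :=
  le_add_of_nonneg_right (Finset.sum_nonneg fun l _ => by
    have := hh l; simp only [smul_eq_mul]; positivity)

theorem contDiff_discDen {c δ : ℝ} {h : ℕ → ℝ} {w₀ : Sp N → ℝ} {A : ℕ → Sp N → ℝ} {K : ℕ}
    (hw₀ : ContDiff ℝ ∞ w₀) (hA : ∀ l, ContDiff ℝ ∞ (A l)) :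
    ContDiff ℝ ∞ (discDen c δ h w₀ A K) :=
  hw₀.add (ContDiff.sum fun l _ => (Real.contDiff_exp.comp (hA l)).const_smul _)

theorem contDiff_discAmp {c δ : ℝ} (hc : 0 ≤ c) (hδ : 0 ≤ δ) {h : ℕ → ℝ} (hh : ∀ l, 0 ≤ h l)
    {w₀ : Sp N → ℝ} {A : ℕ → Sp N → ℝ} {K : ℕ}
    (hw₀ : ContDiff ℝ ∞ w₀) (hpos : ∀ y, 0 < w₀ y) (hA : ∀ l, ContDiff ℝ ∞ (A l)) :
    ContDiff ℝ ∞ (discAmp c δ h w₀ A K) :=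
  ((contDiff_discDen hw₀ hA).inv fun y => ((hpos y).trans_le (discDen_ge hc hδ hh)).ne').smul
    (Real.contDiff_exp.comp (hA K))

/-- The denominator is a sum of positive terms, each with derivatives bounded relative to itself, so
the sum has the same property with a constant independent of the number of terms. Bounded phases
make every exponential comparable to `1`, and the size is that of the denominator with `A = 0`. -/
theorem HasMaj.discAmp (P : ℕ) (C₁ κ : ℝ) (hC₁ : 0 ≤ C₁) (hκ : 0 ≤ κ) : ∃ C, 0 ≤ C ∧
    ∀ (a : ℕ → ℝ) (c δ : ℝ) (h : ℕ → ℝ) (w₀ : Sp N → ℝ) (A : ℕ → Sp N → ℝ) (K : ℕ) (x : Sp N),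
      SubMul P a → 0 ≤ c → 0 ≤ δ → (∀ l, 0 ≤ h l) → ContDiff ℝ ∞ w₀ → (∀ y, 0 < w₀ y) →
      (∀ l, ContDiff ℝ ∞ (A l)) → (∀ l ≤ K, |A l x| ≤ κ) →
      (∀ l ≤ K, ∀ j, 1 ≤ j → j ≤ P → ‖iteratedFDeriv ℝ j (A l) x‖ ≤ C₁ * a j) →
      HasMaj P a (C₁ * w₀ x) w₀ x →
      HasMaj P a (C * (w₀ x + ∑ l ∈ Finset.range K, c * δ * h l)⁻¹)
        (DissipativeNLS.discAmp c δ h w₀ A K) x := by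
  obtain ⟨C₂, hC₂, H₂⟩ := HasMaj.exp (E := Sp N) P C₁ hC₁
  obtain ⟨C₃, hC₃, H₃⟩ := HasMaj.inv (E := Sp N) P (C₁ + C₂) (by positivity)
  refine ⟨2 ^ P * (C₃ * Real.exp κ) * (C₂ * Real.exp κ), by positivity,
    fun a c δ h w₀ A K x ha hc hδ hh hw₀ hpos hA hAκ hAj hw => ?_⟩
  have hE : ∀ l ≤ K, HasMaj P a (C₂ * Real.exp (A l x)) (fun y => Real.exp (A l y)) x :=
    fun l hl => H₂ a (A l) x ha (hA l) (hAj l hl)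
  have hsm : ∀ l, ContDiff ℝ ∞ (fun y => Real.exp (A l y)) := fun l => Real.contDiff_exp.comp (hA l)
  have hw0 : ∀ l, 0 ≤ c * δ * h l := fun l => mul_nonneg (mul_nonneg hc hδ) (hh l)
  set M := DissipativeNLS.discDen c δ h w₀ A K with hM
  have hMsm : ContDiff ℝ ∞ M := contDiff_discDen hw₀ hA
  have hMpos : ∀ y, 0 < M y := fun y => (hpos y).trans_le (discDen_ge hc hδ hh)
  have hsum : HasMaj P a (∑ l ∈ Finset.range K, (c * δ * h l) * (C₂ * Real.exp (A l x)))
      (fun y => ∑ l ∈ Finset.range K, (c * δ * h l) • Real.exp (A l y)) x := by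
    intro j hj
    refine (norm_iteratedFDeriv_sum_mul_le _ _ hw0 _ hsm j x).trans ?_
    rw [Finset.sum_mul]
    refine Finset.sum_le_sum fun l hl => ?_
    rw [mul_assoc (c * δ * h l)]
    exact mul_le_mul_of_nonneg_left (hE l (Finset.mem_range.mp hl).le j hj) (hw0 l)
  have hMmaj : HasMaj P a ((C₁ + C₂) * M x) M x := by
    have h1 := hw.add hw₀ (ContDiff.sum fun l _ => (hsm l).const_smul (c * δ * h l)) hsum
    refine HasMaj.mono h1 ?_ (fun j _ => le_rfl) ha.nonneg (mul_nonneg (by positivity) (hMpos x).le)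
    have e : M x = w₀ x + ∑ l ∈ Finset.range K, (c * δ * h l) * Real.exp (A l x) := rfl
    have e2 : ∑ l ∈ Finset.range K, (c * δ * h l) * (C₂ * Real.exp (A l x))
        = C₂ * ∑ l ∈ Finset.range K, (c * δ * h l) * Real.exp (A l x) := by
      rw [Finset.mul_sum]; exact Finset.sum_congr rfl fun l _ => by ring
    have hs0 : 0 ≤ ∑ l ∈ Finset.range K, (c * δ * h l) * Real.exp (A l x) :=
      Finset.sum_nonneg fun l _ => mul_nonneg (hw0 l) (Real.exp_pos _).le
    rw [e2, e]
    nlinarith [mul_nonneg hC₂ (hpos x).le, mul_nonneg hC₁ hs0]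
  have hinv := H₃ a M x ha hMsm hMpos hMmaj
  have hprod := HasMaj.smul (hMsm.inv fun y => (hMpos y).ne') (hsm K)
    (mul_nonneg hC₃ (inv_pos.mpr (hMpos x)).le) (by positivity) ha.nonneg ha.mul_le ha.nonneg
    hinv (hE K le_rfl)
  have hD : 0 < w₀ x + ∑ l ∈ Finset.range K, c * δ * h l :=
    add_pos_of_pos_of_nonneg (hpos x) (Finset.sum_nonneg fun l _ => hw0 l)
  refine HasMaj.mono hprod ?_ (fun j _ => le_rfl) ha.nonneg (by positivity)
  -- Only here and for `exp (A_K)` does the bound `κ` on the phases enter.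
  have hlow : Real.exp (-κ) * (w₀ x + ∑ l ∈ Finset.range K, c * δ * h l) ≤ M x := by
    have e : M x = w₀ x + ∑ l ∈ Finset.range K, (c * δ * h l) * Real.exp (A l x) := rfl
    rw [e, mul_add, Finset.mul_sum]
    refine add_le_add ?_ (Finset.sum_le_sum fun l hl => ?_)
    · exact mul_le_of_le_one_left (hpos x).le (Real.exp_le_one_iff.mpr (by linarith))
    · rw [mul_comm]
      refine mul_le_mul_of_nonneg_left (Real.exp_le_exp.mpr ?_) (hw0 l)
      exact (abs_le.mp (hAκ l (Finset.mem_range.mp hl).le)).1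
  have hMi : (M x)⁻¹ ≤ Real.exp κ * (w₀ x + ∑ l ∈ Finset.range K, c * δ * h l)⁻¹ := by
    have := inv_anti₀ (mul_pos (Real.exp_pos _) hD) hlow
    rwa [mul_inv, Real.exp_neg, inv_inv] at this
  have hEK : Real.exp (A K x) ≤ Real.exp κ :=
    Real.exp_le_exp.mpr (abs_le.mp (hAκ K le_rfl)).2
  calc _ ≤ 2 ^ P * (C₃ * (Real.exp κ * (w₀ x + ∑ l ∈ Finset.range K, c * δ * h l)⁻¹))
        * (C₂ * Real.exp κ) := by gcongr
    _ = _ := by ring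

end Core

/-! ### Weak derivatives -/

section Weak

variable {N : ℕ} {F : Type*} [NormedAddCommGroup F] [NormedSpace ℝ F]

theorem IsWeakDeriv.ae_eq [CompleteSpace F] {β : Fin N → ℕ} {u w w' : Sp N → F}
    (h : IsWeakDeriv β u w) (h' : IsWeakDeriv β u w') : w =ᵐ[volume] w' := by
  refine ae_eq_of_integral_contDiff_smul_eq h.2.1 h'.2.1 fun φ hφ hc => ?_
  have e := (h.2.2 φ hφ hc).symm.trans (h'.2.2 φ hφ hc)
  have h0 : ((-1 : ℝ) ^ order β) ≠ 0 := pow_ne_zero _ (by norm_num)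
  exact smul_right_injective F h0 e

theorem IsWeakDeriv.ae_eq_weakDeriv [CompleteSpace F] {β : Fin N → ℕ} {u w : Sp N → F}
    (h : IsWeakDeriv β u w) : weakDeriv β u =ᵐ[volume] w :=
  (isWeakDeriv_weakDeriv ⟨w, h⟩).ae_eq h

theorem isWeakDeriv_zero {u : Sp N → F} (hu : LocallyIntegrable u volume) : IsWeakDeriv 0 u u :=
  ⟨hu, hu, fun φ _ _ => by rw [iterPartial_zero, order_zero]; simp⟩

/-- One integration by parts, which supplies the extra factor `-1`; the test function is `D^β φ`. -/
theorem IsWeakDeriv.of_pd {β : Fin N → ℕ} {i : Fin N} {u w : Sp N → F} (hu : ContDiff ℝ 1 u)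
    (h : IsWeakDeriv β (pd i u) w) : IsWeakDeriv (β + Pi.single i 1) u w := by
  refine ⟨hu.continuous.locallyIntegrable, h.2.1, fun φ hφ hc => ?_⟩
  have hD := contDiff_iterPartial β hφ
  have hDc := hasCompactSupport_iterPartial β hφ hc
  have hpd : Continuous (pd i u) := (hu.continuous_fderiv one_ne_zero).clm_apply continuous_const
  have hpD : Continuous (partialDeriv i (iterPartial β φ)) := (contDiff_pd i hD).continuous
  have hpDc : HasCompactSupport (partialDeriv i (iterPartial β φ)) := hDc.fderiv_apply ℝ _
  have h1 := integral_smul_fderiv_eq_neg_fderiv_smul_of_integrable (μ := volume) (𝕜 := ℝ)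
    (f := iterPartial β φ) (g := u) (v := EuclideanSpace.single i (1 : ℝ))
    ((hpD.smul hu.continuous).integrable_of_hasCompactSupport (hpDc.smul_right))
    ((hD.continuous.smul hpd).integrable_of_hasCompactSupport (hDc.smul_right))
    ((hD.continuous.smul hu.continuous).integrable_of_hasCompactSupport (hDc.smul_right))
    (fun x _ => hD.differentiable (by simp) x) (fun x _ => hu.differentiable one_ne_zero x)
  rw [iterPartial_add_single β i hφ, iterPartial_partialDeriv β i hφ, order_add_single, pow_succ,
    mul_neg_one, neg_smul, ← h.2.2 φ hφ hc]
  exact neg_eq_iff_eq_neg.mp h1.symm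

theorem isWeakDeriv_iterPartial (β : Fin N → ℕ) :
    ∀ {f : Sp N → ℝ}, ContDiff ℝ ∞ f → IsWeakDeriv β f (iterPartial β f) := by
  induction β using order_induction with
  | h0 => intro f hf; rw [iterPartial_zero]; exact isWeakDeriv_zero hf.continuous.locallyIntegrable
  | hs β i ih =>
    intro f hf
    rw [iterPartial_add_single β i hf]
    exact (ih (contDiff_pd i hf)).of_pd (hf.of_le (by exact_mod_cast le_top))

theorem isWeakDeriv_pd (i : Fin N) {u : Sp N → F} (hu : ContDiff ℝ 1 u) :
    IsWeakDeriv (Pi.single i 1) u (pd i u) := by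
  have hpd : Continuous (pd i u) := (hu.continuous_fderiv one_ne_zero).clm_apply continuous_const
  have := (isWeakDeriv_zero hpd.locallyIntegrable).of_pd hu
  rwa [zero_add] at this

theorem contDiff_one_pd (i : Fin N) {u : Sp N → F} (hu : ContDiff ℝ 2 u) :
    ContDiff ℝ 1 (pd i u) :=
  (hu.fderiv_right (m := 1) (by norm_num)).clm_apply contDiff_const

theorem isWeakDeriv_pd_pd (i : Fin N) {u : Sp N → F} (hu : ContDiff ℝ 2 u) :
    IsWeakDeriv (Pi.single i 1 + Pi.single i 1) u (pd i (pd i u)) :=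
  (isWeakDeriv_pd i (contDiff_one_pd i hu)).of_pd (hu.of_le (by norm_num))

/-! ### Stability of weak derivatives under bounded pointwise limits. -/

open Filter Topology

theorem tendsto_integral_iterPartial_smul {β : Fin N → ℕ} {f : ℕ → Sp N → ℝ} {f' : Sp N → ℝ}
    {B : ℝ} (hf : ∀ k, LocallyIntegrable (f k) volume)
    (hlim : ∀ x, Tendsto (fun k => f k x) atTop (𝓝 (f' x))) (hb : ∀ k x, |f k x| ≤ B)
    {φ : Sp N → ℝ} (hφ : ContDiff ℝ ∞ φ) (hc : HasCompactSupport φ) :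
    Tendsto (fun k => ∫ x, iterPartial β φ x • f k x) atTop
      (𝓝 (∫ x, iterPartial β φ x • f' x)) := by
  have hD := (contDiff_iterPartial β hφ).continuous
  have hDc := hasCompactSupport_iterPartial β hφ hc
  refine tendsto_integral_of_dominated_convergence (fun x => |iterPartial β φ x| * B) ?_ ?_ ?_ ?_
  · exact fun k => hD.aestronglyMeasurable.smul (hf k).aestronglyMeasurable
  · exact ((hD.integrable_of_hasCompactSupport hDc).abs).mul_const _
  · refine fun k => Eventually.of_forall fun x => ?_
    rw [smul_eq_mul, norm_mul]
    exact mul_le_mul_of_nonneg_left (hb k x) (norm_nonneg _)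
  · exact Eventually.of_forall fun x => (hlim x).const_smul _

theorem locallyIntegrable_of_tendsto {f : ℕ → Sp N → ℝ} {f' : Sp N → ℝ}
    {B : ℝ} (hf : ∀ k, LocallyIntegrable (f k) volume)
    (hlim : ∀ x, Tendsto (fun k => f k x) atTop (𝓝 (f' x))) (hb : ∀ k x, |f k x| ≤ B) :
    LocallyIntegrable f' volume := by
  have hm : AEStronglyMeasurable f' volume :=
    aestronglyMeasurable_of_tendsto_ae atTop (fun k => (hf k).aestronglyMeasurable)
      (Eventually.of_forall hlim)
  have hb' : ∀ x, |f' x| ≤ B := fun x =>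
    le_of_tendsto (hlim x).abs (Eventually.of_forall fun k => hb k x)
  refine (locallyIntegrable_const B).mono hm (Eventually.of_forall fun x => ?_)
  exact (hb' x).trans (le_abs_self _)

/-- Weighted `L²` bounds on weak derivatives pass to bounded pointwise limits. -/
theorem exists_isWeakDeriv_of_tendsto {β : Fin N → ℕ} {f : ℕ → Sp N → ℝ} {f' W : Sp N → ℝ}
    {B B' : ℝ} (hW : Continuous W) (hWpos : ∀ x, 0 < W x)
    (h : ∀ k, ∃ g, IsWeakDeriv β (f k) g ∧
      eLpNorm (fun x => W x * g x) 2 volume ≤ ENNReal.ofReal B)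
    (hlim : ∀ x, Tendsto (fun k => f k x) atTop (𝓝 (f' x))) (hb : ∀ k x, |f k x| ≤ B') :
    ∃ g, IsWeakDeriv β f' g ∧ eLpNorm (fun x => W x * g x) 2 volume ≤ ENNReal.ofReal B := by
  choose g hg hgB using h
  have hmem : ∀ k, MemLp (fun x => W x * g k x) 2 volume := fun k =>
    ⟨hW.aestronglyMeasurable.mul (hg k).2.1.aestronglyMeasurable,
      (hgB k).trans_lt ENNReal.ofReal_lt_top⟩
  set H := Lp ℝ 2 (volume : Measure (Sp N))
  let Gk : ℕ → H := fun k => (hmem k).toLp _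
  have hGk : ∀ k, ‖Gk k‖ ≤ max B 0 := by
    intro k
    rw [Lp.norm_toLp]
    refine ENNReal.toReal_le_of_le_ofReal (le_max_right _ _) ((hgB k).trans ?_)
    exact ENNReal.ofReal_le_ofReal (le_max_left _ _)
  -- Weak compactness of balls in `L²`: the weighted derivatives, seen as functionals, converge
  -- weak-star along a nonprincipal ultrafilter. No subsequence is needed, since the limits on the
  -- side of the `f k` hold along the whole sequence.
  let ℓ : ℕ → WeakDual ℝ H := fun k => StrongDual.toWeakDual (InnerProductSpace.toDual ℝ H (Gk k))
  have hcomp := WeakDual.isCompact_closedBall (𝕜 := ℝ) (E := H) 0 (max B 0)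
  let U : Ultrafilter (WeakDual ℝ H) := (Filter.hyperfilter ℕ).map ℓ
  obtain ⟨ℓ', hℓ', hU⟩ := hcomp.ultrafilter_le_nhds U (by
    rw [Ultrafilter.coe_map, Filter.le_principal_iff, Filter.mem_map]
    refine Filter.univ_mem' fun k => ?_
    simp only [Set.mem_preimage, mem_closedBall_zero_iff]
    change ‖InnerProductSpace.toDual ℝ H (Gk k)‖ ≤ _
    rw [LinearIsometryEquiv.norm_map]
    exact hGk k)
  set G : H := (InnerProductSpace.toDual ℝ H).symm (WeakDual.toStrongDual ℓ') with hG
  have hGn : ‖G‖ ≤ max B 0 := by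
    rw [hG, LinearIsometryEquiv.norm_map]
    simpa using hℓ'
  have hev : ∀ ψ : H, Tendsto (fun k => inner ℝ (Gk k) ψ) (Filter.hyperfilter ℕ)
      (𝓝 (inner ℝ G ψ)) := by
    intro ψ
    have h1 : Tendsto ℓ (Filter.hyperfilter ℕ) (𝓝 ℓ') := hU
    have h2 := ((WeakDual.eval_continuous ψ).tendsto ℓ').comp h1
    have h3 : ℓ' ψ = inner ℝ G ψ := by
      rw [hG, InnerProductSpace.toDual_symm_apply]; rfl
    rw [← h3]
    exact h2
  have hGmem := Lp.memLp G
  have hgloc : LocallyIntegrable (fun x => (W x)⁻¹ • G x) volume := by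
    exact (hGmem.locallyIntegrable (by norm_num)).continuous_smul
      (hW.inv₀ fun x => (hWpos x).ne')
  refine ⟨fun x => (W x)⁻¹ • G x,
    ⟨locallyIntegrable_of_tendsto (fun k => (hg k).1) hlim hb, hgloc, fun φ hφ hc => ?_⟩, ?_⟩
  · have hψc : Continuous fun x => (W x)⁻¹ * φ x :=
      (hW.inv₀ fun x => (hWpos x).ne').mul hφ.continuous
    -- Dividing the test function by the weight turns the pairing with the weighted derivative `W g`
    -- into the pairing of `g` with `φ`.
    have hψmem : MemLp (fun x => (W x)⁻¹ * φ x) 2 volume :=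
      hψc.memLp_of_hasCompactSupport hc.mul_left
    have hl := hev (hψmem.toLp _)
    have e1 : ∀ k, inner ℝ (Gk k) (hψmem.toLp _) =
        (-1 : ℝ) ^ order β * ∫ x, iterPartial β φ x • f k x := by
      intro k
      rw [(hg k).2.2 φ hφ hc, smul_eq_mul, ← mul_assoc, ← mul_pow]
      norm_num
      rw [L2.inner_def]
      refine integral_congr_ae ?_
      filter_upwards [(hmem k).coeFn_toLp, hψmem.coeFn_toLp] with x h1 h2
      rw [h1, h2]
      have := (hWpos x).ne'
      simp only [RCLike.inner_apply, conj_trivial]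
      field_simp
    have e2 : inner ℝ G (hψmem.toLp _) = ∫ x, φ x • ((W x)⁻¹ • G x) := by
      rw [L2.inner_def]
      refine integral_congr_ae ?_
      filter_upwards [hψmem.coeFn_toLp] with x h2
      rw [h2]
      simp only [RCLike.inner_apply, conj_trivial, smul_eq_mul]
      ring
    simp only [e1, e2] at hl
    have hl2 := ((tendsto_integral_iterPartial_smul (fun k => (hg k).1) hlim hb hφ hc
      (β := β)).const_mul ((-1 : ℝ) ^ order β)).mono_left Nat.hyperfilter_le_atTop
    have := tendsto_nhds_unique hl hl2
    rw [this, smul_eq_mul, ← mul_assoc, ← mul_pow]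
    norm_num
  · have e : eLpNorm (fun x => W x * ((W x)⁻¹ • G x)) 2 volume = eLpNorm G 2 volume := by
      congr 1
      funext x
      have := (hWpos x).ne'
      rw [smul_eq_mul, mul_inv_cancel_left₀ this]
    rw [e, ← Lp.enorm_def, ← ofReal_norm]
    refine (ENNReal.ofReal_le_ofReal hGn).trans ?_
    simp

/-- A uniform bump sequence shrinking to the origin. -/
noncomputable def bump (N : ℕ) (k : ℕ) : ContDiffBump (0 : Sp N) :=
  ⟨1 / ((k : ℝ) + 2), 2 / ((k : ℝ) + 2), by positivity, by gcongr; norm_num⟩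

theorem tendsto_bump_rOut : Tendsto (fun k => (bump N k).rOut) atTop (𝓝 0) := by
  have h : Tendsto (fun k : ℕ => (k : ℝ) + 2) atTop atTop :=
    tendsto_atTop_add_const_right _ _ tendsto_natCast_atTop_atTop
  exact h.const_div_atTop 2

theorem bump_rOut_le_one (k : ℕ) : (bump N k).rOut ≤ 1 := by
  change 2 / ((k : ℝ) + 2) ≤ 1
  rw [div_le_one (by positivity)]
  linarith [Nat.cast_nonneg (α := ℝ) k]

/-- The mollification of `u` at scale `1 / k`. -/
noncomputable def mollify (k : ℕ) (u : Sp N → F) : Sp N → F :=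
  convolution ((bump N k).normed volume) u (ContinuousLinearMap.lsmul ℝ ℝ) volume

theorem ae_tendsto_mollify [CompleteSpace F] {u : Sp N → F} (hu : LocallyIntegrable u volume) :
    ∀ᵐ x, Tendsto (fun k => mollify k u x) atTop (𝓝 (u x)) :=
  ContDiffBump.ae_convolution_tendsto_right_of_locallyIntegrable (K := 2) tendsto_bump_rOut
    (Eventually.of_forall fun k => by
      change 2 / ((k : ℝ) + 2) ≤ 2 * (1 / ((k : ℝ) + 2)); rw [mul_one_div]) hu

theorem tendsto_mollify [CompleteSpace F] {u : Sp N → F} (hu : Continuous u) (x : Sp N) :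
    Tendsto (fun k => mollify k u x) atTop (𝓝 (u x)) :=
  ContDiffBump.convolution_tendsto_right_of_continuous tendsto_bump_rOut hu x

theorem mollify_apply (k : ℕ) (u : Sp N → F) (x : Sp N) :
    mollify k u x = ∫ y, (bump N k).normed volume (x - y) • u y := by
  unfold mollify
  rw [convolution_eq_swap]
  rfl

theorem contDiff_bump_shift (k : ℕ) (x : Sp N) :
    ContDiff ℝ ∞ (fun y => (bump N k).normed volume (x - y)) :=
  ((bump N k).contDiff_normed).comp (contDiff_const.sub contDiff_id)

theorem hasCompactSupport_bump_shift (k : ℕ) (x : Sp N) :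
    HasCompactSupport (fun y => (bump N k).normed volume (x - y)) :=
  ((bump N k).hasCompactSupport_normed).comp_homeomorph (Homeomorph.subLeft x)

/-- Pointwise bounds on weak derivatives pass to bounded pointwise limits. -/
theorem IsWeakDeriv.ae_abs_le_of_tendsto {β : Fin N → ℕ} {f : ℕ → Sp N → ℝ} {f' h g' : Sp N → ℝ}
    {B' : ℝ} (hh : Continuous h)
    (hg : ∀ k, ∃ g, IsWeakDeriv β (f k) g ∧ ∀ᵐ x, |g x| ≤ h x)
    (hlim : ∀ x, Tendsto (fun k => f k x) atTop (𝓝 (f' x))) (hb : ∀ k x, |f k x| ≤ B')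
    (hg' : IsWeakDeriv β f' g') : ∀ᵐ x, |g' x| ≤ h x := by
  choose g hg hgh using hg
  -- A pointwise bound by `h` is equivalent to a bound against nonnegative test functions, and the
  -- latter is closed under distributional limits. Shrinking bump functions then recover the
  -- pointwise bound almost everywhere.
  have key : ∀ φ : Sp N → ℝ, ContDiff ℝ ∞ φ → HasCompactSupport φ → (∀ x, 0 ≤ φ x) →
      |∫ x, φ x • g' x| ≤ ∫ x, φ x • h x := by
    intro φ hφ hc hφ0
    have hl := (tendsto_integral_iterPartial_smul (fun k => (hg k).1) hlim hb hφ hc (β := β)).abs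
    have e : ∀ (u w : Sp N → ℝ), IsWeakDeriv β u w →
        |∫ x, iterPartial β φ x • u x| = |∫ x, φ x • w x| := by
      intro u w huw
      rw [huw.2.2 φ hφ hc, smul_eq_mul, abs_mul, abs_pow]
      norm_num
    rw [e _ _ hg'] at hl
    simp only [fun k => e _ _ (hg k)] at hl
    refine le_of_tendsto hl (Eventually.of_forall fun k => ?_)
    have hint : Integrable (fun x => φ x • h x) volume :=
      (hφ.continuous.smul hh).integrable_of_hasCompactSupport hc.smul_right
    rw [← Real.norm_eq_abs]
    refine norm_integral_le_of_norm_le hint ?_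
    filter_upwards [hgh k] with x hx
    rw [norm_smul, Real.norm_eq_abs, Real.norm_eq_abs, abs_of_nonneg (hφ0 x)]
    exact mul_le_mul_of_nonneg_left hx (hφ0 x)
  filter_upwards [ae_tendsto_mollify hg'.2.1] with x hx
  refine le_of_tendsto_of_tendsto' hx.abs (tendsto_mollify hh x) fun k => ?_
  rw [mollify_apply, mollify_apply]
  exact key _ (contDiff_bump_shift k x) (hasCompactSupport_bump_shift k x)
    fun y => (bump N k).nonneg_normed _

end Weak

/-! ### Mollification -/

section Mollify

variable {N : ℕ} {F : Type*} [NormedAddCommGroup F] [NormedSpace ℝ F]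

/-- The convolution `ρ ⋆ u` on `ℝ^N`. -/
noncomputable def conv (ρ : Sp N → ℝ) (u : Sp N → F) : Sp N → F :=
  convolution ρ u (ContinuousLinearMap.lsmul ℝ ℝ) volume

theorem conv_apply (ρ : Sp N → ℝ) (u : Sp N → F) (x : Sp N) :
    conv ρ u x = ∫ y, ρ (x - y) • u y := by
  unfold conv
  rw [convolution_eq_swap]
  rfl

theorem contDiff_conv {ρ : Sp N → ℝ} (hρ : ContDiff ℝ ∞ ρ) (hc : HasCompactSupport ρ)
    {u : Sp N → F} (hu : LocallyIntegrable u volume) : ContDiff ℝ ∞ (conv ρ u) :=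
  hc.contDiff_convolution_left (n := ⊤) _ hρ hu

theorem pd_conv (i : Fin N) {ρ : Sp N → ℝ} (hρ : ContDiff ℝ ∞ ρ) (hc : HasCompactSupport ρ)
    {u : Sp N → F} (hu : LocallyIntegrable u volume) :
    pd i (conv ρ u) = conv (partialDeriv i ρ) u := by
  funext x
  have h := (hc.hasFDerivAt_convolution_left (ContinuousLinearMap.lsmul ℝ ℝ)
    (hρ.of_le (by exact_mod_cast le_top)) hu x).fderiv
  change fderiv ℝ (conv ρ u) x _ = _
  have hex := (hc.fderiv ℝ).convolutionExists_left
    (ContinuousLinearMap.precompL (Sp N) (ContinuousLinearMap.lsmul ℝ ℝ : ℝ →L[ℝ] F →L[ℝ] F))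
    (contDiff_fderiv_infty hρ).continuous hu x
  rw [conv, h, conv, convolution_def, convolution_def, ContinuousLinearMap.integral_apply hex]
  rfl

/-- Each order costs a sum over `N` coordinates, hence `N ^ j`. All derivatives are put on the
kernel, so no regularity of `u` is required. -/
theorem norm_iteratedFDeriv_conv_le (j : ℕ) {u : Sp N → F} (hu : LocallyIntegrable u volume)
    (x : Sp N) {B : ℝ} : ∀ {ρ : Sp N → ℝ}, ContDiff ℝ ∞ ρ → HasCompactSupport ρ →
    (∀ β : Fin N → ℕ, order β = j → ‖conv (iterPartial β ρ) u x‖ ≤ B) →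
    ‖iteratedFDeriv ℝ j (conv ρ u) x‖ ≤ N ^ j * B := by
  induction j with
  | zero =>
    intro ρ hρ hc h
    have := h 0 order_zero
    rw [iterPartial_zero] at this
    simpa using this
  | succ j ih =>
    intro ρ hρ hc h
    refine (norm_iteratedFDeriv_succ_le (contDiff_conv hρ hc hu) j x).trans ?_
    have : ∀ i ∈ (Finset.univ : Finset (Fin N)),
        ‖iteratedFDeriv ℝ j (pd i (conv ρ u)) x‖ ≤ N ^ j * B := by
      intro i _
      rw [pd_conv i hρ hc hu]
      refine ih (contDiff_pd i hρ) (hc.fderiv_apply ℝ _) fun β hβ => ?_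
      have := h (β + Pi.single i 1) (by rw [order_add_single, hβ])
      rwa [iterPartial_add_single β i hρ] at this
    refine (Finset.sum_le_card_nsmul _ _ _ this).trans ?_
    rw [Finset.card_univ, Fintype.card_fin, nsmul_eq_mul, pow_succ]
    exact le_of_eq (by ring)

theorem iterPartial_sub_left (β : Fin N → ℕ) (x : Sp N) : ∀ {ρ : Sp N → ℝ}, ContDiff ℝ ∞ ρ →
    iterPartial β (fun y => ρ (x - y)) = fun y => (-1 : ℝ) ^ order β * iterPartial β ρ (x - y) := by
  induction β using order_induction with
  | h0 => intro ρ _; simp [iterPartial_zero, order_zero]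
  | hs β i ih =>
    intro ρ hρ
    have hs : ContDiff ℝ ∞ (fun y => ρ (x - y)) := hρ.comp (contDiff_const.sub contDiff_id)
    have hpd : ContDiff ℝ ∞ (partialDeriv i ρ) := contDiff_pd i hρ
    rw [iterPartial_add_single β i hs, iterPartial_add_single β i hρ, order_add_single]
    have e : partialDeriv i (fun y => ρ (x - y)) = fun y => -(partialDeriv i ρ (x - y)) := by
      funext y
      change fderiv ℝ (fun y => ρ (x - y)) y _ = _
      have hd : HasFDerivAt (fun y => ρ (x - y))
          ((fderiv ℝ ρ (x - y)).comp (-(ContinuousLinearMap.id ℝ (Sp N)))) y :=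
        ((hρ.differentiable (by simp)) (x - y)).hasFDerivAt.comp y
          ((hasFDerivAt_id y).const_sub x)
      rw [hd.fderiv]
      simp [partialDeriv]
    have hneg : ∀ ψ : Sp N → ℝ, ContDiff ℝ ∞ ψ →
        iterPartial β (fun y => -ψ y) = fun y => -iterPartial β ψ y := by
      clear ih hs hpd e hρ
      induction β using order_induction with
      | h0 => intro ψ _; simp [iterPartial_zero]
      | hs β j ih =>
        intro ψ hψ
        have hj : ContDiff ℝ ∞ (partialDeriv j ψ) := contDiff_pd j hψ
        rw [iterPartial_add_single β j hψ.neg, iterPartial_add_single β j hψ, ← ih _ hj]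
        congr 1
        funext y
        simp [partialDeriv]
    have hpx : ContDiff ℝ ∞ (fun y => partialDeriv i ρ (x - y)) :=
      hpd.comp (contDiff_const.sub contDiff_id)
    rw [e, hneg _ hpx, ih hpd]
    funext y
    ring

/-- The weak derivative is tested against the reflected translate of the kernel. The reflection
produces the sign `(-1)^{|β|}`, which cancels the one in the definition. -/
theorem conv_iterPartial {β : Fin N → ℕ} {u w : Sp N → F} (h : IsWeakDeriv β u w)
    {ρ : Sp N → ℝ} (hρ : ContDiff ℝ ∞ ρ) (hc : HasCompactSupport ρ) :
    conv (iterPartial β ρ) u = conv ρ w := by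
  funext x
  have h1 := h.2.2 (fun y => ρ (x - y)) (hρ.comp (contDiff_const.sub contDiff_id))
    (hc.comp_homeomorph (Homeomorph.subLeft x))
  rw [iterPartial_sub_left β x hρ] at h1
  simp only [mul_smul, integral_smul] at h1
  rw [conv_apply, conv_apply]
  exact smul_right_injective F (pow_ne_zero (order β) (by norm_num : (-1 : ℝ) ≠ 0)) h1

/-! ### Derivatives and weighted norms of mollified functions. -/

theorem mollify_eq_conv (k : ℕ) (u : Sp N → F) :
    mollify k u = conv ((bump N k).normed volume) u := rfl

theorem contDiff_mollify (k : ℕ) {u : Sp N → F} (hu : LocallyIntegrable u volume) :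
    ContDiff ℝ ∞ (mollify k u) :=
  contDiff_conv (bump N k).contDiff_normed (bump N k).hasCompactSupport_normed hu

theorem norm_iteratedFDeriv_mollify_le (k j : ℕ) {u : Sp N → F} {w : (Fin N → ℕ) → Sp N → F}
    (hu : LocallyIntegrable u volume)
    (hw : ∀ β, order β = j → IsWeakDeriv β u (w β)) (x : Sp N) {B : ℝ}
    (hB : ∀ β, order β = j → ‖mollify k (w β) x‖ ≤ B) :
    ‖iteratedFDeriv ℝ j (mollify k u) x‖ ≤ N ^ j * B := by
  refine norm_iteratedFDeriv_conv_le j hu x (bump N k).contDiff_normed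
    (bump N k).hasCompactSupport_normed fun β hβ => ?_
  rw [conv_iterPartial (hw β hβ) (bump N k).contDiff_normed (bump N k).hasCompactSupport_normed]
  exact hB β hβ

theorem lap_mollify (k : ℕ) {u : Sp N → F} (hu : ContDiff ℝ 2 u) :
    lap (mollify k u) = fun x => ∑ i, mollify k (pd i (pd i u)) x := by
  funext x
  refine Finset.sum_congr rfl fun i _ => ?_
  have hρ := (bump N k).contDiff_normed (μ := (volume : Measure (Sp N))) (n := ⊤)
  have hc := (bump N k).hasCompactSupport_normed (μ := (volume : Measure (Sp N)))
  have hu' := hu.continuous.locallyIntegrable (μ := (volume : Measure (Sp N)))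
  have hρi : ContDiff ℝ ∞ (partialDeriv i ((bump N k).normed volume)) := contDiff_pd i hρ
  rw [mollify_eq_conv, pd_conv i hρ hc hu',
    pd_conv i hρi (hc.fderiv_apply ℝ _) hu', mollify_eq_conv,
    ← conv_iterPartial (isWeakDeriv_pd_pd i hu) hρ hc, iterPartial_add_single _ _ hρ]
  have := iterPartial_add_single (0 : Fin N → ℕ) i (contDiff_pd i hρ)
  rw [zero_add, iterPartial_zero] at this
  exact congrFun (congrArg (fun f => conv f u) this.symm) x

theorem tendsto_lap_mollify [CompleteSpace F] {u : Sp N → F} (hu : ContDiff ℝ 2 u) (x : Sp N) :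
    Filter.Tendsto (fun k => lap (mollify k u) x) Filter.atTop (nhds (lap u x)) := by
  simp only [lap_mollify _ hu]
  exact tendsto_finsetSum _ fun i _ =>
    tendsto_mollify (((contDiff_one_pd i hu).continuous_fderiv one_ne_zero).clm_apply
      continuous_const) x

theorem norm_mollify_le (k : ℕ) {w : Sp N → F} {x : Sp N} {B : ℝ}
    (hw : ∀ᵐ y, dist y x < (bump N k).rOut → ‖w y‖ ≤ B) : ‖mollify k w x‖ ≤ B := by
  rw [mollify_apply]
  have hint : Integrable (fun y => (bump N k).normed volume (x - y)) volume :=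
    (contDiff_bump_shift k x).continuous.integrable_of_hasCompactSupport
      (hasCompactSupport_bump_shift k x)
  have h1 : ∫ y, (bump N k).normed volume (x - y) * B = B := by
    rw [integral_mul_const, integral_sub_left_eq_self (fun y => (bump N k).normed volume y),
      ContDiffBump.integral_normed, one_mul]
  rw [← h1]
  refine norm_integral_le_of_norm_le (hint.mul_const B) ?_
  filter_upwards [hw] with y hy
  rw [norm_smul, Real.norm_eq_abs, abs_of_nonneg ((bump N k).nonneg_normed _)]
  by_cases hd : dist y x < (bump N k).rOut
  · exact mul_le_mul_of_nonneg_left (hy hd) ((bump N k).nonneg_normed _)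
  · have : (bump N k).normed volume (x - y) = 0 := by
      rw [← Function.notMem_support, ContDiffBump.support_normed_eq, Metric.mem_ball,
        dist_zero_right, ← dist_eq_norm, dist_comm]
      exact hd
    simp [this]

theorem bracket_pos (x : Sp N) : 0 < bracket x := Real.sqrt_pos.mpr (by positivity)

theorem one_le_bracket (x : Sp N) : 1 ≤ bracket x :=
  Real.one_le_sqrt.mpr (le_add_of_nonneg_right (by positivity))

theorem continuous_bracket : Continuous (bracket : Sp N → ℝ) :=
  (continuous_const.add (continuous_norm.pow 2)).sqrt

theorem bracket_le_two_mul {x y : Sp N} (h : dist y x ≤ 1) : bracket x ≤ 2 * bracket y := by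
  have h1 : ‖x‖ ≤ ‖y‖ + 1 := by
    have := norm_sub_norm_le x y
    rw [dist_comm, dist_eq_norm] at h
    linarith
  unfold bracket
  rw [show (2 : ℝ) = Real.sqrt (2 ^ 2) by rw [Real.sqrt_sq]; norm_num, ← Real.sqrt_mul (by positivity)]
  refine Real.sqrt_le_sqrt ?_
  nlinarith [norm_nonneg x, norm_nonneg y, sq_nonneg (‖y‖ - 1)]

theorem lintegral_bump_normed (k : ℕ) :
    ∫⁻ y, ENNReal.ofReal ((bump N k).normed volume y) = 1 := by
  rw [← ofReal_integral_eq_lintegral_ofReal (bump N k).integrable_normed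
    (Filter.Eventually.of_forall fun y => (bump N k).nonneg_normed y),
    ContDiffBump.integral_normed, ENNReal.ofReal_one]

/-- Young's inequality in `L²` for the mollifier. -/
theorem lintegral_sq_lintegral_bump_le (k : ℕ) {g : Sp N → ℝ≥0∞} (hg : AEMeasurable g volume) :
    ∫⁻ x, (∫⁻ y, ENNReal.ofReal ((bump N k).normed volume (x - y)) * g y) ^ (2 : ℝ)
      ≤ ∫⁻ y, g y ^ (2 : ℝ) := by
  set ρ : Sp N → ℝ≥0∞ := fun y => ENNReal.ofReal ((bump N k).normed volume y) with hρ
  have hρm : Measurable ρ := ((bump N k).contDiff_normed (n := 0)).continuous.measurable.ennreal_ofReal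
  have h1 : ∀ x, ∫⁻ y, ρ (x - y) = 1 := fun x => by
    rw [lintegral_sub_left_eq_self]; exact lintegral_bump_normed k
  have h2 : ∀ y, ∫⁻ x, ρ (x - y) = 1 := fun y => by
    rw [lintegral_sub_right_eq_self]; exact lintegral_bump_normed k
  have hpt : ∀ x, (∫⁻ y, ρ (x - y) * g y) ^ (2 : ℝ) ≤ ∫⁻ y, ρ (x - y) * g y ^ (2 : ℝ) := by
    intro x
    have hm : AEMeasurable (fun y => ρ (x - y)) volume :=
      (hρm.comp (measurable_const.sub measurable_id)).aemeasurable
    -- Cauchy–Schwarz after splitting the kernel as `ρ = ρ^{1/2} ρ^{1/2}`; the spare factor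
    -- integrates to one.
    have hH := ENNReal.lintegral_mul_le_Lp_mul_Lq volume Real.HolderConjugate.two_two
      (f := fun y => ρ (x - y) ^ (1 / 2 : ℝ)) (g := fun y => ρ (x - y) ^ (1 / 2 : ℝ) * g y)
      (hm.pow_const _) ((hm.pow_const _).mul hg)
    have e1 : ∀ a : ℝ≥0∞, a ^ (1 / 2 : ℝ) * a ^ (1 / 2 : ℝ) = a := fun a => by
      rw [← ENNReal.rpow_add_of_nonneg _ _ (by norm_num) (by norm_num)]; norm_num
    have e2 : ∀ a : ℝ≥0∞, (a ^ (1 / 2 : ℝ)) ^ (2 : ℝ) = a := fun a => by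
      rw [← ENNReal.rpow_mul]; norm_num
    simp only [Pi.mul_apply, ← mul_assoc, e1, ENNReal.mul_rpow_of_nonneg _ _ zero_le_two, e2, h1,
      ENNReal.one_rpow, one_mul] at hH
    calc _ ≤ ((∫⁻ y, ρ (x - y) * g y ^ (2 : ℝ)) ^ (1 / 2 : ℝ)) ^ (2 : ℝ) :=
          ENNReal.rpow_le_rpow hH zero_le_two
      _ = _ := e2 _
  refine (lintegral_mono hpt).trans ?_
  rw [lintegral_lintegral_swap]
  · refine le_of_eq (lintegral_congr fun y => ?_)
    have hm : Measurable fun x => ρ (x - y) := hρm.comp (measurable_id.sub measurable_const)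
    rw [lintegral_mul_const _ hm, h2, one_mul]
  · refine AEMeasurable.mul (hρm.comp (measurable_fst.sub measurable_snd)).aemeasurable ?_
    exact (hg.pow_const _).comp_quasiMeasurePreserving Measure.quasiMeasurePreserving_snd

/-- The kernel has radius at most one, and over that distance the bracket varies by a factor at most
`2`. The weight therefore passes inside the convolution at the cost `2 ^ μ`, uniformly in the scale.
-/
theorem eLpNorm_bracket_mollify_le (k μ : ℕ) {w : Sp N → F} (hw : AEStronglyMeasurable w volume) :
    eLpNorm (fun x => bracket x ^ μ * ‖mollify k w x‖) 2 volume
      ≤ ENNReal.ofReal (2 ^ μ) * eLpNorm (fun x => bracket x ^ μ * ‖w x‖) 2 volume := by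
  set g : Sp N → ℝ≥0∞ := fun y => ‖(2 ^ μ : ℝ) • (bracket y ^ μ * ‖w y‖)‖ₑ with hg
  have hgm : AEMeasurable g volume :=
    (((continuous_bracket.pow μ).aestronglyMeasurable.mul hw.norm).const_smul (2 ^ μ : ℝ)).enorm
  have hR : ENNReal.ofReal (2 ^ μ) * eLpNorm (fun x => bracket x ^ μ * ‖w x‖) 2 volume =
      eLpNorm (fun x => (2 ^ μ : ℝ) • (bracket x ^ μ * ‖w x‖)) 2 volume := by
    have := eLpNorm_const_smul (2 ^ μ : ℝ) (fun x => bracket x ^ μ * ‖w x‖) 2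
      (volume : Measure (Sp N))
    rw [show (fun x => (2 ^ μ : ℝ) • (bracket x ^ μ * ‖w x‖))
      = (2 ^ μ : ℝ) • (fun x => bracket x ^ μ * ‖w x‖) from rfl, this,
      Real.enorm_of_nonneg (by positivity)]
  rw [hR, eLpNorm_eq_lintegral_rpow_enorm_toReal two_ne_zero ENNReal.ofNat_ne_top,
    eLpNorm_eq_lintegral_rpow_enorm_toReal two_ne_zero ENNReal.ofNat_ne_top]
  refine ENNReal.rpow_le_rpow ?_ (by norm_num)
  simp only [ENNReal.toReal_ofNat]
  refine le_trans (lintegral_mono fun x => ?_) (lintegral_sq_lintegral_bump_le k hgm)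
  refine ENNReal.rpow_le_rpow ?_ zero_le_two
  have hb := (bracket_pos x).le
  rw [enorm_mul, enorm_norm, mollify_apply]
  refine (mul_le_mul_right (enorm_integral_le_lintegral_enorm _) _).trans ?_
  rw [← lintegral_const_mul' _ _ enorm_ne_top]
  refine lintegral_mono fun y => ?_
  by_cases hd : dist y x < (bump N k).rOut
  · have h2 : bracket x ^ μ ≤ 2 ^ μ * bracket y ^ μ := by
      rw [← mul_pow]
      exact pow_le_pow_left₀ hb (bracket_le_two_mul (hd.le.trans (bump_rOut_le_one k))) μ
    rw [enorm_smul, Real.enorm_of_nonneg ((bump N k).nonneg_normed _), mul_left_comm]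
    refine mul_le_mul_right ?_ _
    rw [smul_eq_mul, ← mul_assoc, enorm_mul _ ‖w y‖, enorm_norm]
    refine mul_le_mul_left ?_ _
    rw [Real.enorm_of_nonneg (by positivity), Real.enorm_of_nonneg (by have := bracket_pos y; positivity)]
    exact ENNReal.ofReal_le_ofReal h2
  · have : (bump N k).normed volume (x - y) = 0 := by
      rw [← Function.notMem_support, ContDiffBump.support_normed_eq, Metric.mem_ball,
        dist_zero_right, ← dist_eq_norm, dist_comm]
      exact hd
    simp [this]

end Mollify

/-! ### Riemann sums -/

section Riemann

open Filter Topology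

theorem one_sub_mul_pos {b t s : ℝ} (hb : 0 < b) (hbt : b * t < 1) (hs : s ≤ t) :
    0 < 1 - b * s := by nlinarith

theorem grid_mem {t : ℝ} (ht : 0 ≤ t) {K l : ℕ} (hl : l ≤ K) :
    (l : ℝ) * (t / K) ∈ Set.Icc 0 t := by
  rcases Nat.eq_zero_or_pos K with rfl | hK
  · simp [ht]
  · refine ⟨by positivity, ?_⟩
    have hK' : (0 : ℝ) < K := Nat.cast_pos.mpr hK
    have hl' : (l : ℝ) ≤ K := Nat.cast_le.mpr hl
    rw [← mul_div_assoc, div_le_iff₀ hK', mul_comm]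
    exact mul_le_mul_of_nonneg_left hl' ht

/-- Left Riemann sums of an increasing function stay below its integral. Concretely, Bernoulli's
inequality with exponent `1 - a` bounds each term by an increment of `-(1 - bs)^{1-a} / (b(1-a))`,
and the sum telescopes. The bound is uniform in the grid and in `t < 1/b`. -/
theorem sum_grid_rpow_le {a b t : ℝ} (ha0 : 0 ≤ a) (ha1 : a < 1) (hb : 0 < b) (ht : 0 ≤ t)
    (hbt : b * t < 1) {K i : ℕ} (hi : i ≤ K) :
    ∑ l ∈ Finset.range i, (t / K) * (1 - b * (l * (t / K))) ^ (-a) ≤ 1 / (b * (1 - a)) := by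
  set δ := t / K with hδ
  have hδ0 : 0 ≤ δ := by positivity
  have hc : 0 < b * (1 - a) := mul_pos hb (by linarith)
  have hpos : ∀ l ≤ K, 0 < 1 - b * (l * δ) := fun l hl =>
    one_sub_mul_pos hb hbt (grid_mem ht hl).2
  have key : ∀ i ≤ K, ∑ l ∈ Finset.range i, δ * (1 - b * (l * δ)) ^ (-a)
      ≤ (1 - (1 - b * (i * δ)) ^ (1 - a)) / (b * (1 - a)) := by
    intro i
    induction i with
    | zero => intro _; simp
    | succ i ih =>
      intro hi
      rw [Finset.sum_range_succ]
      have h1 := ih (by omega)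
      set y := 1 - b * (i * δ) with hy
      have hy0 : 0 < y := hpos i (by omega)
      have hy' : 1 - b * ((i + 1 : ℕ) * δ) = y - b * δ := by rw [hy]; push_cast; ring
      have hy'0 : 0 < y - b * δ := hy' ▸ hpos (i + 1) hi
      rw [hy']
      have hB := rpow_one_add_le_one_add_mul_self (s := (y - b * δ) / y - 1) (p := 1 - a)
        (by have := div_pos hy'0 hy0; linarith) (by linarith) (by linarith)
      rw [show 1 + ((y - b * δ) / y - 1) = (y - b * δ) / y by ring,
        Real.div_rpow hy'0.le hy0.le, div_le_iff₀ (Real.rpow_pos_of_pos hy0 _)] at hB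
      have e1 : y ^ (1 - a) = y * y ^ (-a) := by
        rw [sub_eq_add_neg, Real.rpow_add hy0, Real.rpow_one]
      have hB' : (y - b * δ) ^ (1 - a) ≤ y ^ (1 - a) - (1 - a) * (b * δ) * y ^ (-a) := by
        refine hB.trans (le_of_eq ?_)
        rw [e1]
        field_simp
        ring
      have h2 : δ * y ^ (-a) ≤ (y ^ (1 - a) - (y - b * δ) ^ (1 - a)) / (b * (1 - a)) := by
        rw [le_div_iff₀ hc]
        linarith
      calc _ ≤ (1 - y ^ (1 - a)) / (b * (1 - a)) + _ := add_le_add h1 h2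
        _ = _ := by rw [← add_div]; congr 1; ring
  refine (key i hi).trans ?_
  gcongr
  have := Real.rpow_nonneg (hpos i hi).le (1 - a)
  linarith

theorem integral_one_sub_mul_rpow {b p t : ℝ} (hb : 0 < b) (hp : 0 < p) (ht : 0 ≤ t)
    (hbt : b * t < 1) :
    ∫ s in (0 : ℝ)..t, (1 - b * s) ^ (-(p + 1)) = ((1 - b * t) ^ (-p) - 1) / (b * p) := by
  have hpos : ∀ s ∈ Set.uIcc 0 t, 0 < 1 - b * s := fun s hs => by
    rw [Set.uIcc_of_le ht] at hs
    exact one_sub_mul_pos hb hbt hs.2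
  have h := intervalIntegral.integral_eq_sub_of_hasDerivAt (a := 0) (b := t)
    (f := fun s => (1 - b * s) ^ (-p) / (b * p)) (f' := fun s => (1 - b * s) ^ (-(p + 1)))
    (fun s hs => by
      have h1 : HasDerivAt (fun s => 1 - b * s) (-b) s := by
        simpa using ((hasDerivAt_id s).const_mul b).const_sub 1
      have h2 := (h1.rpow_const (p := -p) (Or.inl (hpos s hs).ne')).div_const (b * p)
      refine h2.congr_deriv ?_
      rw [show -p - 1 = -(p + 1) by ring]
      field_simp)
    (ContinuousOn.intervalIntegrable (ContinuousOn.rpow_const (by fun_prop)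
      fun s hs => Or.inl (hpos s hs).ne'))
  rw [h]
  simp only [mul_zero, sub_zero, Real.one_rpow]
  ring

/-- Uniformity in the endpoint `i` is what the amplitude requires: its denominator contains the
exponential of a partial phase sum at every grid time. -/
theorem riemann_uniform {t : ℝ} (ht : 0 ≤ t) {g : ℝ → ℝ} (hg : ContinuousOn g (Set.Icc 0 t)) {ε : ℝ}
    (hε : 0 < ε) : ∀ᶠ K : ℕ in atTop, ∀ i ≤ K,
      |∑ l ∈ Finset.range i, (t / K) * g (l * (t / K)) - ∫ s in (0 : ℝ)..(i * (t / K)), g s| ≤ ε := by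
  have huc := isCompact_Icc.uniformContinuousOn_of_continuous hg
  rw [Metric.uniformContinuousOn_iff] at huc
  obtain ⟨η, hη, H⟩ := huc (ε / (t + 1)) (by positivity)
  have hlim : Tendsto (fun K : ℕ => t / (K : ℝ)) atTop (𝓝 0) :=
    tendsto_const_div_atTop_nhds_zero_nat t
  filter_upwards [hlim.eventually (gt_mem_nhds hη)] with K hK i hi
  set δ := t / K with hδ
  have hδ0 : 0 ≤ δ := by positivity
  have hmem : ∀ l ≤ K, (l : ℝ) * δ ∈ Set.Icc 0 t := fun l hl => grid_mem ht hl
  have hint : ∀ l < i, IntervalIntegrable g volume (l * δ) ((l + 1 : ℕ) * δ) := fun l hl =>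
    (hg.mono (Set.uIcc_subset_Icc (hmem l (by omega)) (hmem (l + 1) (by omega)))).intervalIntegrable
  have hsum := intervalIntegral.sum_integral_adjacent_intervals (a := fun l : ℕ => (l : ℝ) * δ)
    (n := i) hint
  simp only [Nat.cast_zero, zero_mul] at hsum
  rw [← hsum, ← Finset.sum_sub_distrib]
  refine (Finset.abs_sum_le_sum_abs _ _).trans ?_
  have hterm : ∀ l ∈ Finset.range i, |δ * g (l * δ) - ∫ s in (l * δ)..((l + 1 : ℕ) * δ), g s|
      ≤ ε / (t + 1) * δ := by
    intro l hl
    have hl' := Finset.mem_range.mp hl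
    have hle : (l : ℝ) * δ ≤ (l + 1 : ℕ) * δ := by push_cast; nlinarith
    have e : δ * g (l * δ) = ∫ s in (l * δ)..((l + 1 : ℕ) * δ), g (l * δ) := by
      rw [intervalIntegral.integral_const, smul_eq_mul]; push_cast; ring
    rw [e, ← intervalIntegral.integral_sub intervalIntegrable_const (hint l hl'),
      ← Real.norm_eq_abs]
    refine (intervalIntegral.norm_integral_le_of_norm_le_const (C := ε / (t + 1)) fun s hs => ?_).trans
      (le_of_eq ?_)
    · rw [Set.uIoc_of_le hle] at hs
      have h1 := hmem l (by omega)
      have h2 := hmem (l + 1) (by omega)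
      rw [← dist_eq_norm]
      refine (H _ h1 s ⟨h1.1.trans hs.1.le, hs.2.trans h2.2⟩ ?_).le
      rw [dist_comm, Real.dist_eq, abs_of_nonneg (by linarith [hs.1])]
      have := hs.2
      push_cast at this
      linarith
    · rw [abs_of_nonneg (by linarith)]; push_cast; ring
  refine (Finset.sum_le_sum hterm).trans ?_
  rw [Finset.sum_const, Finset.card_range, nsmul_eq_mul]
  have h3 := (hmem i hi).2
  have h4 : (i : ℝ) * (ε / (t + 1) * δ) = ε / (t + 1) * (i * δ) := by ring
  rw [h4]
  calc _ ≤ ε / (t + 1) * t := mul_le_mul_of_nonneg_left h3 (by positivity)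
    _ ≤ ε := by rw [div_mul_eq_mul_div, div_le_iff₀ (by positivity)]; nlinarith

theorem riemann_tendsto {t : ℝ} (ht : 0 ≤ t) {g : ℝ → ℝ} (hg : ContinuousOn g (Set.Icc 0 t)) :
    Tendsto (fun K : ℕ => ∑ l ∈ Finset.range K, (t / K) * g (l * (t / K))) atTop
      (𝓝 (∫ s in (0 : ℝ)..t, g s)) := by
  rw [Metric.tendsto_nhds]
  intro ε hε
  filter_upwards [riemann_uniform ht hg (half_pos hε), eventually_gt_atTop 0] with K hK hK0
  have h := hK K le_rfl
  have e : (K : ℝ) * (t / K) = t := by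
    have : (K : ℝ) ≠ 0 := Nat.cast_ne_zero.mpr hK0.ne'
    field_simp
  rw [e] at h
  rw [Real.dist_eq]
  linarith

/-- Convergence of the discretized amplitude at a point. -/
theorem tendsto_riemann_amp {t : ℝ} (ht : 0 ≤ t) {L h : ℝ → ℝ} (hL : ContinuousOn L (Set.Icc 0 t))
    (hh : ContinuousOn h (Set.Icc 0 t)) (hh0 : ∀ s ∈ Set.Icc 0 t, 0 ≤ h s) (α c w : ℝ) (hw : 0 < w)
    (hc : 0 ≤ c) :
    Tendsto (fun K : ℕ => (w + ∑ l ∈ Finset.range K, (c * (t / K) * h (l * (t / K))) *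
        Real.exp (∑ j ∈ Finset.range l, (α * (t / K)) * L (j * (t / K))))⁻¹ *
        Real.exp (∑ j ∈ Finset.range K, (α * (t / K)) * L (j * (t / K)))) atTop
      (𝓝 ((w + c * ∫ s in (0 : ℝ)..t, h s * Real.exp (α * ∫ r in (0 : ℝ)..s, L r))⁻¹ *
        Real.exp (α * ∫ r in (0 : ℝ)..t, L r))) := by
  have hαsum : ∀ (K l : ℕ), ∑ j ∈ Finset.range l, (α * (t / K)) * L (j * (t / K)) =
      α * ∑ j ∈ Finset.range l, (t / K) * L (j * (t / K)) := fun K l => by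
    rw [Finset.mul_sum]; exact Finset.sum_congr rfl fun j _ => by ring
  simp only [hαsum]
  set A : ℝ → ℝ := fun s => α * ∫ r in (0 : ℝ)..s, L r with hA
  have hAc : ContinuousOn A (Set.Icc 0 t) := by
    have := intervalIntegral.continuousOn_primitive_interval (μ := volume) (f := L) (a := 0) (b := t)
      (by rw [Set.uIcc_of_le ht]; exact hL.integrableOn_Icc)
    rw [Set.uIcc_of_le ht] at this
    exact continuousOn_const.mul this
  have hE : ContinuousOn (fun s => h s * Real.exp (A s)) (Set.Icc 0 t) := hh.mul hAc.rexp
  obtain ⟨H, hH⟩ := isCompact_Icc.exists_bound_of_continuousOn hE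
  have hH0 : 0 ≤ H := (norm_nonneg _).trans (hH 0 ⟨le_rfl, ht⟩)
  have h1 := riemann_tendsto ht hE
  have hAt : Tendsto (fun K : ℕ => α * ∑ j ∈ Finset.range K, (t / K) * L (j * (t / K))) atTop
      (𝓝 (A t)) := (riemann_tendsto ht hL).const_mul α
  have hdiff : Tendsto (fun K : ℕ => ∑ l ∈ Finset.range K, (t / K) * (h (l * (t / K)) *
      (Real.exp (α * ∑ j ∈ Finset.range l, (t / K) * L (j * (t / K)))))) atTop
      (𝓝 (∫ s in (0 : ℝ)..t, h s * Real.exp (A s))) := by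
    -- The partial phase sums are first replaced by the exact phase at the grid points; what remains
    -- is an ordinary Riemann sum.
    have hd : Tendsto (fun K : ℕ => ∑ l ∈ Finset.range K, (t / K) * (h (l * (t / K)) *
        (Real.exp (α * ∑ j ∈ Finset.range l, (t / K) * L (j * (t / K))))) -
        ∑ l ∈ Finset.range K, (t / K) * (h (l * (t / K)) * Real.exp (A (l * (t / K))))) atTop
        (𝓝 0) := by
      rw [Metric.tendsto_nhds]
      intro ε hε
      -- The bound `|e^z - 1| ≤ 2|z|` needs `|z| ≤ 1`. The total error is then at most `2 t H ε'`,
      -- which is less than `ε`.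
      set ε' := min 1 (ε / (2 * (t * H + 1))) with hε'
      have hε'0 : 0 < ε' := lt_min one_pos (by positivity)
      have hε1 : ε' * (2 * (t * H + 1)) ≤ ε := by
        rw [← le_div_iff₀ (by positivity)]; exact min_le_right _ _
      filter_upwards [riemann_uniform ht hL (show 0 < ε' / (|α| + 1) by positivity)] with K hK
      rw [Real.dist_eq, sub_zero, ← Finset.sum_sub_distrib]
      set δ := t / K with hδ
      have hδ0 : 0 ≤ δ := by positivity
      have hterm : ∀ l ∈ Finset.range K, |δ * (h (l * δ) *
          (Real.exp (α * ∑ j ∈ Finset.range l, δ * L (j * δ)))) -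
          δ * (h (l * δ) * Real.exp (A (l * δ)))| ≤ δ * (H * (2 * ε')) := by
        intro l hl
        have hm := grid_mem ht (Finset.mem_range.mp hl).le
        have hx := hK l (Finset.mem_range.mp hl).le
        set S := ∑ j ∈ Finset.range l, δ * L (j * δ) with hS
        have hy : |α * S - A (l * δ)| ≤ ε' := by
          rw [hA]
          simp only
          rw [← mul_sub, abs_mul]
          calc _ ≤ (|α| + 1) * (ε' / (|α| + 1)) :=
                mul_le_mul (by linarith) hx (abs_nonneg _) (by positivity)
            _ = ε' := by field_simp
        have hz := Real.abs_exp_sub_one_le (hy.trans (min_le_left _ _))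
        have e : δ * (h (l * δ) * Real.exp (α * S)) - δ * (h (l * δ) * Real.exp (A (l * δ)))
            = δ * ((h (l * δ) * Real.exp (A (l * δ))) * (Real.exp (α * S - A (l * δ)) - 1)) := by
          rw [Real.exp_sub]
          have := (Real.exp_pos (A (l * δ))).ne'
          field_simp
        rw [e, abs_mul, abs_of_nonneg hδ0, abs_mul]
        refine mul_le_mul_of_nonneg_left ?_ hδ0
        refine mul_le_mul (hH _ hm) (by linarith) (abs_nonneg _) hH0
      refine ((Finset.abs_sum_le_sum_abs _ _).trans (Finset.sum_le_sum hterm)).trans_lt ?_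
      rw [Finset.sum_const, Finset.card_range, nsmul_eq_mul]
      have h3 := (grid_mem ht (le_refl K)).2
      have h4 : (K : ℝ) * (δ * (H * (2 * ε'))) = (K * δ) * (H * (2 * ε')) := by ring
      rw [h4]
      have h5 : (K * δ) * (H * (2 * ε')) ≤ t * (H * (2 * ε')) :=
        mul_le_mul_of_nonneg_right h3 (by positivity)
      nlinarith
    have := hd.add h1
    simpa using this
  have hden : Tendsto (fun K : ℕ => w + ∑ l ∈ Finset.range K, (c * (t / K) * h (l * (t / K))) *
        Real.exp (α * ∑ j ∈ Finset.range l, (t / K) * L (j * (t / K)))) atTop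
      (𝓝 (w + c * ∫ s in (0 : ℝ)..t, h s * Real.exp (A s))) := by
    refine tendsto_const_nhds.add ?_
    have := hdiff.const_mul c
    refine this.congr fun K => ?_
    rw [Finset.mul_sum]
    exact Finset.sum_congr rfl fun l _ => by ring
  refine (hden.inv₀ ?_).mul ((Real.continuous_exp.tendsto _).comp hAt)
  have : 0 ≤ ∫ s in (0 : ℝ)..t, h s * Real.exp (A s) :=
    intervalIntegral.integral_nonneg ht fun s hs => mul_nonneg (hh0 s hs) (Real.exp_pos _).le
  have := mul_nonneg hc this
  linarith

end Riemann

/-! ### Estimates on mollified time slices -/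

section Slice

variable {N : ℕ}

theorem weightExp_antitone (k m n : ℕ) : Antitone (weightExp k m n) := by
  intro i j hij
  unfold weightExp topOrder
  split_ifs <;> omega

theorem weightExp_le (k m n p : ℕ) : weightExp k m n p ≤ n := by
  unfold weightExp topOrder
  split_ifs <;> omega

theorem weightExp_le_add_two (k m n p : ℕ) : weightExp k m n p ≤ weightExp k m n (p + 2) + 2 := by
  unfold weightExp topOrder
  split_ifs <;> omega

theorem le_of_ae_le_of_continuous {f g : Sp N → ℝ} (hf : Continuous f) (hg : Continuous g)
    (h : ∀ᵐ x, f x ≤ g x) (x : Sp N) : f x ≤ g x := by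
  by_contra hx
  have ho : IsOpen {x | g x < f x} := isOpen_lt hg hf
  have h0 : volume {x | g x < f x} = 0 := by
    rw [ae_iff] at h
    simpa using h
  have := ho.eq_empty_of_measure_zero h0
  exact (this ▸ (not_le.mp hx : x ∈ {x | g x < f x}) : x ∈ (∅ : Set (Sp N)))

theorem norm_fderiv_le_of_pd {F : Type*} [NormedAddCommGroup F] [NormedSpace ℝ F] {u : Sp N → F}
    {x : Sp N} {B : ℝ} (hB : 0 ≤ B) (h : ∀ i, ‖pd i u x‖ ≤ B) : ‖fderiv ℝ u x‖ ≤ N * B := by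
  refine ContinuousLinearMap.opNorm_le_bound _ (by positivity) fun z => ?_
  conv_lhs => rw [eq_sum_single z, map_sum]
  refine (norm_sum_le _ _).trans ((Finset.sum_le_card_nsmul _ _ (B * ‖z‖) fun i _ => ?_).trans ?_)
  · rw [map_smul, norm_smul, mul_comm]
    exact mul_le_mul (h i) (PiLp.norm_apply_le z i) (norm_nonneg _) hB
  · simp [mul_assoc]

theorem eLpNorm_finset_sum_le {ι : Type*} (s : Finset ι) (c B : ι → ℝ) (f : ι → Sp N → ℝ)
    (hc : ∀ i ∈ s, 0 ≤ c i) (hB : ∀ i ∈ s, 0 ≤ B i)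
    (hf : ∀ i ∈ s, AEStronglyMeasurable (f i) volume)
    (h : ∀ i ∈ s, eLpNorm (f i) 2 volume ≤ ENNReal.ofReal (B i)) :
    eLpNorm (fun x => ∑ i ∈ s, c i * f i x) 2 volume ≤ ENNReal.ofReal (∑ i ∈ s, c i * B i) := by
  have e : (fun x => ∑ i ∈ s, c i * f i x) = ∑ i ∈ s, c i • f i := by
    funext x; simp
  rw [e]
  refine (eLpNorm_sum_le (fun i hi => (hf i hi).const_smul (c i)) (by norm_num)).trans ?_
  rw [ENNReal.ofReal_sum_of_nonneg fun i hi => mul_nonneg (hc i hi) (hB i hi)]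
  refine Finset.sum_le_sum fun i hi => ?_
  rw [eLpNorm_const_smul, Real.enorm_of_nonneg (hc i hi), ENNReal.ofReal_mul (hc i hi)]
  exact mul_le_mul_right (h i hi) _

theorem eLpNorm_le_of_abs_le {f g : Sp N → ℝ} (h : ∀ x, |f x| ≤ g x) :
    eLpNorm f 2 volume ≤ eLpNorm g 2 volume :=
  eLpNorm_mono_real fun x => h x

/-- Mollification is uniformly close to a function with bounded logarithmic derivative. -/
theorem eventually_mollify_close (Λ : ℝ) (hΛ : 0 ≤ Λ) :
    ∀ᶠ q : ℕ in Filter.atTop, ∀ u : Sp N → ℂ, ContDiff ℝ 1 u →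
      (∀ x, ‖fderiv ℝ u x‖ ≤ Λ * ‖u x‖) → ∀ x,
        (∀ y, dist y x < (bump N q).rOut → ‖u y‖ ≤ 2 * ‖u x‖) ∧
        ‖mollify q u x - u x‖ ≤ 1 / 2 * ‖u x‖ := by
  have hlim := (tendsto_bump_rOut (N := N)).const_mul Λ
  rw [mul_zero] at hlim
  filter_upwards [hlim.eventually (ge_mem_nhds (show (0 : ℝ) < 1 / 4 by norm_num))] with q hq
  intro u hu hΛu x
  have hd : Differentiable ℝ u := hu.differentiable one_ne_zero
  have h2 : ∀ y, dist y x < (bump N q).rOut → ‖u y‖ ≤ 2 * ‖u x‖ := by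
    intro y hy
    have hderiv : ∀ τ : ℝ, HasDerivAt (fun τ : ℝ => u (x + τ • (y - x)))
        (fderiv ℝ u (x + τ • (y - x)) (y - x)) τ := by
      intro τ
      have h1 : HasDerivAt (fun τ : ℝ => x + τ • (y - x)) (y - x) τ := by
        simpa using ((hasDerivAt_id τ).smul_const (y - x)).const_add x
      exact (hd _).hasFDerivAt.comp_hasDerivAt τ h1
    have hyx : ‖y - x‖ ≤ (bump N q).rOut := by rw [← dist_eq_norm]; exact hy.le
    -- Gronwall along the segment from `x` to `y`: the logarithmic derivative times its length is at
    -- most `1/4`, so `|u|` grows by at most `e^{1/4} ≤ 2`.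
    have := norm_le_gronwallBound_of_norm_deriv_right_le (f := fun τ : ℝ => u (x + τ • (y - x)))
      (f' := fun τ => fderiv ℝ u (x + τ • (y - x)) (y - x)) (δ := ‖u x‖) (K := 1 / 4) (ε := 0)
      (a := 0) (b := 1) (fun τ _ => (hderiv τ).continuousAt.continuousWithinAt)
      (fun τ _ => (hderiv τ).hasDerivWithinAt) (by simp)
      (fun τ _ => by
        rw [add_zero]
        refine (ContinuousLinearMap.le_opNorm _ _).trans ?_
        calc _ ≤ (Λ * ‖u (x + τ • (y - x))‖) * (bump N q).rOut :=
              mul_le_mul (hΛu _) hyx (norm_nonneg _) (by positivity)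
          _ = (Λ * (bump N q).rOut) * ‖u (x + τ • (y - x))‖ := by ring
          _ ≤ _ := mul_le_mul_of_nonneg_right hq (norm_nonneg _)) 1 ⟨zero_le_one, le_rfl⟩
    rw [gronwallBound_ε0] at this
    simp only [one_smul, add_sub_cancel, sub_zero, mul_one] at this
    refine this.trans ?_
    rw [mul_comm]
    refine mul_le_mul_of_nonneg_right ?_ (norm_nonneg _)
    have := Real.abs_exp_sub_one_le (x := 1 / 4) (by rw [abs_of_pos] <;> norm_num)
    rw [abs_of_pos (show (0 : ℝ) < 1 / 4 by norm_num)] at this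
    have := (abs_le.mp this).2
    linarith
  refine ⟨h2, ?_⟩
  rw [← dist_eq_norm]
  refine ContDiffBump.dist_normed_convolution_le hu.continuous.aestronglyMeasurable fun y hy => ?_
  rw [dist_eq_norm]
  have hy' := Metric.mem_ball.mp hy
  have hmv := (convex_ball x (bump N q).rOut).norm_image_sub_le_of_norm_fderiv_le (𝕜 := ℝ) (f := u)
    (C := Λ * (2 * ‖u x‖)) (fun z _ => hd z)
    (fun z hz => (hΛu z).trans (mul_le_mul_of_nonneg_left (h2 z (Metric.mem_ball.mp hz)) hΛ))
    (Metric.mem_ball_self (bump N q).rOut_pos) hy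
  refine hmv.trans ?_
  have : ‖y - x‖ ≤ (bump N q).rOut := by rw [← dist_eq_norm]; exact hy'.le
  calc _ ≤ Λ * (2 * ‖u x‖) * (bump N q).rOut := mul_le_mul_of_nonneg_left this (by positivity)
    _ = (Λ * (bump N q).rOut) * (2 * ‖u x‖) := by ring
    _ ≤ 1 / 4 * (2 * ‖u x‖) := mul_le_mul_of_nonneg_right hq (by positivity)
    _ = _ := by ring

/-- The bounds on one time slice `u = v(s)`, where `R = (1 - b s)^{-σ}` and `S` is the lower bound
weight. -/
structure SliceBound (k m n : ℕ) (K₁ R S : ℝ) (u : Sp N → ℂ) : Prop where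
  one_le : 1 ≤ R
  contDiff : ContDiff ℝ 2 u
  ne_zero : ∀ x, u x ≠ 0
  weak : ∀ β : Fin N → ℕ, order β ≤ topOrder k m n → IsWeakDeriv β u (weakDeriv β u)
  low : ∀ β : Fin N → ℕ, order β ≤ 2 * m →
    ∀ᵐ x, ‖weakDeriv β u x‖ ≤ K₁ * R ^ order β * ‖u x‖
  mid : ∀ β : Fin N → ℕ, order β ≤ 2 * m + 2 →
    ∀ᵐ x, ‖weakDeriv β u x‖ ≤ K₁ * R ^ (order β + 4) * ‖u x‖
  high : ∀ β : Fin N → ℕ, 2 * m + 1 ≤ order β → order β ≤ topOrder k m n →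
    eLpNorm (fun x => bracket x ^ weightExp k m n (order β) * ‖weakDeriv β u x‖) 2 volume
      ≤ ENNReal.ofReal (K₁ * R ^ (order β + 4))
  lower : ∀ x, S ≤ K₁ * (bracket x ^ n * ‖u x‖)

theorem order_single (i : Fin N) : order (Pi.single i 1 : Fin N → ℕ) = 1 := by
  have := order_add_single (0 : Fin N → ℕ) i
  rwa [zero_add, order_zero] at this

variable {k m n : ℕ} {K₁ R S : ℝ} {u : Sp N → ℂ}

theorem SliceBound.norm_fderiv_le (h : SliceBound k m n K₁ R S u) (hK₁ : 0 ≤ K₁) (hm : 1 ≤ m)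
    (x : Sp N) : ‖fderiv ℝ u x‖ ≤ N * (K₁ * R) * ‖u x‖ := by
  have hR := zero_le_one.trans h.one_le
  rw [mul_assoc]
  refine norm_fderiv_le_of_pd (by positivity) fun i => ?_
  refine le_of_ae_le_of_continuous (f := fun x => ‖pd i u x‖) (g := fun x => K₁ * R * ‖u x‖)
    (contDiff_one_pd i h.contDiff).continuous.norm
    (continuous_const.mul h.contDiff.continuous.norm) ?_ x
  have h1 := h.low (Pi.single i 1) (by rw [order_single]; omega)
  have h2 := (isWeakDeriv_pd i (h.contDiff.of_le (by norm_num))).ae_eq_weakDeriv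
  filter_upwards [h1, h2] with y hy1 hy2
  rw [order_single, pow_one, hy2] at hy1
  exact hy1

/-- The relative size of the derivatives of order `> 2m + 2`, normalized by powers of `R`. -/
noncomputable def highRatio (m : ℕ) (R : ℝ) (v : Sp N → ℂ) (j : ℕ) (x : Sp N) : ℝ :=
  ∑ i ∈ Finset.Ico (2 * m + 3) (j + 1), (R ^ (i + 4))⁻¹ * (‖iteratedFDeriv ℝ i v x‖ / ‖v x‖)

theorem highRatio_nonneg (hR : 0 ≤ R) (v : Sp N → ℂ) (j : ℕ) (x : Sp N) :
    0 ≤ highRatio m R v j x := Finset.sum_nonneg fun i _ => by positivity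

theorem highRatio_mono (hR : 0 ≤ R) (v : Sp N → ℂ) (x : Sp N) :
    Monotone fun j => highRatio m R v j x := fun i j hij =>
  Finset.sum_le_sum_of_subset_of_nonneg (Finset.Ico_subset_Ico_right (by omega))
    fun i _ _ => by positivity

theorem highRatio_eq_zero (v : Sp N → ℂ) {j : ℕ} (hj : j ≤ 2 * m + 2) (x : Sp N) :
    highRatio m R v j x = 0 := by
  rw [highRatio, Finset.Ico_eq_empty (by omega), Finset.sum_empty]

/-- Majorant with a loss factor `q_j` at orders `j > 2m`. -/
noncomputable def lossSeq (M c : ℕ) (r : ℝ) (q : ℕ → ℝ) (j : ℕ) : ℝ :=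
  r ^ (j - c) * if j ≤ M then 1 else q j

/-- When `i + j ≤ 2M + 1`, at most one index exceeds `M`, so the factor `q` occurs at most once on
the left and monotonicity suffices. This is why the unbounded quantities stay linear in every
product. The truncated exponents satisfy `(i - c) + (j - c) ≤ (i + j) - c`. -/
theorem subMul_lossSeq {M c P : ℕ} {r : ℝ} {q : ℕ → ℝ} (hr : 1 ≤ r) (hq : ∀ j, 1 ≤ q j)
    (hmono : Monotone q) (hP : P ≤ 2 * M + 1) : SubMul P (lossSeq M c r q) := by
  have hf : ∀ j, 1 ≤ (if j ≤ M then (1 : ℝ) else q j) := fun j => by split_ifs <;> simp [hq]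
  refine ⟨fun j => one_le_mul_of_one_le_of_one_le (one_le_pow₀ hr) (hf j), fun i j hij => ?_⟩
  unfold lossSeq
  rw [mul_mul_mul_comm, ← pow_add]
  refine mul_le_mul (pow_le_pow_right₀ hr (by omega)) ?_
    (mul_nonneg (zero_le_one.trans (hf i)) (zero_le_one.trans (hf j))) (by positivity)
  by_cases hi : i ≤ M
  · by_cases hj : j ≤ M
    · simpa [hi, hj] using hf (i + j)
    · have : ¬ (i + j ≤ M) := by omega
      simpa [hi, hj, this] using hmono (by omega : j ≤ i + j)
  · have hj : j ≤ M := by omega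
    have : ¬ (i + j ≤ M) := by omega
    simpa [hi, hj, this] using hmono (by omega : i ≤ i + j)

/-- The properties of a mollified slice. -/
structure MollifiedBound (k m n : ℕ) (C₀ C₁ R : ℝ) (u v : Sp N → ℂ) : Prop where
  smooth : ContDiff ℝ ∞ v
  ne_zero : ∀ x, v x ≠ 0
  le_two_mul : ∀ x, ‖v x‖ ≤ 2 * ‖u x‖
  le_two_mul' : ∀ x, ‖u x‖ ≤ 2 * ‖v x‖
  maj : ∀ x, HasMaj (topOrder k m n)
    (lossSeq (2 * m) 0 R fun j => R ^ 4 * (1 + highRatio m R v j x)) (C₀ * ‖v x‖) v x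
  high : ∀ j ≤ topOrder k m n,
    eLpNorm (fun x => bracket x ^ weightExp k m n j * (‖v x‖ * highRatio m R v j x)) 2 volume
      ≤ ENNReal.ofReal C₁

/-- Relative pointwise bounds survive mollification because `u` varies by a bounded factor on the
support of the kernel; weighted `L²` bounds survive by Young's inequality. The constants do not
involve `R`. Only the threshold on `q` depends on `r`, so one scale serves all slices at once. -/
theorem exists_mollifiedBound (N k m n : ℕ) (hm : 1 ≤ m) (K₁ : ℝ) (hK₁ : 0 ≤ K₁) :
    ∃ C₀ C₁ : ℝ, 0 ≤ C₀ ∧ 0 ≤ C₁ ∧ ∀ r : ℝ, 0 ≤ r → ∀ᶠ q : ℕ in Filter.atTop,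
      ∀ (R S : ℝ) (u : Sp N → ℂ), R ≤ r → SliceBound k m n K₁ R S u →
        MollifiedBound k m n C₀ C₁ R u (mollify q u) := by
  -- In the first witness, `4 = 2 · 2` comes from `‖u y‖ ≤ 2 ‖u x‖ ≤ 4 ‖v x‖`, and the `1` serves
  -- orders above `2m + 2`. In the second, `2 ^ n` is the cost of the weights, and the powers of `R`
  -- are removed by the normalization in `highRatio`.
  set J := topOrder k m n with hJ
  refine ⟨max 1 ((max 1 (N : ℝ)) ^ J * (K₁ * 4)), ∑ i ∈ Finset.range (J + 1),
    ∑ β ∈ (Finset.univ : Finset (Fin N)).piAntidiag i, (N : ℝ) ^ i * (2 ^ n * K₁),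
    by positivity, by positivity, fun r hr => ?_⟩
  filter_upwards [eventually_mollify_close (N := N) (N * (K₁ * r)) (by positivity)] with q hq
  intro R S u hRr hu
  have hR1 := hu.one_le
  have hR0 : 0 < R := zero_lt_one.trans_le hR1
  have hcl := hq u (hu.contDiff.of_le (by norm_num)) fun x =>
    (hu.norm_fderiv_le hK₁ hm x).trans (by gcongr)
  set v := mollify q u with hv
  have huloc : LocallyIntegrable u volume := hu.contDiff.continuous.locallyIntegrable
  have hlo : ∀ x, ‖u x‖ ≤ 2 * ‖v x‖ := fun x => by
    have h1 := (hcl x).2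
    have h2 := norm_sub_norm_le (u x) (v x)
    rw [norm_sub_rev] at h2
    linarith
  have hup : ∀ x, ‖v x‖ ≤ 2 * ‖u x‖ := fun x => by
    have h1 := (hcl x).2
    have h2 := norm_sub_norm_le (v x) (u x)
    linarith [norm_nonneg (u x)]
  have hne : ∀ x, v x ≠ 0 := fun x h0 => by
    have := hlo x
    rw [h0, norm_zero, mul_zero] at this
    exact hu.ne_zero x (norm_le_zero_iff.mp this)
  have hpt : ∀ (j : ℕ) (A : ℝ), 0 ≤ A → j ≤ J →
      (∀ β : Fin N → ℕ, order β = j → ∀ᵐ x, ‖weakDeriv β u x‖ ≤ K₁ * A * ‖u x‖) →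
      ∀ x, ‖iteratedFDeriv ℝ j v x‖ ≤ (max 1 (N : ℝ)) ^ J * (K₁ * 4) * ‖v x‖ * A := by
    intro j A hA hj hβ x
    have h1 := norm_iteratedFDeriv_mollify_le q j huloc
      (fun β hβj => hu.weak β (hβj ▸ hj)) x (B := K₁ * A * (2 * ‖u x‖)) (fun β hβj => by
        refine norm_mollify_le q ?_
        filter_upwards [hβ β hβj] with y hy hd
        exact hy.trans (mul_le_mul_of_nonneg_left ((hcl x).1 y hd) (by positivity)))
    refine h1.trans ?_
    have h2 : (N : ℝ) ^ j ≤ (max 1 (N : ℝ)) ^ J :=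
      (pow_le_pow_left₀ (Nat.cast_nonneg _) (le_max_right _ _) j).trans
        (pow_le_pow_right₀ (le_max_left _ _) hj)
    have h3 := hlo x
    calc _ ≤ (max 1 (N : ℝ)) ^ J * (K₁ * A * (2 * (2 * ‖v x‖))) := by gcongr
      _ = _ := by ring
  refine ⟨contDiff_mollify q huloc, hne, hup, hlo, fun x j hj => ?_, fun j hj => ?_⟩
  · unfold lossSeq
    rw [Nat.sub_zero]
    by_cases hj1 : j ≤ 2 * m
    · rw [if_pos hj1, mul_one]
      refine (hpt j (R ^ j) (by positivity) hj (fun β hβ => ?_) x).trans ?_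
      · have := hu.low β (by omega)
        rwa [hβ] at this
      · gcongr
        exact le_max_right _ _
    · rw [if_neg hj1]
      have hQ := highRatio_nonneg (m := m) hR0.le v j x
      by_cases hj2 : j ≤ 2 * m + 2
      · refine (hpt j (R ^ (j + 4)) (by positivity) hj (fun β hβ => ?_) x).trans ?_
        · have := hu.mid β (by omega)
          rwa [hβ] at this
        · rw [pow_add]
          have : R ^ j * R ^ 4 ≤ R ^ j * (R ^ 4 * (1 + highRatio m R v j x)) := by
            rw [← mul_assoc]
            exact le_mul_of_one_le_right (by positivity) (by linarith)
          gcongr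
          exact le_max_right _ _
      -- Above order `2m + 2` there is nothing to estimate pointwise: the derivative is itself one
      -- of the terms of the loss factor.
      · have hterm : (R ^ (j + 4))⁻¹ * (‖iteratedFDeriv ℝ j v x‖ / ‖v x‖) ≤ highRatio m R v j x :=
          Finset.single_le_sum (f := fun i => (R ^ (i + 4))⁻¹ * (‖iteratedFDeriv ℝ i v x‖ / ‖v x‖))
            (fun i _ => by positivity) (Finset.mem_Ico.mpr ⟨by omega, by omega⟩)
        have hvp := norm_pos_iff.mpr (hne x)
        have e : ‖iteratedFDeriv ℝ j v x‖ = ‖v x‖ * (R ^ j * (R ^ 4 *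
            ((R ^ (j + 4))⁻¹ * (‖iteratedFDeriv ℝ j v x‖ / ‖v x‖)))) := by
          rw [pow_add]
          field_simp
        rw [e]
        calc _ ≤ ‖v x‖ * (R ^ j * (R ^ 4 * (1 + highRatio m R v j x))) := by
              gcongr; linarith
          _ ≤ _ := by
              rw [mul_assoc (max _ _)]
              exact le_mul_of_one_le_left (by positivity) (le_max_left _ _)
  · have hmeas : ∀ (i : ℕ) (β : Fin N → ℕ), order β ≤ J → AEStronglyMeasurable
        (fun x => bracket x ^ i * ‖mollify q (weakDeriv β u) x‖) volume := fun i β hβ =>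
      ((continuous_bracket.pow i).mul
        (contDiff_mollify q (hu.weak β hβ).2.1).continuous.norm).aestronglyMeasurable
    have hin : ∀ i ∈ Finset.Ico (2 * m + 3) (j + 1),
        eLpNorm (fun x => ∑ β ∈ (Finset.univ : Finset (Fin N)).piAntidiag i, (N : ℝ) ^ i *
          (bracket x ^ weightExp k m n i * ‖mollify q (weakDeriv β u) x‖)) 2 volume ≤
        ENNReal.ofReal (∑ β ∈ (Finset.univ : Finset (Fin N)).piAntidiag i,
          (N : ℝ) ^ i * (2 ^ n * (K₁ * R ^ (i + 4)))) := by
      intro i hi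
      have hi' := Finset.mem_Ico.mp hi
      have hord : ∀ β ∈ (Finset.univ : Finset (Fin N)).piAntidiag i, order β = i := fun β hβ =>
        (Finset.mem_piAntidiag.mp hβ).1
      refine eLpNorm_finset_sum_le _ _ _ _ (fun _ _ => by positivity) (fun _ _ => by positivity)
        (fun β hβ => hmeas _ _ ((hord β hβ).le.trans (by omega))) fun β hβ => ?_
      have hβi := hord β hβ
      refine (eLpNorm_bracket_mollify_le q _
        (hu.weak β (hβi.le.trans (by omega))).2.1.aestronglyMeasurable).trans ?_
      have h1 := hu.high β (by omega) (hβi.le.trans (by omega))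
      rw [hβi] at h1
      rw [ENNReal.ofReal_mul (by positivity)]
      refine mul_le_mul' (ENNReal.ofReal_le_ofReal ?_) h1
      exact pow_le_pow_right₀ (by norm_num) (weightExp_le _ _ _ _)
    have hall := eLpNorm_finset_sum_le (Finset.Ico (2 * m + 3) (j + 1))
      (fun i => (R ^ (i + 4))⁻¹) (fun i => ∑ β ∈ (Finset.univ : Finset (Fin N)).piAntidiag i,
          (N : ℝ) ^ i * (2 ^ n * (K₁ * R ^ (i + 4)))) _ (fun i _ => by positivity)
      (fun i _ => by positivity) (fun i hi => ?_) hin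
    · refine (eLpNorm_le_of_abs_le fun x => ?_).trans (hall.trans (ENNReal.ofReal_le_ofReal ?_))
      · have hb := bracket_pos x
        rw [abs_of_nonneg (mul_nonneg (by positivity) (mul_nonneg (norm_nonneg _)
          (highRatio_nonneg hR0.le v j x))), highRatio, Finset.mul_sum, Finset.mul_sum]
        refine Finset.sum_le_sum fun i hi => ?_
        have hi' := Finset.mem_Ico.mp hi
        have hvp := norm_pos_iff.mpr (hne x)
        have e : bracket x ^ weightExp k m n j * (‖v x‖ * ((R ^ (i + 4))⁻¹ *
            (‖iteratedFDeriv ℝ i v x‖ / ‖v x‖))) =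
            (R ^ (i + 4))⁻¹ * (bracket x ^ weightExp k m n j * ‖iteratedFDeriv ℝ i v x‖) := by
          field_simp
        rw [e]
        refine mul_le_mul_of_nonneg_left ?_ (by positivity)
        rw [← Finset.mul_sum, ← Finset.mul_sum, mul_left_comm]
        -- The loss factor at order `j` sums orders `i ≤ j`, for which the available weight `μ(i)`
        -- is at least `μ(j)`.
        refine mul_le_mul (pow_le_pow_right₀ (one_le_bracket x)
          (weightExp_antitone k m n (by omega))) ?_ (norm_nonneg _) (by positivity)
        refine norm_iteratedFDeriv_mollify_le q i huloc
          (fun β hβj => hu.weak β (by omega)) x (fun β hβj => ?_)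
        exact Finset.single_le_sum (f := fun β => ‖mollify q (weakDeriv β u) x‖)
          (fun _ _ => norm_nonneg _) (Finset.mem_piAntidiag.mpr ⟨hβj, by simp⟩)
      · calc _ ≤ ∑ i ∈ Finset.Ico (2 * m + 3) (j + 1),
              ∑ β ∈ (Finset.univ : Finset (Fin N)).piAntidiag i, (N : ℝ) ^ i * (2 ^ n * K₁) := by
              refine Finset.sum_le_sum fun i _ => ?_
              rw [Finset.mul_sum]
              refine Finset.sum_le_sum fun β _ => le_of_eq ?_
              field_simp
          _ ≤ _ := Finset.sum_le_sum_of_subset_of_nonneg (fun i hi => by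
              have := Finset.mem_Ico.mp hi
              exact Finset.mem_range.mpr (by omega)) fun i _ _ => by positivity
    · have hi' := Finset.mem_Ico.mp hi
      have hc : ∀ β ∈ (Finset.univ : Finset (Fin N)).piAntidiag i, Continuous fun x =>
          (N : ℝ) ^ i * (bracket x ^ weightExp k m n i * ‖mollify q (weakDeriv β u) x‖) :=
        fun β hβ => continuous_const.mul ((continuous_bracket.pow _).mul
          (contDiff_mollify q (hu.weak β ((Finset.mem_piAntidiag.mp hβ).1.le.trans
            (by omega))).2.1).continuous.norm)
      exact (continuous_finsetSum _ hc).aestronglyMeasurable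

end Slice

/-! ### Estimates on the regularized amplitude -/

section Grid

variable {N : ℕ}

theorem continuous_highRatio {m : ℕ} {R : ℝ} {v : Sp N → ℂ} (hv : ContDiff ℝ ∞ v)
    (hne : ∀ x, v x ≠ 0) (j : ℕ) : Continuous (highRatio m R v j) := by
  refine continuous_finsetSum _ fun i _ => continuous_const.mul ?_
  exact (hv.continuous_iteratedFDeriv (by exact_mod_cast le_top)).norm.div hv.continuous.norm
    fun x => norm_ne_zero_iff.mpr (hne x)

/-- Orders `2m + 1` and `2m + 2` of `v` are still bounded pointwise, at the price of `R ^ 4`. After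
the shift by two, the phase thus has no loss up to order `2m`, which is the range of item 4. -/
theorem lossSeq_shift_le {m : ℕ} {R : ℝ} (hR : 1 ≤ R) (v : Sp N → ℂ) (x : Sp N) (j : ℕ) :
    lossSeq (2 * m) 0 R (fun j => R ^ 4 * (1 + highRatio m R v j x)) (j + 2)
      ≤ R ^ (j + 6) * if j ≤ 2 * m then 1 else 1 + highRatio m R v (j + 2) x := by
  have hR0 : 0 ≤ R := zero_le_one.trans hR
  unfold lossSeq
  rw [Nat.sub_zero]
  by_cases h1 : j + 2 ≤ 2 * m
  · rw [if_pos h1, if_pos (by omega), mul_one, mul_one]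
    exact pow_le_pow_right₀ hR (by omega)
  · rw [if_neg h1]
    beta_reduce
    by_cases h2 : j ≤ 2 * m
    · rw [if_pos h2, highRatio_eq_zero v (by omega), add_zero, mul_one, mul_one, ← pow_add]
    · rw [if_neg h2, ← mul_assoc, ← pow_add]

/-- The discretized and mollified amplitude. -/
noncomputable def regAmp (α c δ : ℝ) (h : ℕ → ℝ) (u₀ : Sp N → ℂ) (u : ℕ → Sp N → ℂ) (M : ℕ) :
    Sp N → ℝ :=
  discAmp c δ h (fun y => ‖u₀ y‖ ^ (-α)) (discPhase α δ fun l => phaseRate (u l)) M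

/-- The unbounded part of the relative size of the derivatives of the amplitude. -/
noncomputable def lossPart (m : ℕ) (δ : ℝ) (R : ℕ → ℝ) (v₀ : Sp N → ℂ) (v : ℕ → Sp N → ℂ) (M : ℕ)
    (j : ℕ) (x : Sp N) : ℝ :=
  highRatio m 1 v₀ j x +
    ∑ l ∈ Finset.range M, (δ * R l ^ 7) * highRatio m (R l) (v l) (j + 2) x

/-- For `j ≥ 1` a slice contributes `R_l^{j+6} = R_l^{j-1} R_l^7` to the phase. The first factor is
at most `r^{j-1}`, the growth claimed in items 4 and 5. The second is summable in time with total at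
most `C₅`. This explains the offset `c = 1` in the resulting majorant. -/
theorem regAmp_hasMaj (N k m n : ℕ) (α C₀ C₅ : ℝ) (hα : 0 ≤ α) (hC₀ : 0 ≤ C₀) (hC₅ : 0 ≤ C₅)
    (hJ : topOrder k m n ≤ 4 * m + 1) : ∃ C, 0 ≤ C ∧
    ∀ (C₁ r c δ : ℝ) (h R : ℕ → ℝ) (u₀ v₀ : Sp N → ℂ) (u v : ℕ → Sp N → ℂ) (M : ℕ) (x : Sp N),
      1 ≤ r → 0 ≤ c → 0 ≤ δ → (∀ l, 0 ≤ h l) → (∀ l, 1 ≤ R l) → (∀ l, R l ≤ r) →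
      MollifiedBound k m n C₀ C₁ 1 u₀ v₀ →
      (∀ l, MollifiedBound k m n C₀ C₁ (R l) (u l) (v l)) →
      ∑ l ∈ Finset.range M, δ * R l ^ 7 ≤ C₅ →
      HasMaj (topOrder k m n - 2) (lossSeq (2 * m) 1 r fun j => 1 + lossPart m δ R v₀ v M j x)
        (C * (‖v₀ x‖ ^ (-α) + ∑ l ∈ Finset.range M, c * δ * h l)⁻¹)
        (regAmp α c δ h v₀ v M) x := by
  set P := topOrder k m n - 2 with hP
  have hJP : topOrder k m n = P + 2 := by rw [hP]; unfold topOrder; omega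
  obtain ⟨CL, hCL, HL⟩ := HasMaj.phaseRate (N := N) P C₀ hC₀
  obtain ⟨Cw, hCw, Hw⟩ := HasMaj.norm_rpow_neg (N := N) P α C₀ hC₀
  obtain ⟨C, hC, HA⟩ := HasMaj.discAmp (N := N) P (max Cw (α * CL * (C₅ + 1))) (α * CL * C₅)
    (le_max_of_le_left hCw) (by positivity)
  refine ⟨C, hC, fun C₁ r c δ h R u₀ v₀ u v M x hr hc hδ hh hR hRr hm₀ hm hsum => ?_⟩
  have hR0 : ∀ l, 0 ≤ R l := fun l => zero_le_one.trans (hR l)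
  set Q := fun j => lossPart m δ R v₀ v M j x with hQ
  set T := fun j => ∑ l ∈ Finset.range M, (δ * R l ^ 7) * highRatio m (R l) (v l) (j + 2) x with hT
  have hT0 : ∀ j, 0 ≤ T j := fun j => Finset.sum_nonneg fun l _ =>
    mul_nonneg (mul_nonneg hδ (pow_nonneg (hR0 l) 7)) (highRatio_nonneg (hR0 l) _ _ _)
  have hH0 : ∀ j, 0 ≤ highRatio m 1 v₀ j x := fun j => highRatio_nonneg zero_le_one _ _ _
  have hQe : ∀ j, Q j = highRatio m 1 v₀ j x + T j := fun j => rfl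
  have hQ0 : ∀ j, 0 ≤ Q j := fun j => add_nonneg (hH0 j) (hT0 j)
  have hQm : Monotone fun j => 1 + Q j := by
    intro i j hij
    refine add_le_add le_rfl (add_le_add (highRatio_mono zero_le_one v₀ x hij)
      (Finset.sum_le_sum fun l _ => ?_))
    exact mul_le_mul_of_nonneg_left (highRatio_mono (hR0 l) (v l) x (by omega : i + 2 ≤ j + 2))
      (mul_nonneg hδ (pow_nonneg (hR0 l) 7))
  have ha : SubMul P (lossSeq (2 * m) 1 r fun j => 1 + Q j) :=
    subMul_lossSeq hr (fun j => by linarith [hQ0 j]) hQm (by omega)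
  have hat : ∀ l, SubMul (P + 2)
      (lossSeq (2 * m) 0 (R l) fun j => R l ^ 4 * (1 + highRatio m (R l) (v l) j x)) := fun l =>
    subMul_lossSeq (hR l)
      (fun j => one_le_mul_of_one_le_of_one_le (one_le_pow₀ (hR l))
        (by linarith [highRatio_nonneg (m := m) (hR0 l) (v l) j x]))
      (fun i j hij => mul_le_mul_of_nonneg_left
        (add_le_add le_rfl (highRatio_mono (hR0 l) (v l) x hij)) (pow_nonneg (hR0 l) 4))
      (by omega)
  have hphase : ∀ l, ∀ j ≤ P, ‖iteratedFDeriv ℝ j (phaseRate (v l)) x‖ ≤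
      CL * (R l ^ (j + 6) * if j ≤ 2 * m then 1 else 1 + highRatio m (R l) (v l) (j + 2) x) := by
    intro l j hj
    have h1 := HL _ (v l) x (hat l) (hm l).smooth (hm l).ne_zero (hJP ▸ (hm l).maj x) j hj
    exact h1.trans (mul_le_mul_of_nonneg_left (lossSeq_shift_le (hR l) (v l) x j) hCL)
  have hphsm : ∀ l, ContDiff ℝ ∞ (phaseRate (v l)) := fun l =>
    contDiff_phaseRate (hm l).smooth (hm l).ne_zero
  have hA : ∀ i ≤ M, ∀ j ≤ P,
      ‖iteratedFDeriv ℝ j (discPhase α δ (fun l => phaseRate (v l)) i) x‖ ≤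
      (α * CL) * ∑ l ∈ Finset.range M, δ * (R l ^ (j + 6) *
        if j ≤ 2 * m then 1 else 1 + highRatio m (R l) (v l) (j + 2) x) := by
    intro i hi j hj
    refine (norm_iteratedFDeriv_sum_mul_le (Finset.range i) (fun _ => α * δ)
      (fun _ => mul_nonneg hα hδ) _ hphsm j x).trans ?_
    have hnn : ∀ l, 0 ≤ R l ^ (j + 6) *
        if j ≤ 2 * m then 1 else 1 + highRatio m (R l) (v l) (j + 2) x := fun l => by
      refine mul_nonneg (pow_nonneg (hR0 l) _) ?_
      have := highRatio_nonneg (m := m) (hR0 l) (v l) (j + 2) x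
      split_ifs <;> linarith
    rw [Finset.mul_sum]
    calc _ ≤ ∑ l ∈ Finset.range i, (α * CL) * (δ * (R l ^ (j + 6) *
          if j ≤ 2 * m then 1 else 1 + highRatio m (R l) (v l) (j + 2) x)) := by
          refine Finset.sum_le_sum fun l _ => ?_
          refine (mul_le_mul_of_nonneg_left (hphase l j hj) (mul_nonneg hα hδ)).trans (le_of_eq ?_)
          ring
      _ ≤ _ := Finset.sum_le_sum_of_subset_of_nonneg
          (Finset.range_subset_range.mpr hi)
          fun l _ _ => mul_nonneg (mul_nonneg hα hCL) (mul_nonneg hδ (hnn l))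
  refine HA _ c δ h _ _ M x ha hc hδ hh (contDiff_norm_rpow_neg hm₀.smooth hm₀.ne_zero α)
    (fun y => Real.rpow_pos_of_pos (norm_pos_iff.mpr (hm₀.ne_zero y)) _)
    (fun l => contDiff_discPhase α δ hphsm l) (fun i hi => ?_) (fun i hi j hj1 hj => ?_) ?_
  -- At order zero the cost is `R_l^6 ≤ R_l^7`, so the same sum bounds the phases themselves.
  · have h1 := hA i hi 0 (Nat.zero_le _)
    rw [norm_iteratedFDeriv_zero, Real.norm_eq_abs] at h1
    refine h1.trans (mul_le_mul_of_nonneg_left ?_ (by positivity))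
    refine le_trans (Finset.sum_le_sum fun l _ => ?_) hsum
    rw [if_pos (Nat.zero_le _), mul_one]
    exact mul_le_mul_of_nonneg_left (pow_le_pow_right₀ (hR l) (by omega)) hδ
  · refine (hA i hi j hj).trans ?_
    have hfac : ∑ l ∈ Finset.range M, δ * (R l ^ (j + 6) *
        if j ≤ 2 * m then 1 else 1 + highRatio m (R l) (v l) (j + 2) x) ≤
        (C₅ + 1) * lossSeq (2 * m) 1 r (fun j => 1 + Q j) j := by
      calc _ ≤ ∑ l ∈ Finset.range M, r ^ (j - 1) * (δ * R l ^ 7 *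
            if j ≤ 2 * m then 1 else 1 + highRatio m (R l) (v l) (j + 2) x) := by
            refine Finset.sum_le_sum fun l _ => ?_
            have hnn : 0 ≤ (if j ≤ 2 * m then (1 : ℝ) else
                1 + highRatio m (R l) (v l) (j + 2) x) := by
              have := highRatio_nonneg (m := m) (hR0 l) (v l) (j + 2) x
              split_ifs <;> linarith
            have e : R l ^ (j + 6) = R l ^ (j - 1) * R l ^ 7 := by rw [← pow_add]; congr 1; omega
            rw [e]
            have : R l ^ (j - 1) ≤ r ^ (j - 1) := pow_le_pow_left₀ (hR0 l) (hRr l) _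
            have h7 := pow_nonneg (hR0 l) 7
            calc _ = R l ^ (j - 1) * (δ * R l ^ 7 * if j ≤ 2 * m then 1 else
                  1 + highRatio m (R l) (v l) (j + 2) x) := by ring
              _ ≤ _ := by gcongr
        _ = r ^ (j - 1) * ∑ l ∈ Finset.range M, (δ * R l ^ 7 *
            if j ≤ 2 * m then 1 else 1 + highRatio m (R l) (v l) (j + 2) x) := by
            rw [Finset.mul_sum]
        _ ≤ r ^ (j - 1) * ((C₅ + 1) * if j ≤ 2 * m then 1 else 1 + Q j) := by
            refine mul_le_mul_of_nonneg_left ?_ (by positivity)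
            by_cases hjm : j ≤ 2 * m
            · simp only [if_pos hjm, mul_one]
              linarith
            · simp only [if_neg hjm, mul_add, mul_one, Finset.sum_add_distrib]
              have h1 := hH0 j
              have h2 := hT0 j
              have h3 : ∑ l ∈ Finset.range M, δ * R l ^ 7 * highRatio m (R l) (v l) (j + 2) x = T j :=
                rfl
              rw [h3, hQe]
              nlinarith [mul_nonneg hC₅ h1, mul_nonneg hC₅ h2]
        _ = _ := by unfold lossSeq; ring
    calc _ ≤ (α * CL) * ((C₅ + 1) * lossSeq (2 * m) 1 r (fun j => 1 + Q j) j) :=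
          mul_le_mul_of_nonneg_left hfac (by positivity)
      _ = (α * CL * (C₅ + 1)) * lossSeq (2 * m) 1 r (fun j => 1 + Q j) j := by ring
      _ ≤ _ := mul_le_mul_of_nonneg_right (le_max_right _ _) (ha.nonneg j)
  · have h1 := ((hm₀.maj x).mono_order (show P ≤ topOrder k m n by omega))
    have hcomp : ∀ j ≤ P, lossSeq (2 * m) 0 1 (fun j => 1 ^ 4 * (1 + highRatio m 1 v₀ j x)) j ≤
        lossSeq (2 * m) 1 r (fun j => 1 + Q j) j := by
      intro j _
      unfold lossSeq
      rw [one_pow]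
      refine mul_le_mul (one_le_pow₀ hr) ?_ ?_ (by positivity)
      · split_ifs
        · exact le_rfl
        · beta_reduce; rw [one_pow, one_mul, hQe]; linarith [hT0 j]
      · have := hH0 j
        split_ifs
        · exact zero_le_one
        · positivity
    have hnn : ∀ j, 0 ≤ lossSeq (2 * m) 0 1 (fun j => 1 ^ 4 * (1 + highRatio m 1 v₀ j x)) j := by
      intro j
      unfold lossSeq
      have := hH0 j
      split_ifs <;> positivity
    have h2 := h1.mono le_rfl hcomp hnn (mul_nonneg hC₀ (norm_nonneg _))
    refine (Hw _ v₀ x ha hm₀.smooth hm₀.ne_zero h2).mono ?_ (fun j _ => le_rfl) ha.nonneg ?_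
    · exact mul_le_mul_of_nonneg_right (le_max_left _ _) (Real.rpow_nonneg (norm_nonneg _) _)
    · exact mul_nonneg (le_max_of_le_left hCw) (Real.rpow_nonneg (norm_nonneg _) _)

theorem contDiff_regAmp {α c δ : ℝ} (hc : 0 ≤ c) (hδ : 0 ≤ δ) {h : ℕ → ℝ} (hh : ∀ l, 0 ≤ h l)
    {v₀ : Sp N → ℂ} {v : ℕ → Sp N → ℂ} (hv₀ : ContDiff ℝ ∞ v₀) (hne₀ : ∀ x, v₀ x ≠ 0)
    (hv : ∀ l, ContDiff ℝ ∞ (v l)) (hne : ∀ l x, v l x ≠ 0) (M : ℕ) :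
    ContDiff ℝ ∞ (regAmp α c δ h v₀ v M) :=
  contDiff_discAmp hc hδ hh (contDiff_norm_rpow_neg hv₀ hne₀ α)
    (fun y => Real.rpow_pos_of_pos (norm_pos_iff.mpr (hne₀ y)) _)
    (fun l => contDiff_discPhase α δ (fun l => contDiff_phaseRate (hv l) (hne l)) l)

/-- The relative derivatives of slice `l` are square integrable only after multiplication by
`|v_l|`, while the available factor is `|u₀|`. The upper bound on `u₀` and the lower bound on the
slice have the same profile `⟨x⟩^{-n}`, so one is exchanged for the other at the cost `1 / S_l`. -/
theorem eLpNorm_lossPart_le {k m n : ℕ} {C₀ C₁ C₅ K₁ B δ : ℝ} {R S : ℕ → ℝ} {u₀ v₀ : Sp N → ℂ}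
    {u v : ℕ → Sp N → ℂ} {M : ℕ} (hδ : 0 ≤ δ) (hR : ∀ l, 0 ≤ R l) (hS : ∀ l, 0 < S l)
    (hK₁ : 0 ≤ K₁) (hB : 0 ≤ B) (hC₁ : 0 ≤ C₁)
    (hm₀ : MollifiedBound k m n C₀ C₁ 1 u₀ v₀)
    (hm : ∀ l, MollifiedBound k m n C₀ C₁ (R l) (u l) (v l))
    (hlow : ∀ l x, S l ≤ K₁ * (bracket x ^ n * ‖u l x‖))
    (hu₀ : ∀ x, bracket x ^ n * ‖u₀ x‖ ≤ B)
    (hsum : ∑ l ∈ Finset.range M, δ * R l ^ 7 / S l ≤ C₅) {j : ℕ} (hj : j + 2 ≤ topOrder k m n) :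
    eLpNorm (fun x => bracket x ^ weightExp k m n (j + 2) *
      (‖u₀ x‖ * lossPart m δ R v₀ v M j x)) 2 volume
      ≤ ENNReal.ofReal (2 * C₁ + 2 * B * K₁ * C₁ * C₅) := by
  set W := fun x : Sp N => bracket x ^ weightExp k m n (j + 2) with hW
  have hWc : Continuous W := continuous_bracket.pow _
  have hWpos : ∀ x, 0 < W x := fun x => pow_pos (bracket_pos x) _
  have h1 : eLpNorm (fun x => 2 * (bracket x ^ weightExp k m n j * (‖v₀ x‖ * highRatio m 1 v₀ j x)))
      2 volume ≤ ENNReal.ofReal (2 * C₁) := by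
    have := eLpNorm_finset_sum_le (N := N) {()} (fun _ => 2) (fun _ => C₁) (fun _ x =>
      bracket x ^ weightExp k m n j * (‖v₀ x‖ * highRatio m 1 v₀ j x)) (by simp) (by simpa)
      (fun _ _ => ((continuous_bracket.pow _).mul (hm₀.smooth.continuous.norm.mul
        (continuous_highRatio hm₀.smooth hm₀.ne_zero j))).aestronglyMeasurable)
      (fun _ _ => hm₀.high j (by omega))
    simpa using this
  have h2 := eLpNorm_finset_sum_le (N := N) (Finset.range M)
    (fun l => δ * R l ^ 7 / S l * (2 * B * K₁)) (fun _ => C₁)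
    (fun l x => W x * (‖v l x‖ * highRatio m (R l) (v l) (j + 2) x))
    (fun l _ => mul_nonneg (div_nonneg (mul_nonneg hδ (pow_nonneg (hR l) 7)) (hS l).le)
      (by positivity)) (fun _ _ => hC₁)
    (fun l _ => (hWc.mul ((hm l).smooth.continuous.norm.mul
      (continuous_highRatio (hm l).smooth (hm l).ne_zero _))).aestronglyMeasurable)
    (fun l _ => (hm l).high (j + 2) hj)
  have hm1 : AEStronglyMeasurable (fun x => 2 * (bracket x ^ weightExp k m n j *
      (‖v₀ x‖ * highRatio m 1 v₀ j x))) volume :=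
    (continuous_const.mul ((continuous_bracket.pow _).mul (hm₀.smooth.continuous.norm.mul
        (continuous_highRatio hm₀.smooth hm₀.ne_zero j)))).aestronglyMeasurable
  have hm2 : AEStronglyMeasurable (fun x => ∑ l ∈ Finset.range M,
      (δ * R l ^ 7 / S l * (2 * B * K₁)) *
        (W x * (‖v l x‖ * highRatio m (R l) (v l) (j + 2) x))) volume :=
    (continuous_finsetSum _ fun l _ => continuous_const.mul (hWc.mul
      ((hm l).smooth.continuous.norm.mul
      (continuous_highRatio (hm l).smooth (hm l).ne_zero _)))).aestronglyMeasurable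
  have h3 := (eLpNorm_add_le hm1 hm2 (by norm_num)).trans (add_le_add h1 h2)
  refine (eLpNorm_le_of_abs_le fun x => ?_).trans (h3.trans ?_)
  · have hH := highRatio_nonneg (m := m) zero_le_one v₀ j x
    have hHl : ∀ l, 0 ≤ highRatio m (R l) (v l) (j + 2) x := fun l =>
      highRatio_nonneg (hR l) (v l) _ x
    have hcoef : ∀ l, 0 ≤ δ * R l ^ 7 := fun l => mul_nonneg hδ (pow_nonneg (hR l) 7)
    have hT0 : 0 ≤ ∑ l ∈ Finset.range M, (δ * R l ^ 7) * highRatio m (R l) (v l) (j + 2) x :=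
      Finset.sum_nonneg fun l _ => mul_nonneg (hcoef l) (hHl l)
    have hnn : 0 ≤ bracket x ^ weightExp k m n (j + 2) *
        (‖u₀ x‖ * lossPart m δ R v₀ v M j x) :=
      mul_nonneg (hWpos x).le (mul_nonneg (norm_nonneg _) (add_nonneg hH hT0))
    rw [abs_of_nonneg hnn]
    simp only [Pi.add_apply, lossPart, mul_add]
    refine add_le_add ?_ ?_
    · calc _ ≤ bracket x ^ weightExp k m n j * ((2 * ‖v₀ x‖) * highRatio m 1 v₀ j x) := by
            refine mul_le_mul ?_ ?_ (by positivity) (pow_nonneg (bracket_pos x).le _)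
            · exact pow_le_pow_right₀ (one_le_bracket x) (weightExp_antitone k m n (by omega))
            · exact mul_le_mul_of_nonneg_right (hm₀.le_two_mul' x) hH
        _ = _ := by ring
    · rw [Finset.mul_sum, Finset.mul_sum]
      refine Finset.sum_le_sum fun l _ => ?_
      have hbn : 0 < bracket x ^ n := pow_pos (bracket_pos x) n
      have hkey : ‖u₀ x‖ ≤ 2 * B * K₁ / S l * ‖v l x‖ := by
        have e1 : ‖u₀ x‖ ≤ B / bracket x ^ n := by
          rw [le_div_iff₀ hbn, mul_comm]; exact hu₀ x
        have e2 : 1 / bracket x ^ n ≤ K₁ * (2 * ‖v l x‖) / S l := by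
          rw [div_le_div_iff₀ hbn (hS l), one_mul]
          refine (hlow l x).trans ?_
          have := (hm l).le_two_mul' x
          calc _ ≤ K₁ * (bracket x ^ n * (2 * ‖v l x‖)) := by gcongr
            _ = _ := by ring
        calc _ ≤ B * (1 / bracket x ^ n) := by rw [mul_one_div]; exact e1
          _ ≤ B * (K₁ * (2 * ‖v l x‖) / S l) := mul_le_mul_of_nonneg_left e2 hB
          _ = _ := by ring
      calc W x * (‖u₀ x‖ * (δ * R l ^ 7 * highRatio m (R l) (v l) (j + 2) x))
          ≤ W x * ((2 * B * K₁ / S l * ‖v l x‖) *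
            (δ * R l ^ 7 * highRatio m (R l) (v l) (j + 2) x)) := by
            refine mul_le_mul_of_nonneg_left ?_ (hWpos x).le
            exact mul_le_mul_of_nonneg_right hkey (mul_nonneg (hcoef l) (hHl l))
        _ = _ := by ring
  · rw [← ENNReal.ofReal_add (by positivity) (Finset.sum_nonneg fun l _ => mul_nonneg
      (mul_nonneg (div_nonneg (mul_nonneg hδ (pow_nonneg (hR l) 7)) (hS l).le)
      (by positivity)) hC₁)]
    refine ENNReal.ofReal_le_ofReal (add_le_add le_rfl ?_)
    rw [← Finset.sum_mul, ← Finset.sum_mul]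
    have : 0 ≤ 2 * B * K₁ * C₁ := by positivity
    calc _ = (∑ l ∈ Finset.range M, δ * R l ^ 7 / S l) * (2 * B * K₁ * C₁) := by ring
      _ ≤ C₅ * (2 * B * K₁ * C₁) := mul_le_mul_of_nonneg_right hsum this
      _ = _ := by ring

end Grid

/-! ### The ordinary differential equation at a point -/

section ODE

/-- Integration of the equation satisfied by `|z|^{-α}` along a solution at a fixed point. -/
theorem amplitude_formula {α t : ℝ} {lam : ℂ} (ht : 0 ≤ t) {z D : ℝ → ℂ} {h : ℝ → ℝ}
    (hD : ContinuousOn D (Set.Icc 0 t)) (hh : ContinuousOn h (Set.Icc 0 t))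
    (hz : ∀ s ∈ Set.Icc 0 t, z s ≠ 0)
    (heq : ∀ s ∈ Set.Icc 0 t, ∃ dv : ℂ, HasDerivWithinAt z dv (Set.Icc 0 t) s ∧
      Complex.I * dv + D s = lam * ((h s * ‖z s‖ ^ α : ℝ) : ℂ) * z s) :
    ‖z t‖ ^ (-α) * Real.exp (α * ∫ r in (0 : ℝ)..t,
        (‖z r‖ ^ 2)⁻¹ • inner ℝ ((-Complex.I) • z r) (D r)) =
      ‖z 0‖ ^ (-α) + (-(α * lam.im)) * ∫ s in (0 : ℝ)..t, h s *
        Real.exp (α * ∫ r in (0 : ℝ)..s, (‖z r‖ ^ 2)⁻¹ • inner ℝ ((-Complex.I) • z r) (D r)) := by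
  set ℓ : ℝ → ℝ := fun r => (‖z r‖ ^ 2)⁻¹ • inner ℝ ((-Complex.I) • z r) (D r) with hℓ
  set A : ℝ → ℝ := fun s => α * ∫ r in (0 : ℝ)..s, ℓ r with hA
  have hzc : ContinuousOn z (Set.Icc 0 t) := fun s hs => by
    obtain ⟨dv, h1, _⟩ := heq s hs
    exact h1.continuousWithinAt
  have hℓc : ContinuousOn ℓ (Set.Icc 0 t) :=
    ((hzc.norm.pow 2).inv₀ fun s hs => pow_ne_zero 2 (norm_ne_zero_iff.mpr (hz s hs))).smul
      (ContinuousOn.inner (𝕜 := ℝ) (hzc.const_smul (-Complex.I)) hD)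
  have hAc : ContinuousOn A (Set.Icc 0 t) := by
    have := intervalIntegral.continuousOn_primitive_interval (μ := volume) (f := ℓ) (a := 0) (b := t)
      (by rw [Set.uIcc_of_le ht]; exact hℓc.integrableOn_Icc)
    rw [Set.uIcc_of_le ht] at this
    exact continuousOn_const.mul this
  have hWc : ContinuousOn (fun s => ‖z s‖ ^ (-α)) (Set.Icc 0 t) :=
    hzc.norm.rpow_const fun s hs => Or.inl (norm_ne_zero_iff.mpr (hz s hs))
  have hderiv : ∀ s ∈ Set.Ioo 0 t, HasDerivAt (fun s => ‖z s‖ ^ (-α) * Real.exp (A s))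
      (-(α * lam.im) * (h s * Real.exp (A s))) s := by
    intro s hs
    have hs' := Set.Ioo_subset_Icc_self hs
    have hnhds : Set.Icc 0 t ∈ nhds s := Icc_mem_nhds hs.1 hs.2
    obtain ⟨dv, h1, h2⟩ := heq s hs'
    have hzd := h1.hasDerivAt hnhds
    have hAd : HasDerivAt A (α * ℓ s) s := by
      refine HasDerivAt.const_mul α ?_
      refine intervalIntegral.integral_hasDerivAt_right ?_ ?_ (hℓc.continuousAt hnhds)
      · exact (hℓc.mono (by
          rw [Set.uIcc_of_le hs.1.le]; exact Set.Icc_subset_Icc_right hs.2.le)).intervalIntegrable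
      · exact (hℓc.mono Set.Ioo_subset_Icc_self).stronglyMeasurableAtFilter isOpen_Ioo s hs
    have hr : 0 < ‖z s‖ := norm_pos_iff.mpr (hz s hs')
    have hsq : HasDerivAt (fun s => ‖z s‖ ^ 2) (2 * inner ℝ (z s) dv) s := hzd.norm_sq
    -- Real part of the equation paired with `z`: only `Im λ` survives from the nonlinearity. Since
    -- the nonlinear rate of `log |z|` is `Im λ · h |z|^α`, the power `|z|^{-α}` makes that term
    -- independent of `z`.
    have hdv : inner ℝ (z s) dv = ‖z s‖ ^ 2 * (ℓ s + lam.im * (h s * ‖z s‖ ^ α)) := by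
      have e : dv = Complex.I * D s - Complex.I * (lam * ((h s * ‖z s‖ ^ α : ℝ) : ℂ) * z s) := by
        rw [← h2]
        linear_combination dv * Complex.I_mul_I
      have hn : ‖z s‖ ^ 2 = (z s).re * (z s).re + (z s).im * (z s).im := by
        rw [← Complex.normSq_eq_norm_sq, Complex.normSq_apply]
      rw [hℓ]
      simp only [smul_eq_mul]
      rw [mul_add, ← mul_assoc, mul_inv_cancel₀ (pow_ne_zero 2 hr.ne'), one_mul, e, hn]
      simp only [Complex.inner, Complex.mul_re, Complex.mul_im, Complex.sub_re, Complex.sub_im,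
        Complex.conj_re, Complex.conj_im, Complex.I_re, Complex.I_im, Complex.ofReal_re,
        Complex.ofReal_im, Complex.neg_re, Complex.neg_im]
      ring
    have hW : HasDerivAt (fun s => (‖z s‖ ^ 2) ^ (-α / 2))
        (2 * inner ℝ (z s) dv * (-α / 2) * (‖z s‖ ^ 2) ^ (-α / 2 - 1)) s :=
      hsq.rpow_const (Or.inl (pow_ne_zero 2 hr.ne'))
    have hpow : ∀ r : ℝ, 0 ≤ r → (r ^ 2) ^ (-α / 2) = r ^ (-α) := fun r hr => by
      rw [← Real.rpow_natCast, ← Real.rpow_mul hr]; congr 1; push_cast; ring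
    have hW' : HasDerivAt (fun s => ‖z s‖ ^ (-α))
        (-(α * ‖z s‖ ^ (-α) * ℓ s) - α * lam.im * h s) s := by
      have e : (fun s => ‖z s‖ ^ (-α)) = fun s => (‖z s‖ ^ 2) ^ (-α / 2) :=
        funext fun s => (hpow _ (norm_nonneg _)).symm
      rw [e]
      refine hW.congr_deriv ?_
      have hp : 0 < ‖z s‖ ^ 2 := by positivity
      rw [hdv, Real.rpow_sub_one hp.ne', hpow _ hr.le]
      have e3 : ‖z s‖ ^ α * ‖z s‖ ^ (-α) = 1 := by
        rw [← Real.rpow_add hr, add_neg_cancel, Real.rpow_zero]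
      have : ∀ a w wi l m q : ℝ, 0 < a → w * wi = 1 →
          2 * (a * (l + m * (q * w))) * (-α / 2) * (wi / a) =
          -(α * wi * l) - α * m * q := by
        intro a w wi l m q ha hw
        field_simp
        linear_combination (-(α * m * q)) * hw
      exact this _ _ _ _ _ _ hp e3
    refine (hW'.mul hAd.exp).congr_deriv ?_
    ring
  have hint : IntervalIntegrable (fun s => -(α * lam.im) * (h s * Real.exp (A s))) volume 0 t := by
    refine ContinuousOn.intervalIntegrable ?_
    rw [Set.uIcc_of_le ht]
    exact continuousOn_const.mul (hh.mul hAc.rexp)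
  have hc : ContinuousOn (fun s => ‖z s‖ ^ (-α) * Real.exp (A s)) (Set.Icc 0 t) :=
    hWc.mul hAc.rexp
  have hF := intervalIntegral.integral_eq_sub_of_hasDerivAt_of_le ht hc hderiv hint
  rw [intervalIntegral.integral_const_mul] at hF
  have hA0 : A 0 = 0 := by simp [hA]
  rw [hA0, Real.exp_zero, mul_one] at hF
  linarith

end ODE

/-! ### Bounds on the time slices of a solution -/

section Unpack

variable {N : ℕ}

theorem laplacian_eq_lap {u : Sp N → ℂ} (hu : ContDiff ℝ 2 u) (x : Sp N) :
    Laplacian.laplacian u x = lap u x := by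
  rw [InnerProductSpace.laplacian_eq_iteratedFDeriv_orthonormalBasis u
    (EuclideanSpace.basisFun (Fin N) ℝ)]
  refine Finset.sum_congr rfl fun i _ => ?_
  rw [iteratedFDeriv_two_apply]
  simp only [Matrix.cons_val_zero, Matrix.cons_val_one, EuclideanSpace.basisFun_apply]
  have hd : DifferentiableAt ℝ (fderiv ℝ u) x :=
    ((hu.fderiv_right (m := 1) (by norm_num)).differentiable one_ne_zero) x
  have := (hd.hasFDerivAt.clm_apply
    (hasFDerivAt_const (EuclideanSpace.single i (1 : ℝ) : Sp N) x)).fderiv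
  change _ = fderiv ℝ (fun y => fderiv ℝ u y (EuclideanSpace.single i 1)) x _
  rw [this]
  simp

theorem lap_sub {u w : Sp N → ℂ} (hu : ContDiff ℝ 2 u) (hw : ContDiff ℝ 2 w) (x : Sp N) :
    lap (u - w) x = lap u x - lap w x := by
  have hpd : ∀ (i : Fin N) {f g : Sp N → ℂ}, ContDiff ℝ 1 f → ContDiff ℝ 1 g →
      pd i (f - g) = pd i f - pd i g := by
    intro i f g hf hg
    funext y
    simp only [pd, Pi.sub_apply]
    rw [fderiv_sub (hf.differentiable one_ne_zero y) (hg.differentiable one_ne_zero y)]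
    rfl
  unfold lap
  rw [← Finset.sum_sub_distrib]
  refine Finset.sum_congr rfl fun i _ => ?_
  rw [hpd i (hu.of_le (by norm_num)) (hw.of_le (by norm_num)),
    hpd i (contDiff_one_pd i hu) (contDiff_one_pd i hw)]
  rfl

theorem ae_norm_le_of_eLpNorm_top {f : Sp N → ℂ} {B : ℝ} (hB : 0 ≤ B)
    (h : eLpNorm f ∞ volume ≤ ENNReal.ofReal B) : ∀ᵐ x, ‖f x‖ ≤ B := by
  rw [eLpNorm_exponent_top] at h
  filter_upwards [enorm_ae_le_eLpNormEssSup f volume] with x hx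
  have := hx.trans h
  rwa [← ofReal_norm, ENNReal.ofReal_le_ofReal_iff hB] at this

theorem norm_weighted (a : ℕ) (β : Fin N → ℕ) (u : Sp N → ℂ) (x : Sp N) :
    ‖weighted a β u x‖ = bracket x ^ a * ‖weakDeriv β u x‖ := by
  rw [weighted, norm_mul, Complex.norm_real, Real.norm_of_nonneg (pow_nonneg (bracket_pos x).le a)]

theorem weighted_norm_le_of_normOne {n ℓ : ℕ} {u w : Sp N → ℂ} {β : Fin N → ℕ} (hβ : order β ≤ ℓ)
    (hw : IsWeakDeriv β u w) (hwc : Continuous w) {B : ℝ} (hB : 0 ≤ B)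
    (h : normOne n ℓ u ≤ ENNReal.ofReal B) (x : Sp N) : bracket x ^ n * ‖w x‖ ≤ B := by
  have h1 : eLpNorm (weighted n β u) ∞ volume ≤ ENNReal.ofReal B :=
    (le_iSup₂ (f := fun (β : Fin N → ℕ) (_ : order β ≤ ℓ) =>
      eLpNorm (weighted n β u) ∞ volume) β hβ).trans h
  refine le_of_ae_le_of_continuous (f := fun x => bracket x ^ n * ‖w x‖) (g := fun _ => B)
    ((continuous_bracket.pow n).mul hwc.norm) continuous_const ?_ x
  filter_upwards [ae_norm_le_of_eLpNorm_top hB h1, hw.ae_eq_weakDeriv] with y hy hy2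
  rwa [norm_weighted, hy2] at hy

theorem norm_lap_le_of_normOne {n ℓ : ℕ} (hℓ : 2 ≤ ℓ) {u : Sp N → ℂ} (hu : ContDiff ℝ 2 u) {B : ℝ}
    (hB : 0 ≤ B) (h : normOne n ℓ u ≤ ENNReal.ofReal B) (x : Sp N) : ‖lap u x‖ ≤ N * B := by
  refine (norm_sum_le _ _).trans ((Finset.sum_le_card_nsmul _ _ B fun i _ => ?_).trans (by simp))
  have hc : Continuous (pd i (pd i u)) :=
    ((contDiff_one_pd i hu).continuous_fderiv one_ne_zero).clm_apply continuous_const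
  have h1 := weighted_norm_le_of_normOne (by rw [order_add_single, order_single]; exact hℓ)
    (isWeakDeriv_pd_pd i hu) hc hB h x
  exact (le_mul_of_one_le_left (norm_nonneg _) (one_le_pow₀ (one_le_bracket x))).trans h1

/-! ### Continuity in time of a solution, and the bounds carried by `Ψ`. -/

variable {k m n : ℕ} {α b T σ : ℝ} {lam : ℂ} {v₀ : Sp N → ℂ} {v : ℝ → Sp N → ℂ}

/-- As `2 ≤ 2m`, the norm of `S` controls the second derivatives uniformly in `x`. -/
theorem IsSolution.continuousOn_lap (h : IsSolution N k m n α lam b T v₀ v) (hm : 1 ≤ m)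
    (x : Sp N) : ContinuousOn (fun s => lap (v s) x) (Set.Ico 0 T) := by
  intro t ht
  rw [ContinuousWithinAt, Metric.tendsto_nhds]
  intro ε hε
  have hε' : 0 < ε / (N + 1) := by positivity
  have h1 := (h.continuous t ht).eventually
    (ge_mem_nhds (show (0 : ℝ≥0∞) < ENNReal.ofReal (ε / (N + 1)) from ENNReal.ofReal_pos.mpr hε'))
  filter_upwards [h1, self_mem_nhdsWithin] with s hs hsT
  have hsub : ContDiff ℝ 2 (v s - v t) := (h.contDiff s hsT).sub (h.contDiff t ht)
  have h2 := norm_lap_le_of_normOne (show 2 ≤ 2 * m by omega) hsub hε'.le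
    ((le_self_add).trans hs) x
  rw [lap_sub (h.contDiff s hsT) (h.contDiff t ht)] at h2
  rw [dist_eq_norm]
  refine h2.trans_lt ?_
  rw [← mul_div_assoc, div_lt_iff₀ (by positivity)]
  nlinarith

theorem IsSolution.lowerBound_pos (h : IsSolution N k m n α lam b T v₀ v) {s : ℝ}
    (hs : s ∈ Set.Ico 0 T) : 0 < lowerBound n (v s) :=
  (h.bounded_below s hs).trans_le (iInf₂_le s ⟨hs.1, le_rfl⟩)

theorem lowerBound_le {u : Sp N → ℂ} (x : Sp N) :
    lowerBound n u ≤ ENNReal.ofReal (bracket x ^ n * ‖u x‖) := iInf_le _ x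

theorem IsSolution.ne_zero (h : IsSolution N k m n α lam b T v₀ v) {s : ℝ}
    (hs : s ∈ Set.Ico 0 T) (x : Sp N) : v s x ≠ 0 := by
  intro h0
  have := (h.lowerBound_pos hs).trans_le (lowerBound_le x)
  simp [h0] at this

theorem sigmaExp_le (hσ : 0 ≤ σ) (j : ℕ) : sigmaExp k m n σ j ≤ (j + 4) * σ := by
  unfold sigmaExp
  split_ifs <;> nlinarith

theorem rpow_neg_natCast_mul {y : ℝ} (hy : 0 < y) (σ : ℝ) (j : ℕ) :
    (y ^ (-σ)) ^ j = y ^ (-(j * σ)) := by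
  rw [← Real.rpow_natCast, ← Real.rpow_mul hy.le]
  congr 1
  ring

theorem ofReal_inv_mul_le {ρ K₁ : ℝ} (hρ : 0 < ρ) {X : ℝ≥0∞}
    (h : ENNReal.ofReal ρ * X ≤ ENNReal.ofReal K₁) : X ≤ ENNReal.ofReal (K₁ * ρ⁻¹) := by
  rw [ENNReal.ofReal_mul' (inv_nonneg.mpr hρ.le), ENNReal.ofReal_inv_of_pos hρ, ← div_eq_mul_inv,
    ENNReal.le_div_iff_mul_le (Or.inl (ENNReal.ofReal_pos.mpr hρ).ne')
    (Or.inl ENNReal.ofReal_ne_top), mul_comm]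
  exact h

/-- Up to order `2m` the exponent is exactly `σ_j = jσ`, and `Φ₄` gives the sharp power `R^j`.
Beyond, the various exponents are all replaced by the common bound `(j + 4)σ`; the excess is paid
later by the integrable factor `R^7`. -/
theorem IsSolution.sliceBound (h : IsSolution N k m n α lam b T v₀ v) {K₁ t s : ℝ}
    (hb : 0 < b) (hσ : 0 ≤ σ) (hK₁ : 0 ≤ K₁) (htT : t < T) (hbt : b * t < 1)
    (hΨ : Psi k m n α σ b v t ≤ ENNReal.ofReal K₁) (hs : s ∈ Set.Icc 0 t) :
    SliceBound k m n K₁ ((1 - b * s) ^ (-σ)) ((1 - b * s) ^ ((2 - N * α) / (2 * α))) (v s) := by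
  have hsT : s ∈ Set.Ico 0 T := ⟨hs.1, hs.2.trans_lt htT⟩
  have hy : 0 < 1 - b * s := one_sub_mul_pos hb hbt hs.2
  have hy1 : 1 - b * s ≤ 1 := by nlinarith [hs.1]
  have hΦ2 : Phi2 k m n σ b v t ≤ ENNReal.ofReal K₁ :=
    ((le_max_right _ _).trans (le_max_left _ _)).trans hΨ
  have hΦ3 : Phi3 n α b v t ≤ ENNReal.ofReal K₁ :=
    ((le_max_left _ _).trans (le_max_right _ _)).trans hΨ
  have hΦ4 : Phi4 k m n σ b v t ≤ ENNReal.ofReal K₁ :=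
    ((le_max_right _ _).trans (le_max_right _ _)).trans hΨ
  have hcdv := h.contDiff s hsT
  have hexp : ∀ j : ℕ, ((1 - b * s) ^ sigmaExp k m n σ j)⁻¹ ≤ ((1 - b * s) ^ (-σ)) ^ (j + 4) := by
    intro j
    rw [rpow_neg_natCast_mul hy, ← Real.rpow_neg hy.le]
    refine Real.rpow_le_rpow_of_exponent_ge hy hy1 ?_
    push_cast
    linarith [sigmaExp_le (k := k) (m := m) (n := n) hσ j]
  have h4 : ∀ β : Fin N → ℕ, order β ≤ 2 * m + 2 → ∀ᵐ x, ‖weakDeriv β (v s) x‖ ≤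
      K₁ * ((1 - b * s) ^ sigmaExp k m n σ (order β))⁻¹ * ‖v s x‖ := by
    intro β hβ
    have h1 : ENNReal.ofReal ((1 - b * s) ^ sigmaExp k m n σ (order β)) *
        ⨆ (γ : Fin N → ℕ) (_ : order γ = order β),
          eLpNorm (fun x => weakDeriv γ (v s) x / (‖v s x‖ : ℂ)) ∞ volume ≤ ENNReal.ofReal K₁ :=
      le_trans (le_trans (le_iSup₂ (f := fun (j : ℕ) (_ : j ∈ Set.Icc 0 (2 * m + 2)) =>
        ENNReal.ofReal ((1 - b * s) ^ sigmaExp k m n σ j) *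
        ⨆ (γ : Fin N → ℕ) (_ : order γ = j),
          eLpNorm (fun x => weakDeriv γ (v s) x / (‖v s x‖ : ℂ)) ∞ volume) (order β)
          ⟨Nat.zero_le _, hβ⟩) (le_iSup₂ (f := fun (s : ℝ) (_ : s ∈ Set.Icc 0 t) =>
        ⨆ j ∈ Set.Icc 0 (2 * m + 2), ENNReal.ofReal ((1 - b * s) ^ sigmaExp k m n σ j) *
        ⨆ (γ : Fin N → ℕ) (_ : order γ = j),
          eLpNorm (fun x => weakDeriv γ (v s) x / (‖v s x‖ : ℂ)) ∞ volume) s hs)) hΦ4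
    have hρ := Real.rpow_pos_of_pos hy (sigmaExp k m n σ (order β))
    have h2 := ofReal_inv_mul_le hρ h1
    have h3 := (le_iSup₂ (f := fun (γ : Fin N → ℕ) (_ : order γ = order β) =>
      eLpNorm (fun x => weakDeriv γ (v s) x / (‖v s x‖ : ℂ)) ∞ volume) β rfl).trans h2
    filter_upwards [ae_norm_le_of_eLpNorm_top (by positivity) h3] with x hx
    have hv := norm_pos_iff.mpr (h.ne_zero hsT x)
    rwa [norm_div, Complex.norm_real, norm_norm, div_le_iff₀ hv] at hx
  refine ⟨?_, hcdv, h.ne_zero hsT, fun β hβ => isWeakDeriv_weakDeriv ((h.memS s hsT).hasWeakDeriv β hβ),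
    fun β hβ => ?_, fun β hβ => ?_, fun β hβ1 hβ2 => ?_, fun x => ?_⟩
  · exact Real.one_le_rpow_of_pos_of_le_one_of_nonpos hy hy1 (by linarith)
  · have e : ((1 - b * s) ^ (-σ)) ^ order β = ((1 - b * s) ^ sigmaExp k m n σ (order β))⁻¹ := by
      rw [rpow_neg_natCast_mul hy, ← Real.rpow_neg hy.le, sigmaExp, if_pos hβ]
    rw [e]
    exact h4 β (by omega)
  · filter_upwards [h4 β hβ] with x hx
    refine hx.trans ?_
    gcongr
    exact hexp _
  · have h1 : ENNReal.ofReal ((1 - b * s) ^ sigmaExp k m n σ (order β)) *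
        normTwo k m n (order β) (v s) ≤ ENNReal.ofReal K₁ :=
      le_trans (le_trans (le_iSup₂ (f := fun (j : ℕ) (_ : j ∈ Set.Icc (2 * m + 1) (topOrder k m n)) =>
        ENNReal.ofReal ((1 - b * s) ^ sigmaExp k m n σ j) * normTwo k m n j (v s)) (order β)
          ⟨hβ1, hβ2⟩) (le_iSup₂ (f := fun (s : ℝ) (_ : s ∈ Set.Icc 0 t) =>
        ⨆ j ∈ Set.Icc (2 * m + 1) (topOrder k m n),
          ENNReal.ofReal ((1 - b * s) ^ sigmaExp k m n σ j) * normTwo k m n j (v s)) s hs)) hΦ2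
    have h2 := ofReal_inv_mul_le (Real.rpow_pos_of_pos hy _) h1
    have h3 := (le_iSup₂ (f := fun (γ : Fin N → ℕ) (_ : 2 * m + 1 ≤ order γ ∧ order γ ≤ order β) =>
      eLpNorm (weighted (weightExp k m n (order γ)) γ (v s)) 2 volume) β ⟨hβ1, le_rfl⟩).trans h2
    have e : eLpNorm (fun x => bracket x ^ weightExp k m n (order β) * ‖weakDeriv β (v s) x‖) 2 volume
        = eLpNorm (weighted (weightExp k m n (order β)) β (v s)) 2 volume := by
      refine eLpNorm_congr_norm_ae (Filter.Eventually.of_forall fun x => ?_)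
      rw [norm_weighted, Real.norm_of_nonneg
        (mul_nonneg (pow_nonneg (bracket_pos x).le _) (norm_nonneg _))]
    rw [e]
    refine h3.trans (ENNReal.ofReal_le_ofReal ?_)
    gcongr
    exact hexp _
  · have h1 : ENNReal.ofReal ((1 - b * s) ^ ((2 - N * α) / (2 * α))) / lowerBound n (v s)
        ≤ ENNReal.ofReal K₁ :=
      (le_iSup₂ (f := fun (s : ℝ) (_ : s ∈ Set.Icc 0 t) =>
        ENNReal.ofReal ((1 - b * s) ^ ((2 - N * α) / (2 * α))) / lowerBound n (v s)) s hs).trans hΦ3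
    rw [ENNReal.div_le_iff (h.lowerBound_pos hsT).ne'
      ((lowerBound_le x).trans_lt ENNReal.ofReal_lt_top).ne] at h1
    have h2 := h1.trans (mul_le_mul_right (lowerBound_le x) _)
    have hnn : 0 ≤ K₁ * (bracket x ^ n * ‖v s x‖) :=
      mul_nonneg hK₁ (mul_nonneg (pow_nonneg (bracket_pos x).le _) (norm_nonneg _))
    rwa [← ENNReal.ofReal_mul hK₁, ENNReal.ofReal_le_ofReal_iff hnn] at h2

theorem bracket_pow_mul_norm_le {u : Sp N → ℂ} (hu : Continuous u) {K : ℝ} (hK : 0 ≤ K)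
    (h : normS k m n u ≤ ENNReal.ofReal K) (x : Sp N) : bracket x ^ n * ‖u x‖ ≤ K :=
  weighted_norm_le_of_normOne (ℓ := 2 * m) (by rw [order_zero]; exact Nat.zero_le _)
    (isWeakDeriv_zero hu.locallyIntegrable) hu hK (le_self_add.trans h) x

end Unpack

/-! ### Uniform bounds for the regularized amplitude and passage to the limit -/

section Limit

variable {N : ℕ}

theorem continuous_bracket_rpow (τ : ℝ) : Continuous fun x : Sp N => bracket x ^ τ :=
  continuous_bracket.rpow_const fun x => Or.inl (bracket_pos x).ne'

theorem memLp_bracket_rpow_neg {τ : ℝ} (hτ : (N : ℝ) < 2 * τ) :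
    MemLp (fun x : Sp N => bracket x ^ (-τ)) 2 volume := by
  rw [memLp_two_iff_integrable_sq (continuous_bracket_rpow (-τ)).aestronglyMeasurable]
  have h := integrable_rpow_neg_one_add_norm_sq (E := Sp N) (μ := volume) (r := 2 * τ)
    (by simpa using hτ)
  refine h.congr (Filter.Eventually.of_forall fun x => ?_)
  have h0 : (0 : ℝ) ≤ 1 + ‖x‖ ^ 2 := by positivity
  change (1 + ‖x‖ ^ 2) ^ (-(2 * τ) / 2) = (bracket x ^ (-τ)) ^ 2
  rw [bracket, Real.sqrt_eq_rpow]
  generalize 1 + ‖x‖ ^ 2 = a at h0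
  rw [← Real.rpow_mul h0, ← Real.rpow_natCast, ← Real.rpow_mul h0]
  congr 1
  push_cast
  ring

theorem eLpNorm_linear_comb_le {f g : Sp N → ℝ} {a b A B : ℝ} (ha : 0 ≤ a) (hb : 0 ≤ b)
    (hA : 0 ≤ A) (hB : 0 ≤ B) (hf : Continuous f) (hg : Continuous g)
    (hfA : eLpNorm f 2 volume ≤ ENNReal.ofReal A) (hgB : eLpNorm g 2 volume ≤ ENNReal.ofReal B) :
    eLpNorm (fun x => a * f x + b * g x) 2 volume ≤ ENNReal.ofReal (a * A + b * B) := by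
  have h := eLpNorm_finset_sum_le (N := N) (Finset.univ : Finset (Fin 2)) ![a, b] ![A, B] ![f, g]
    (by simp [Fin.forall_fin_two, ha, hb]) (by simp [Fin.forall_fin_two, hA, hB])
    (by simp [Fin.forall_fin_two, hf.aestronglyMeasurable, hg.aestronglyMeasurable])
    (by simp [Fin.forall_fin_two, hfA, hgB])
  simpa [Fin.sum_univ_two] using h

/-- At high order the majorant is `1 + Q`. For the part `1`, the factor `⟨x⟩^{μ(j)} |w|` is bounded
and `⟨x⟩^{-τ}` is square integrable. For `Q`, the `L²` bound holds with the weight `μ(j+2)`, and the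
decay `⟨x⟩^{-τ}` makes up the difference. -/
theorem regAmp_mollify_bounds (N k m n : ℕ) (hm : 1 ≤ m) (hJ : topOrder k m n ≤ 4 * m + 1)
    (α K₁ B C₅ τ : ℝ) (hα : 0 ≤ α) (hK₁ : 0 ≤ K₁) (hB : 0 ≤ B) (hC₅ : 0 ≤ C₅)
    (hτ : (N : ℝ) < 2 * τ) (hτ2 : 2 ≤ τ) : ∃ C, 0 ≤ C ∧
    ∀ r : ℝ, 1 ≤ r → ∀ᶠ q : ℕ in Filter.atTop,
    ∀ (c δ S₀ D : ℝ) (h R S : ℕ → ℝ) (u₀ w : Sp N → ℂ) (u : ℕ → Sp N → ℂ) (M : ℕ),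
      0 ≤ c → 0 ≤ δ → 0 ≤ D → (∀ l, 0 ≤ h l) → (∀ l, R l ≤ r) → (∀ l, 0 < S l) →
      SliceBound k m n K₁ 1 S₀ u₀ → (∀ l, SliceBound k m n K₁ (R l) (S l) (u l)) →
      ∑ l ∈ Finset.range M, δ * R l ^ 7 ≤ C₅ → ∑ l ∈ Finset.range M, δ * R l ^ 7 / S l ≤ C₅ →
      (∀ x, bracket x ^ n * ‖u₀ x‖ ≤ B) → Continuous w → (∀ x, ‖w x‖ ≤ 2 * ‖u₀ x‖) →
      (∀ x, ∀ y > 0, y ≤ 2 * ‖u₀ x‖ →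
        (y ^ (-α) + ∑ l ∈ Finset.range M, c * δ * h l)⁻¹ ≤ D * bracket x ^ (-τ)) →
      ContDiff ℝ ∞ (regAmp α c δ h (mollify q u₀) (fun l => mollify q (u l)) M) ∧
      (∀ j ≤ 2 * m, ∀ x, ‖iteratedFDeriv ℝ j
        (regAmp α c δ h (mollify q u₀) (fun l => mollify q (u l)) M) x‖ ≤
          C * D * r ^ (j - 1) * bracket x ^ (-τ)) ∧
      (∀ j, 2 * m + 1 ≤ j → j + 2 ≤ topOrder k m n →
        eLpNorm (fun x => bracket x ^ weightExp k m n j * ‖w x‖ * ‖iteratedFDeriv ℝ j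
          (regAmp α c δ h (mollify q u₀) (fun l => mollify q (u l)) M) x‖) 2 volume
          ≤ ENNReal.ofReal (C * D * r ^ (j - 1))) := by
  obtain ⟨C₀, C₁, hC₀, hC₁, HM⟩ := exists_mollifiedBound N k m n hm K₁ hK₁
  obtain ⟨C, hC, HA⟩ := regAmp_hasMaj N k m n α C₀ C₅ hα hC₀ hC₅ hJ
  set Lτ := (eLpNorm (fun x : Sp N => bracket x ^ (-τ)) 2 volume).toReal with hLτ
  have hLτ' : eLpNorm (fun x : Sp N => bracket x ^ (-τ)) 2 volume ≤ ENNReal.ofReal Lτ :=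
    (ENNReal.ofReal_toReal (memLp_bracket_rpow_neg hτ).eLpNorm_ne_top).ge
  have hLτ0 : 0 ≤ Lτ := ENNReal.toReal_nonneg
  have hC2 : 0 ≤ 2 * C₁ + 2 * B * K₁ * C₁ * C₅ := by positivity
  refine ⟨C + C * (2 * B * Lτ + 2 * (2 * C₁ + 2 * B * K₁ * C₁ * C₅)), by positivity,
    fun r hr => ?_⟩
  have hr0 : 0 ≤ r := zero_le_one.trans hr
  filter_upwards [HM r hr0] with q hq
  intro c δ S₀ D h R S u₀ w u M hc hδ hD hh hRr hS hu₀ hu hs1 hs2 hBu hw hwu hden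
  have hm₀ := hq 1 S₀ u₀ hr hu₀
  have hml := fun l => hq (R l) (S l) (u l) (hRr l) (hu l)
  set f := regAmp α c δ h (mollify q u₀) (fun l => mollify q (u l)) M with hf
  set Q := lossPart m δ R (mollify q u₀) (fun l => mollify q (u l)) M with hQ
  have hR1 := fun l => (hu l).one_le
  have hR0 := fun l => zero_le_one.trans (hR1 l)
  have hfs : ContDiff ℝ ∞ f := contDiff_regAmp hc hδ hh hm₀.smooth hm₀.ne_zero
    (fun l => (hml l).smooth) (fun l => (hml l).ne_zero) M
  have hQ0 : ∀ j x, 0 ≤ Q j x := fun j x => add_nonneg (highRatio_nonneg zero_le_one _ _ _)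
    (Finset.sum_nonneg fun l _ => mul_nonneg (mul_nonneg hδ (pow_nonneg (hR0 l) 7))
      (highRatio_nonneg (hR0 l) _ _ _))
  have hmaj : ∀ x, ∀ j, j + 2 ≤ topOrder k m n → ‖iteratedFDeriv ℝ j f x‖ ≤
      C * (D * bracket x ^ (-τ)) * (r ^ (j - 1) * if j ≤ 2 * m then 1 else 1 + Q j x) := by
    intro x j hj
    refine (HA C₁ r c δ h R u₀ _ u _ M x hr hc hδ hh hR1 hRr hm₀ hml hs1 j (by omega)).trans ?_
    unfold lossSeq
    have h1 := hden x _ (norm_pos_iff.mpr (hm₀.ne_zero x)) (hm₀.le_two_mul x)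
    have h2 := hQ0 j x
    have h3 : 0 ≤ r ^ (j - 1) * if j ≤ 2 * m then (1 : ℝ) else 1 + Q j x := by
      split_ifs <;> positivity
    exact mul_le_mul_of_nonneg_right (mul_le_mul_of_nonneg_left h1 hC) h3
  have hbτ : ∀ x : Sp N, 0 ≤ bracket x ^ (-τ) := fun x => Real.rpow_nonneg (bracket_pos x).le _
  refine ⟨hfs, fun j hj x => ?_, fun j hj1 hj2 => ?_⟩
  · refine (hmaj x j (by unfold topOrder; omega)).trans ?_
    rw [if_pos hj, mul_one]
    calc _ = C * (D * r ^ (j - 1) * bracket x ^ (-τ)) := by ring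
      _ ≤ (C + C * (2 * B * Lτ + 2 * (2 * C₁ + 2 * B * K₁ * C₁ * C₅))) *
          (D * r ^ (j - 1) * bracket x ^ (-τ)) := by
          refine mul_le_mul_of_nonneg_right (le_add_of_nonneg_right (by positivity)) ?_
          have := hbτ x
          positivity
      _ = _ := by ring
  · have hloss := eLpNorm_lossPart_le hδ hR0 hS hK₁ hB hC₁ hm₀ hml (fun l => (hu l).lower) hBu hs2 hj2
    have hQc : Continuous (Q j) := (continuous_highRatio hm₀.smooth hm₀.ne_zero j).add
      (continuous_finsetSum _ fun l _ => continuous_const.mul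
        (continuous_highRatio (hml l).smooth (hml l).ne_zero _))
    have hu₀c : Continuous u₀ := hu₀.contDiff.continuous
    have hlin := eLpNorm_linear_comb_le (N := N)
      (f := fun x => bracket x ^ (-τ))
      (g := fun x => bracket x ^ weightExp k m n (j + 2) * (‖u₀ x‖ * Q j x))
      (a := C * D * r ^ (j - 1) * (2 * B)) (b := C * D * r ^ (j - 1) * 2)
      (by positivity) (by positivity) hLτ0 hC2 (continuous_bracket_rpow _)
      ((continuous_bracket.pow _).mul (hu₀c.norm.mul hQc)) hLτ' hloss
    refine (eLpNorm_le_of_abs_le fun x => ?_).trans (hlin.trans (ENNReal.ofReal_le_ofReal ?_))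
    · have hb := bracket_pos x
      have hb1 := one_le_bracket x
      have h2 := hQ0 j x
      rw [abs_of_nonneg (by positivity)]
      have h1 := hmaj x j hj2
      rw [if_neg (by omega)] at h1
      have hwt : bracket x ^ weightExp k m n j * ‖u₀ x‖ ≤ B :=
        (mul_le_mul_of_nonneg_right (pow_le_pow_right₀ hb1 (weightExp_le k m n j))
          (norm_nonneg _)).trans (hBu x)
      -- The weights at orders `j` and `j + 2` differ by at most two powers, which `τ ≥ 2` absorbs.
      have hwt2 : bracket x ^ weightExp k m n j * bracket x ^ (-τ) ≤
          bracket x ^ weightExp k m n (j + 2) := by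
        have e1 : bracket x ^ weightExp k m n j ≤ bracket x ^ weightExp k m n (j + 2) * bracket x ^ 2 := by
          rw [← pow_add]; exact pow_le_pow_right₀ hb1 (weightExp_le_add_two k m n j)
        have e2 : bracket x ^ 2 * bracket x ^ (-τ) ≤ 1 := by
          rw [← Real.rpow_natCast, ← Real.rpow_add hb]
          exact Real.rpow_le_one_of_one_le_of_nonpos hb1 (by push_cast; linarith)
        calc _ ≤ bracket x ^ weightExp k m n (j + 2) * bracket x ^ 2 * bracket x ^ (-τ) :=
              mul_le_mul_of_nonneg_right e1 (hbτ x)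
          _ = bracket x ^ weightExp k m n (j + 2) * (bracket x ^ 2 * bracket x ^ (-τ)) := by ring
          _ ≤ _ := mul_le_of_le_one_right (by positivity) e2
      have hb0 := hbτ x
      calc _ ≤ bracket x ^ weightExp k m n j * (2 * ‖u₀ x‖) *
            (C * (D * bracket x ^ (-τ)) * (r ^ (j - 1) * (1 + Q j x))) := by
            refine mul_le_mul (mul_le_mul_of_nonneg_left (hwu x) (by positivity)) h1
              (norm_nonneg _) (by positivity)
        _ = C * D * r ^ (j - 1) * (2 * ((bracket x ^ weightExp k m n j * ‖u₀ x‖) * bracket x ^ (-τ)))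
            + C * D * r ^ (j - 1) * 2 * ((bracket x ^ weightExp k m n j * bracket x ^ (-τ)) *
              (‖u₀ x‖ * Q j x)) := by ring
        _ ≤ C * D * r ^ (j - 1) * (2 * (B * bracket x ^ (-τ)))
            + C * D * r ^ (j - 1) * 2 * (bracket x ^ weightExp k m n (j + 2) * (‖u₀ x‖ * Q j x)) := by
            gcongr
        _ = _ := by ring
    · have : 0 ≤ C * (D * r ^ (j - 1)) := by positivity
      calc _ = C * (2 * B * Lτ + 2 * (2 * C₁ + 2 * B * K₁ * C₁ * C₅)) * (D * r ^ (j - 1)) := by ring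
        _ ≤ (C + C * (2 * B * Lτ + 2 * (2 * C₁ + 2 * B * K₁ * C₁ * C₅))) * (D * r ^ (j - 1)) := by
            rw [add_mul]; linarith
        _ = _ := by ring

/-! ### Removal of the mollification. -/

open Filter Topology

theorem tendsto_phaseRate_mollify {u : Sp N → ℂ} (hu : ContDiff ℝ 2 u) (hne : ∀ x, u x ≠ 0)
    (x : Sp N) : Tendsto (fun q => phaseRate (mollify q u) x) atTop (𝓝 (phaseRate u x)) := by
  have h1 := tendsto_mollify hu.continuous x
  have h2 := tendsto_lap_mollify hu x
  exact ((h1.norm.pow 2).inv₀ (pow_ne_zero 2 (norm_ne_zero_iff.mpr (hne x)))).smul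
    ((h1.const_smul (-Complex.I)).inner h2)

theorem tendsto_regAmp_mollify {α c δ : ℝ} {h : ℕ → ℝ} (hc : 0 ≤ c) (hδ : 0 ≤ δ)
    (hh : ∀ l, 0 ≤ h l) {u₀ : Sp N → ℂ} {u : ℕ → Sp N → ℂ}
    (hu₀ : ContDiff ℝ 2 u₀) (hne₀ : ∀ x, u₀ x ≠ 0) (hu : ∀ l, ContDiff ℝ 2 (u l))
    (hne : ∀ l x, u l x ≠ 0) (M : ℕ) (x : Sp N) :
    Tendsto (fun q => regAmp α c δ h (mollify q u₀) (fun l => mollify q (u l)) M x) atTop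
      (𝓝 (regAmp α c δ h u₀ u M x)) := by
  have hph : ∀ i, Tendsto (fun q => discPhase α δ (fun l => phaseRate (mollify q (u l))) i x) atTop
      (𝓝 (discPhase α δ (fun l => phaseRate (u l)) i x)) := fun i =>
    tendsto_finsetSum _ fun l _ => (tendsto_phaseRate_mollify (hu l) (hne l) x).const_smul _
  have hex : ∀ i, Tendsto (fun q => Real.exp
      (discPhase α δ (fun l => phaseRate (mollify q (u l))) i x)) atTop
      (𝓝 (Real.exp (discPhase α δ (fun l => phaseRate (u l)) i x))) := fun i =>
    (Real.continuous_exp.tendsto _).comp (hph i)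
  have hw : Tendsto (fun q => ‖mollify q u₀ x‖ ^ (-α)) atTop (𝓝 (‖u₀ x‖ ^ (-α))) :=
    (tendsto_mollify hu₀.continuous x).norm.rpow_const (Or.inl (norm_ne_zero_iff.mpr (hne₀ x)))
  have hden : Tendsto (fun q => discDen c δ h (fun y => ‖mollify q u₀ y‖ ^ (-α))
      (discPhase α δ fun l => phaseRate (mollify q (u l))) M x) atTop
      (𝓝 (discDen c δ h (fun y => ‖u₀ y‖ ^ (-α)) (discPhase α δ fun l => phaseRate (u l)) M x)) :=
    hw.add (tendsto_finsetSum _ fun l _ => (hex l).const_smul _)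
  have hpos : 0 < discDen c δ h (fun y => ‖u₀ y‖ ^ (-α))
      (discPhase α δ fun l => phaseRate (u l)) M x :=
    (Real.rpow_pos_of_pos (norm_pos_iff.mpr (hne₀ x)) _).trans_le
      (discDen_ge (w₀ := fun y => ‖u₀ y‖ ^ (-α)) hc hδ hh)
  exact (hden.inv₀ hpos.ne').smul (hex M)

/-- Square integrable pointwise bounds on weak derivatives pass to bounded pointwise limits. -/
theorem exists_isWeakDeriv_abs_le_of_tendsto {β : Fin N → ℕ} {f : ℕ → Sp N → ℝ}
    {f' H : Sp N → ℝ} {B' : ℝ} (hH : Continuous H) (hH2 : MemLp H 2 volume)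
    (h : ∀ᶠ k in atTop, (∃ g, IsWeakDeriv β (f k) g ∧ ∀ᵐ x, |g x| ≤ H x) ∧ ∀ x, |f k x| ≤ B')
    (hlim : ∀ x, Tendsto (fun k => f k x) atTop (𝓝 (f' x))) :
    ∃ g, IsWeakDeriv β f' g ∧ ∀ᵐ x, |g x| ≤ H x := by
  obtain ⟨k₀, hk₀⟩ := eventually_atTop.mp h
  have hlim' : ∀ x, Tendsto (fun k => f (k + k₀) x) atTop (𝓝 (f' x)) := fun x =>
    (hlim x).comp (tendsto_add_atTop_nat k₀)
  have hb : ∀ k x, |f (k + k₀) x| ≤ B' := fun k x => (hk₀ _ (by omega)).2 x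
  have hg : ∀ k, ∃ g, IsWeakDeriv β (f (k + k₀)) g ∧ ∀ᵐ x, |g x| ≤ H x := fun k =>
    (hk₀ _ (by omega)).1
  -- A square integrable envelope gives existence of the limit derivative through the `L²` criterion
  -- with weight `1`; the pointwise bound is then a separate passage to the limit.
  obtain ⟨g, hg1, _⟩ := exists_isWeakDeriv_of_tendsto (β := β) (f := fun k => f (k + k₀)) (f' := f')
    (W := fun _ => 1) (B := (eLpNorm H 2 volume).toReal) continuous_const
    (fun _ => one_pos) (fun k => by
      obtain ⟨g, hg1, hg2⟩ := hg k
      refine ⟨g, hg1, ?_⟩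
      rw [ENNReal.ofReal_toReal hH2.eLpNorm_ne_top]
      refine eLpNorm_mono_ae_real ?_
      filter_upwards [hg2] with x hx
      simpa using hx) hlim' hb
  exact ⟨g, hg1, IsWeakDeriv.ae_abs_le_of_tendsto hH hg hlim' hb hg1⟩

theorem exists_isWeakDeriv_of_tendsto_eventually {β : Fin N → ℕ} {f : ℕ → Sp N → ℝ}
    {f' W : Sp N → ℝ} {B B' : ℝ} (hW : Continuous W) (hWpos : ∀ x, 0 < W x)
    (h : ∀ᶠ k in atTop, (∃ g, IsWeakDeriv β (f k) g ∧
      eLpNorm (fun x => W x * g x) 2 volume ≤ ENNReal.ofReal B) ∧ ∀ x, |f k x| ≤ B')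
    (hlim : ∀ x, Tendsto (fun k => f k x) atTop (𝓝 (f' x))) :
    ∃ g, IsWeakDeriv β f' g ∧ eLpNorm (fun x => W x * g x) 2 volume ≤ ENNReal.ofReal B := by
  obtain ⟨k₀, hk₀⟩ := eventually_atTop.mp h
  exact exists_isWeakDeriv_of_tendsto (f := fun k => f (k + k₀)) hW hWpos
    (fun k => (hk₀ _ (by omega)).1) (fun x => (hlim x).comp (tendsto_add_atTop_nat k₀))
    fun k x => (hk₀ _ (by omega)).2 x

/-- The bounds of `regAmp_mollify_bounds` without mollification, on weak derivatives. -/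
theorem regAmp_bounds (N k m n : ℕ) (hm : 1 ≤ m) (hJ : topOrder k m n ≤ 4 * m + 1)
    (α K₁ B C₅ τ : ℝ) (hα : 0 ≤ α) (hK₁ : 0 ≤ K₁) (hB : 0 ≤ B) (hC₅ : 0 ≤ C₅)
    (hτ : (N : ℝ) < 2 * τ) (hτ2 : 2 ≤ τ) : ∃ C, 0 ≤ C ∧
    ∀ (r c δ S₀ D : ℝ) (h R S : ℕ → ℝ) (u₀ w : Sp N → ℂ) (u : ℕ → Sp N → ℂ) (M : ℕ),
      1 ≤ r → 0 ≤ c → 0 ≤ δ → 0 ≤ D → (∀ l, 0 ≤ h l) → (∀ l, R l ≤ r) → (∀ l, 0 < S l) →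
      SliceBound k m n K₁ 1 S₀ u₀ → (∀ l, SliceBound k m n K₁ (R l) (S l) (u l)) →
      ∑ l ∈ Finset.range M, δ * R l ^ 7 ≤ C₅ → ∑ l ∈ Finset.range M, δ * R l ^ 7 / S l ≤ C₅ →
      (∀ x, bracket x ^ n * ‖u₀ x‖ ≤ B) → Continuous w → (∀ x, w x ≠ 0) →
      (∀ x, ‖w x‖ ≤ 2 * ‖u₀ x‖) →
      (∀ x, ∀ y > 0, y ≤ 2 * ‖u₀ x‖ →
        (y ^ (-α) + ∑ l ∈ Finset.range M, c * δ * h l)⁻¹ ≤ D * bracket x ^ (-τ)) →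
      (∀ x, |regAmp α c δ h u₀ u M x| ≤ C * D) ∧
      (∀ β : Fin N → ℕ, order β ≤ 2 * m → ∃ g, IsWeakDeriv β (regAmp α c δ h u₀ u M) g ∧
        ∀ᵐ x, |g x| ≤ C * D * r ^ (order β - 1) * bracket x ^ (-τ)) ∧
      (∀ β : Fin N → ℕ, 2 * m + 1 ≤ order β → order β + 2 ≤ topOrder k m n →
        ∃ g, IsWeakDeriv β (regAmp α c δ h u₀ u M) g ∧
        eLpNorm (fun x => bracket x ^ weightExp k m n (order β) * ‖w x‖ * g x) 2 volume
          ≤ ENNReal.ofReal (C * D * r ^ (order β - 1))) := by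
  obtain ⟨C, hC, H⟩ := regAmp_mollify_bounds N k m n hm hJ α K₁ B C₅ τ hα hK₁ hB hC₅ hτ hτ2
  refine ⟨C, hC, fun r c δ S₀ D h R S u₀ w u M hr hc hδ hD hh hRr hS hu₀ hu hs1 hs2 hBu hw hwne hwu
    hden => ?_⟩
  have hr0 : 0 ≤ r := zero_le_one.trans hr
  have hev := (H r hr).mono fun q hq =>
    hq c δ S₀ D h R S u₀ w u M hc hδ hD hh hRr hS hu₀ hu hs1 hs2 hBu hw hwu hden
  have hlim := tendsto_regAmp_mollify (α := α) hc hδ hh hu₀.contDiff hu₀.ne_zero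
    (fun l => (hu l).contDiff) (fun l => (hu l).ne_zero) M
  have hbd : ∀ᶠ q : ℕ in atTop, ∀ x,
      |regAmp α c δ h (mollify q u₀) (fun l => mollify q (u l)) M x| ≤ C * D := by
    filter_upwards [hev] with q hq x
    have h1 := hq.2.1 0 (Nat.zero_le _) x
    rw [norm_iteratedFDeriv_zero, Real.norm_eq_abs, Nat.zero_sub, pow_zero, mul_one] at h1
    refine h1.trans (mul_le_of_le_one_right (by positivity) ?_)
    exact Real.rpow_le_one_of_one_le_of_nonpos (one_le_bracket x) (by linarith)
  refine ⟨fun x => le_of_tendsto (hlim x).abs (hbd.mono fun q hq => hq x), fun β hβ => ?_,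
    fun β hβ1 hβ2 => ?_⟩
  · refine exists_isWeakDeriv_abs_le_of_tendsto (B' := C * D)
      (continuous_const.mul (continuous_bracket_rpow (-τ)))
      ((memLp_bracket_rpow_neg hτ).const_mul _) ?_ hlim
    filter_upwards [hev, hbd] with q hq hqb
    refine ⟨⟨_, isWeakDeriv_iterPartial β hq.1, Eventually.of_forall fun x => ?_⟩, hqb⟩
    exact (norm_iterPartial_le β hq.1 x).trans (hq.2.1 _ hβ x)
  · refine exists_isWeakDeriv_of_tendsto_eventually (B' := C * D)
      ((continuous_bracket.pow _).mul hw.norm)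
      (fun x => mul_pos (pow_pos (bracket_pos x) _) (norm_pos_iff.mpr (hwne x))) ?_ hlim
    filter_upwards [hev, hbd] with q hq hqb
    refine ⟨⟨_, isWeakDeriv_iterPartial β hq.1, ?_⟩, hqb⟩
    refine (eLpNorm_le_of_abs_le fun x => ?_).trans (hq.2.2 _ hβ1 hβ2)
    have : 0 ≤ bracket x ^ weightExp k m n (order β) * ‖w x‖ :=
      mul_nonneg (pow_nonneg (bracket_pos x).le _) (norm_nonneg _)
    rw [abs_mul, abs_of_nonneg this]
    exact mul_le_mul_of_nonneg_left (norm_iterPartial_le β hq.1 x) this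

end Limit

/-! ### The amplitude of a solution -/

section Amplitude

variable {N : ℕ}

/-- `((1 - b t)^{-p} - 1) / b`, with `p = (2 - N α) / 2`: the inverse of `b G(t)`. -/
noncomputable def invRate (b p t : ℝ) : ℝ := ((1 - b * t) ^ (-p) - 1) / b

theorem invRate_nonneg {b p t : ℝ} (hb : 0 < b) (hp : 0 ≤ p) (ht : 0 ≤ t) (hbt : b * t < 1) :
    0 ≤ invRate b p t := by
  have h1 : (1 : ℝ) ≤ (1 - b * t) ^ (-p) := Real.one_le_rpow_of_pos_of_le_one_of_nonpos
    (one_sub_mul_pos hb hbt le_rfl) (by nlinarith) (by linarith)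
  exact div_nonneg (by linarith) hb.le

theorem ofReal_mul_G {N : ℕ} {α b t : ℝ} (hb : 0 < b) (hbt : b * t < 1) :
    ENNReal.ofReal b * G N α b t = (ENNReal.ofReal (invRate b ((2 - N * α) / 2) t))⁻¹ := by
  have hy : 0 < 1 - b * t := one_sub_mul_pos hb hbt le_rfl
  have hX := Real.rpow_pos_of_pos hy ((2 - N * α) / 2)
  have e : invRate b ((2 - N * α) / 2) t = (1 - (1 - b * t) ^ ((2 - N * α) / 2)) /
      (b * (1 - b * t) ^ ((2 - N * α) / 2)) := by
    rw [invRate, Real.rpow_neg hy.le]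
    field_simp
  rw [e, ENNReal.ofReal_div_of_pos (mul_pos hb hX), ENNReal.inv_div (Or.inl ENNReal.ofReal_ne_top)
    (Or.inl (ENNReal.ofReal_pos.mpr (mul_pos hb hX)).ne'), ENNReal.ofReal_mul hb.le, G, mul_div_assoc]

theorem decay_eq {N : ℕ} {α σ b t : ℝ} (hb : 0 < b) (hbt : b * t < 1)
    (hθ : 0 < 1 - 2 * σ / (2 - N * α)) :
    decay N α σ b t = ENNReal.ofReal
      ((max 1 (invRate b ((2 - N * α) / 2) t)) ^ (-(1 - 2 * σ / (2 - N * α)))) := by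
  rw [decay, ofReal_mul_G hb hbt]
  set Y := invRate b ((2 - N * α) / 2) t
  rcases le_total Y 1 with hY | hY
  · rw [max_eq_left hY, Real.one_rpow, ENNReal.ofReal_one]
    refine min_eq_left (ENNReal.one_le_rpow (ENNReal.one_le_inv.mpr ?_) hθ)
    exact ENNReal.ofReal_le_one.mpr hY
  · have hY0 : 0 < Y := one_pos.trans_le hY
    rw [max_eq_right hY, ENNReal.inv_rpow, ← ENNReal.rpow_neg, ENNReal.ofReal_rpow_of_pos hY0]
    refine min_eq_right (ENNReal.ofReal_le_one.mpr ?_)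
    exact Real.rpow_le_one_of_one_le_of_nonpos hY (by linarith)

/-- Since `X ≥ 1`, both `X` and `max 1 Y` are at most `max X Y ≤ X + Y`, and so is their weighted
geometric mean. With `X` a power of the bracket, this splits the amplitude into decay in space and
decay in time. -/
theorem inv_add_le_interpolate {a d X Y θ : ℝ} (ha : 0 < a) (hd : 0 < d) (hX : 1 ≤ X) (hY : 0 ≤ Y)
    (hθ0 : 0 ≤ θ) (hθ1 : θ ≤ 1) :
    (a * X + d * Y)⁻¹ ≤ (min a d)⁻¹ * (X ^ (-θ) * (max 1 Y) ^ (-(1 - θ))) := by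
  have hX0 : 0 < X := one_pos.trans_le hX
  have hM0 : 0 < max 1 Y := one_pos.trans_le (le_max_left _ _)
  have hμ : 0 < min a d := lt_min ha hd
  rw [Real.rpow_neg hX0.le, Real.rpow_neg hM0.le, ← mul_inv, ← mul_inv]
  have h1 : X ^ θ * max 1 Y ^ (1 - θ) ≤ max X Y := by
    have hZ : 0 < max X Y := hX0.trans_le (le_max_left _ _)
    calc _ ≤ max X Y ^ θ * max X Y ^ (1 - θ) :=
          mul_le_mul (Real.rpow_le_rpow hX0.le (le_max_left _ _) hθ0)
            (Real.rpow_le_rpow hM0.le (max_le_max_right _ hX) (by linarith))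
            (Real.rpow_nonneg hM0.le _) (Real.rpow_nonneg hZ.le _)
      _ = max X Y := by rw [← Real.rpow_add hZ]; simp
  refine inv_anti₀ (by positivity) ?_
  calc _ ≤ min a d * (X + Y) := mul_le_mul_of_nonneg_left
        (h1.trans (max_le (by linarith) (by linarith))) hμ.le
    _ = min a d * X + min a d * Y := by ring
    _ ≤ _ := add_le_add (mul_le_mul_of_nonneg_right (min_le_left _ _) hX0.le)
        (mul_le_mul_of_nonneg_right (min_le_right _ _) hY)

variable {k m n : ℕ} {K₁ R S : ℝ} {u : Sp N → ℂ}

theorem SliceBound.abs_phaseRate_le (h : SliceBound k m n K₁ R S u) (hm : 1 ≤ m) (x : Sp N) :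
    |phaseRate u x| ≤ N * (K₁ * R ^ 2) := by
  have hu := norm_pos_iff.mpr (h.ne_zero x)
  have h1 : ‖lap u x‖ ≤ N * (K₁ * R ^ 2 * ‖u x‖) := by
    refine (norm_sum_le _ _).trans ((Finset.sum_le_card_nsmul _ _ (K₁ * R ^ 2 * ‖u x‖)
      fun i _ => ?_).trans (by simp))
    refine le_of_ae_le_of_continuous (f := fun x => ‖pd i (pd i u) x‖)
      (g := fun x => K₁ * R ^ 2 * ‖u x‖)
      (((contDiff_one_pd i h.contDiff).continuous_fderiv one_ne_zero).clm_apply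
        continuous_const).norm (continuous_const.mul h.contDiff.continuous.norm) ?_ x
    have hord : order (Pi.single i 1 + Pi.single i 1 : Fin N → ℕ) = 2 := by
      rw [order_add_single, order_single]
    have h2 := h.low (Pi.single i 1 + Pi.single i 1) (by omega)
    filter_upwards [h2, (isWeakDeriv_pd_pd i h.contDiff).ae_eq_weakDeriv] with y hy1 hy2
    rwa [hy2, hord] at hy1
  have h3 : |inner ℝ ((-Complex.I) • u x) (lap u x)| ≤ ‖u x‖ * ‖lap u x‖ := by
    refine (abs_real_inner_le_norm _ _).trans (by simp)
  rw [phaseRate, smul_eq_mul, abs_mul, abs_of_nonneg (by positivity : 0 ≤ (‖u x‖ ^ 2)⁻¹),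
    inv_mul_le_iff₀ (by positivity)]
  calc _ ≤ ‖u x‖ * (N * (K₁ * R ^ 2 * ‖u x‖)) := h3.trans (mul_le_mul_of_nonneg_left h1 hu.le)
    _ = _ := by ring

/-! ### The integrated equation and its discretization. -/

open Filter Topology

variable {α b T σ t : ℝ} {lam : ℂ} {v₀ : Sp N → ℂ} {v : ℝ → Sp N → ℂ}

theorem IsSolution.continuousOn_apply (h : IsSolution N k m n α lam b T v₀ v) (x : Sp N) :
    ContinuousOn (fun s => v s x) (Set.Ico 0 T) := fun s hs => by
  obtain ⟨dv, hdv, -⟩ := h.equation s hs x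
  exact hdv.continuousWithinAt

theorem IsSolution.continuousOn_phaseRate (h : IsSolution N k m n α lam b T v₀ v) (hm : 1 ≤ m)
    (x : Sp N) : ContinuousOn (fun s => phaseRate (v s) x) (Set.Ico 0 T) := by
  have h1 := h.continuousOn_apply x
  have h2 : ContinuousOn (fun s => (‖v s x‖ ^ 2)⁻¹) (Set.Ico 0 T) :=
    (h1.norm.pow 2).inv₀ fun s hs => pow_ne_zero 2 (norm_ne_zero_iff.mpr (h.ne_zero hs x))
  have h3 : ContinuousOn (fun s => (-Complex.I) • v s x) (Set.Ico 0 T) :=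
    h1.const_smul (-Complex.I)
  have h4 : ContinuousOn (fun s => (inner ℝ ((-Complex.I) • v s x) (lap (v s) x) : ℝ))
    (Set.Ico 0 T) := h3.inner (h.continuousOn_lap hm x)
  exact h2.smul h4

theorem continuousOn_one_sub_mul_rpow (hb : 0 < b) (hbt : b * t < 1) (a : ℝ) :
    ContinuousOn (fun s => (1 - b * s) ^ a) (Set.Icc 0 t) :=
  (by fun_prop : Continuous fun s : ℝ => 1 - b * s).continuousOn.rpow_const
    fun _ hs => Or.inl (one_sub_mul_pos hb hbt hs.2).ne'

theorem integral_nlRate (hb : 0 < b) (hp : 0 < (2 - N * α) / 2) (ht : 0 ≤ t) (hbt : b * t < 1) :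
    ∫ s in (0 : ℝ)..t, (1 - b * s) ^ (-(4 - N * α) / 2) =
      invRate b ((2 - N * α) / 2) t / ((2 - N * α) / 2) := by
  rw [invRate, div_div, ← integral_one_sub_mul_rpow hb hp ht hbt]
  congr 1
  funext s
  congr 1
  ring

/-- The equation integrated along the amplitude. -/
theorem IsSolution.absPow_eq (h : IsSolution N k m n α lam b T v₀ v) (hm : 1 ≤ m) (hb : 0 < b)
    (ht : t ∈ Set.Ico 0 T) (hbt : b * t < 1) (x : Sp N) :
    absPow α (v t) x = (‖v₀ x‖ ^ (-α) + (-(α * lam.im)) * ∫ s in (0 : ℝ)..t,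
      (1 - b * s) ^ (-(4 - N * α) / 2) * Real.exp (α * ∫ r in (0 : ℝ)..s, phaseRate (v r) x))⁻¹ *
      Real.exp (α * ∫ r in (0 : ℝ)..t, phaseRate (v r) x) := by
  have hsub : Set.Icc 0 t ⊆ Set.Ico 0 T := fun s hs => ⟨hs.1, hs.2.trans_lt ht.2⟩
  have hamp := amplitude_formula (α := α) (lam := lam) (z := fun s => v s x)
    (D := fun s => lap (v s) x) (h := fun s => (1 - b * s) ^ (-(4 - N * α) / 2)) ht.1
    ((h.continuousOn_lap hm x).mono hsub) (continuousOn_one_sub_mul_rpow hb hbt _)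
    (fun s hs => h.ne_zero (hsub hs) x) (fun s hs => by
      obtain ⟨dv, hdv, heq⟩ := h.equation s (hsub hs) x
      refine ⟨dv, hdv.mono hsub, ?_⟩
      rw [← laplacian_eq_lap (h.contDiff s (hsub hs))]
      exact heq)
  rw [h.initial] at hamp
  have hv := norm_pos_iff.mpr (h.ne_zero ht x)
  have hA := Real.exp_pos (α * ∫ r in (0 : ℝ)..t, phaseRate (v r) x)
  change _ = (‖v₀ x‖ ^ (-α) + (-(α * lam.im)) * ∫ s in (0 : ℝ)..t,
    (1 - b * s) ^ (-(4 - N * α) / 2) * Real.exp (α * ∫ r in (0 : ℝ)..s, phaseRate (v r) x)) at hamp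
  change _ * Real.exp (α * ∫ r in (0 : ℝ)..t, phaseRate (v r) x) = _ at hamp
  rw [← hamp, absPow, mul_inv, Real.rpow_neg hv.le, inv_inv, mul_assoc, inv_mul_cancel₀ hA.ne',
    mul_one]

/-- The discrete amplitudes built on the time slices of a solution converge to the amplitude. -/
theorem IsSolution.tendsto_regAmp (h : IsSolution N k m n α lam b T v₀ v) (hm : 1 ≤ m) (hb : 0 < b)
    (hlam : 0 ≤ -(α * lam.im)) (ht : t ∈ Set.Ico 0 T) (hbt : b * t < 1) (x : Sp N) :
    Tendsto (fun M : ℕ => regAmp α (-(α * lam.im)) (t / M)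
      (fun l => (1 - b * min (l * (t / M)) t) ^ (-(4 - N * α) / 2)) v₀
      (fun l => v (min (l * (t / M)) t)) M x) atTop (𝓝 (absPow α (v t) x)) := by
  have hsub : Set.Icc 0 t ⊆ Set.Ico 0 T := fun s hs => ⟨hs.1, hs.2.trans_lt ht.2⟩
  have hv0 : 0 < ‖v₀ x‖ := by
    rw [← h.initial]; exact norm_pos_iff.mpr (h.ne_zero (hsub ⟨le_rfl, ht.1⟩) x)
  rw [h.absPow_eq hm hb ht hbt]
  refine (tendsto_riemann_amp ht.1 ((h.continuousOn_phaseRate hm x).mono hsub)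
    (continuousOn_one_sub_mul_rpow hb hbt (-(4 - N * α) / 2))
    (fun s hs => Real.rpow_nonneg (one_sub_mul_pos hb hbt hs.2).le _) α (-(α * lam.im))
    (‖v₀ x‖ ^ (-α)) (Real.rpow_pos_of_pos hv0 _) hlam).congr fun M => ?_
  -- The minimum with `t` only keeps the slices of index beyond `M` inside the time interval; those
  -- indices never enter the sums.
  have hmin : ∀ l ≤ M, min ((l : ℝ) * (t / M)) t = l * (t / M) := fun l hl =>
    min_eq_left (grid_mem ht.1 hl).2
  have hphase : ∀ i ≤ M, discPhase α (t / M) (fun l => phaseRate (v (min (l * (t / M)) t))) i x =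
      ∑ j ∈ Finset.range i, (α * (t / M)) * phaseRate (v (j * (t / M))) x := by
    intro i hi
    simp only [discPhase, smul_eq_mul]
    refine Finset.sum_congr rfl fun l hl => ?_
    rw [hmin l (by have := Finset.mem_range.mp hl; omega)]
  rw [regAmp]
  simp only [discAmp, discDen, smul_eq_mul]
  rw [hphase M le_rfl]
  congr 3
  refine Finset.sum_congr rfl fun l hl => ?_
  have hl' := (Finset.mem_range.mp hl).le
  rw [hmin l hl', hphase l hl']

/-- The rate is at most `N K₁ (1 - bs)^{-2σ}` with `2σ < 1`, so its integral up to `1/b` is of order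
`1/b`. This is the only source of smallness for large `b`. -/
theorem IsSolution.abs_integral_phaseRate_le (h : IsSolution N k m n α lam b T v₀ v) (hm : 1 ≤ m)
    (hb : 0 < b) (hσ : 0 ≤ σ) (hσ2 : 2 * σ < 1) (hK₁ : 0 ≤ K₁) (htT : t < T) (hbt : b * t < 1)
    (hΨ : Psi k m n α σ b v t ≤ ENNReal.ofReal K₁) {s : ℝ} (hs : s ∈ Set.Icc 0 t) (x : Sp N) :
    |∫ r in (0 : ℝ)..s, phaseRate (v r) x| ≤ N * K₁ / (b * (1 - 2 * σ)) := by
  have hsub : Set.Icc 0 s ⊆ Set.Ico 0 T := fun r hr => ⟨hr.1, (hr.2.trans hs.2).trans_lt htT⟩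
  have hbs : b * s < 1 := by nlinarith [hs.2]
  refine le_of_tendsto (riemann_tendsto hs.1 ((h.continuousOn_phaseRate hm x).mono hsub)).abs
    (Eventually.of_forall fun M => ?_)
  have hδ : 0 ≤ s / (M : ℝ) := div_nonneg hs.1 (Nat.cast_nonneg _)
  calc _ ≤ ∑ l ∈ Finset.range M, |s / M * phaseRate (v (l * (s / M))) x| :=
        Finset.abs_sum_le_sum_abs _ _
    _ ≤ ∑ l ∈ Finset.range M, N * K₁ * (s / M * (1 - b * (l * (s / M))) ^ (-(2 * σ))) := by
        refine Finset.sum_le_sum fun l hl => ?_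
        have hmem := grid_mem hs.1 (Finset.mem_range.mp hl).le
        have h1 := (h.sliceBound hb hσ hK₁ htT hbt hΨ ⟨hmem.1, hmem.2.trans hs.2⟩).abs_phaseRate_le
          hm x
        rw [rpow_neg_natCast_mul (one_sub_mul_pos hb hbs hmem.2), Nat.cast_ofNat] at h1
        rw [abs_mul, abs_of_nonneg hδ]
        calc _ ≤ _ := mul_le_mul_of_nonneg_left h1 hδ
          _ = _ := by ring
    _ ≤ N * K₁ * (1 / (b * (1 - 2 * σ))) := by
        rw [← Finset.mul_sum]
        exact mul_le_mul_of_nonneg_left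
          (sum_grid_rpow_le (by linarith) hσ2 hb hs.1 hbs le_rfl) (by positivity)
    _ = _ := by ring

/-- The pointwise decay of the amplitude. -/
theorem IsSolution.absPow_le (h : IsSolution N k m n α lam b T v₀ v) (hm : 1 ≤ m) (hb : 0 < b)
    (hα : 0 ≤ α) (hp : 0 < (2 - N * α) / 2) (hlam : 0 ≤ -(α * lam.im))
    (hσ : 0 ≤ σ) (hσ2 : 2 * σ < 1) (hK₁ : 0 ≤ K₁) (ht : t ∈ Set.Ico 0 T) (hbt : b * t < 1)
    (hΨ : Psi k m n α σ b v t ≤ ENNReal.ofReal K₁) (x : Sp N) :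
    absPow α (v t) x ≤ Real.exp (2 * (α * N * K₁ / (1 - 2 * σ)) / b) *
      (‖v₀ x‖ ^ (-α) + (-(α * lam.im)) *
        (invRate b ((2 - N * α) / 2) t / ((2 - N * α) / 2)))⁻¹ := by
  set c := -(α * lam.im)
  set κ := (α * N * K₁ / (1 - 2 * σ)) / b with hκ
  have hsub : Set.Icc 0 t ⊆ Set.Ico 0 T := fun s hs => ⟨hs.1, hs.2.trans_lt ht.2⟩
  have hv0 : 0 < ‖v₀ x‖ := by
    rw [← h.initial]; exact norm_pos_iff.mpr (h.ne_zero (hsub ⟨le_rfl, ht.1⟩) x)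
  have hA : ∀ s ∈ Set.Icc 0 t, |α * ∫ r in (0 : ℝ)..s, phaseRate (v r) x| ≤ κ := by
    intro s hs
    rw [abs_mul, abs_of_nonneg hα]
    refine (mul_le_mul_of_nonneg_left
      (h.abs_integral_phaseRate_le hm hb hσ hσ2 hK₁ ht.2 hbt hΨ hs x) hα).trans_eq ?_
    rw [hκ]
    have : 1 - 2 * σ ≠ 0 := by linarith
    field_simp
  have hκ0 : 0 ≤ κ := (abs_nonneg _).trans (hA 0 ⟨le_rfl, ht.1⟩)
  have hLc := (h.continuousOn_phaseRate hm x).mono hsub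
  have hprim : ContinuousOn (fun s => ∫ r in (0 : ℝ)..s, phaseRate (v r) x) (Set.Icc 0 t) := by
    have := intervalIntegral.continuousOn_primitive_interval (μ := volume)
      (f := fun r => phaseRate (v r) x) (a := 0) (b := t)
      (by rw [Set.uIcc_of_le ht.1]; exact hLc.integrableOn_Icc)
    rwa [Set.uIcc_of_le ht.1] at this
  have hhc := continuousOn_one_sub_mul_rpow hb hbt (-(4 - N * α) / 2)
  -- The phase is at least `-κ` in the denominator and at most `κ` in the numerator, whence the
  -- factor `e^{2κ}` in the conclusion.
  have hI : Real.exp (-κ) * (invRate b ((2 - N * α) / 2) t / ((2 - N * α) / 2)) ≤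
      ∫ s in (0 : ℝ)..t, (1 - b * s) ^ (-(4 - N * α) / 2) *
        Real.exp (α * ∫ r in (0 : ℝ)..s, phaseRate (v r) x) := by
    rw [← integral_nlRate hb hp ht.1 hbt, ← intervalIntegral.integral_const_mul]
    refine intervalIntegral.integral_mono_on ht.1
      ((continuousOn_const.mul hhc).intervalIntegrable_of_Icc ht.1)
      ((hhc.mul (Real.continuous_exp.comp_continuousOn (continuousOn_const.mul
        hprim))).intervalIntegrable_of_Icc ht.1) fun s hs => ?_
    rw [mul_comm]
    exact mul_le_mul_of_nonneg_left (Real.exp_le_exp.mpr (neg_le_of_abs_le (hA s hs)))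
      (Real.rpow_nonneg (one_sub_mul_pos hb hbt hs.2).le _)
  have hY := div_nonneg (invRate_nonneg hb hp.le ht.1 hbt) hp.le
  set I := invRate b ((2 - N * α) / 2) t / ((2 - N * α) / 2)
  have hw := Real.rpow_pos_of_pos hv0 (-α)
  set w := ‖v₀ x‖ ^ (-α)
  rw [h.absPow_eq hm hb ht hbt x]
  have hE := Real.exp_pos κ
  have hden : Real.exp (-κ) * (w + c * I) ≤ w + c * ∫ s in (0 : ℝ)..t,
      (1 - b * s) ^ (-(4 - N * α) / 2) * Real.exp (α * ∫ r in (0 : ℝ)..s, phaseRate (v r) x) := by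
    have h1 := mul_le_mul_of_nonneg_left hI hlam
    have h2 : Real.exp (-κ) * w ≤ w :=
      mul_le_of_le_one_left hw.le (Real.exp_le_one_iff.mpr (by linarith))
    calc _ = Real.exp (-κ) * w + c * (Real.exp (-κ) * I) := by ring
      _ ≤ _ := add_le_add h2 h1
  have hpos : 0 < w + c * I := by positivity
  calc _ ≤ (Real.exp (-κ) * (w + c * I))⁻¹ * Real.exp κ :=
        mul_le_mul (inv_anti₀ (by positivity) hden)
          (Real.exp_le_exp.mpr (le_of_abs_le (hA t ⟨ht.1, le_rfl⟩))) (Real.exp_pos _).le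
          (by positivity)
    _ = Real.exp (κ + κ) * (w + c * I)⁻¹ := by
        rw [mul_inv, Real.exp_neg, inv_inv, Real.exp_add]; ring
    _ = _ := by congr 2; rw [hκ]; ring

end Amplitude

/-! ### Bounds on the amplitude and on its weak derivatives -/

section Final

open Filter Topology

variable {N : ℕ}

theorem Psi_mono {k m n : ℕ} {α σ b : ℝ} {v : ℝ → Sp N → ℂ} {t T : ℝ} (h : t ≤ T) :
    Psi k m n α σ b v t ≤ Psi k m n α σ b v T := by
  have hs : Set.Icc 0 t ⊆ Set.Icc 0 T := Set.Icc_subset_Icc_right h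
  exact max_le_max (max_le_max (biSup_mono hs) (biSup_mono hs))
    (max_le_max (biSup_mono hs) (biSup_mono hs))

/-- The upper bound on `y` makes `y^{-α}` at least a multiple of `⟨x⟩^{nα}`; the interpolation is
then applied with `θ = 2σ/p`. -/
theorem inv_add_le_bracket {n : ℕ} {α σ p A d Y Z y : ℝ} {x : Sp N} (hα : 0 ≤ α)
    (hA : 0 < A) (hd : 0 < d) (hY : 0 ≤ Y) (hσ : 0 ≤ σ) (hp : 0 < p) (hσp : 2 * σ ≤ p)
    (hy : 0 < y) (hyA : bracket x ^ n * y ≤ A) (hZ : d * Y ≤ Z) :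
    (y ^ (-α) + Z)⁻¹ ≤ (min (A ^ (-α)) d)⁻¹ * (max 1 Y) ^ (-(1 - 2 * σ / p)) *
      bracket x ^ (-(2 * n * α * σ / p)) := by
  have hb := bracket_pos x
  have hX : 1 ≤ (bracket x ^ n) ^ α := Real.one_le_rpow (one_le_pow₀ (one_le_bracket x)) hα
  have h1 : A ^ (-α) * (bracket x ^ n) ^ α ≤ y ^ (-α) := by
    have hbn : 0 < bracket x ^ n := pow_pos hb n
    have h2 : y ≤ A / bracket x ^ n := by rw [le_div_iff₀ hbn, mul_comm]; exact hyA
    refine Eq.trans_le ?_ (Real.rpow_le_rpow_of_nonpos hy h2 (by linarith : -α ≤ 0))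
    rw [Real.div_rpow hA.le hbn.le, Real.rpow_neg hbn.le, div_inv_eq_mul]
  have hA' : 0 < A ^ (-α) := Real.rpow_pos_of_pos hA _
  refine (inv_anti₀ (by positivity) (add_le_add h1 hZ)).trans ((inv_add_le_interpolate hA' hd hX hY
    (θ := 2 * σ / p) (by positivity) ((div_le_one hp).mpr hσp)).trans_eq ?_)
  have e : ((bracket x ^ n) ^ α) ^ (-(2 * σ / p)) = bracket x ^ (-(2 * n * α * σ / p)) := by
    rw [← Real.rpow_mul (pow_nonneg hb.le n), ← Real.rpow_natCast, ← Real.rpow_mul hb.le]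
    congr 1
    ring
  rw [e]
  ring

/-- The sums converge to twice the claimed lower bound, so they exceed it eventually when the limit
is positive. The remaining case, where `invRate` vanishes as at `t = 0`, is covered by
nonnegativity. -/
theorem eventually_le_nlRate_sum {α b t c : ℝ} (hb : 0 < b) (hp : 0 < (2 - N * α) / 2) (hc : 0 ≤ c)
    (ht : 0 ≤ t) (hbt : b * t < 1) :
    ∀ᶠ M : ℕ in atTop, c / (2 - N * α) * invRate b ((2 - N * α) / 2) t ≤
      ∑ l ∈ Finset.range M, c * (t / M) * (1 - b * min (l * (t / M)) t) ^ (-(4 - N * α) / 2) := by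
  have hsum : ∀ M : ℕ, ∑ l ∈ Finset.range M,
      c * (t / M) * (1 - b * min (l * (t / M)) t) ^ (-(4 - N * α) / 2) =
      c * ∑ l ∈ Finset.range M, t / M * (1 - b * (l * (t / M))) ^ (-(4 - N * α) / 2) := by
    intro M
    rw [Finset.mul_sum]
    refine Finset.sum_congr rfl fun l hl => ?_
    rw [min_eq_left (grid_mem ht (Finset.mem_range.mp hl).le).2]
    ring
  have hY := invRate_nonneg hb hp.le ht hbt
  have hp' : 0 < 2 - N * α := by linarith
  rcases hY.eq_or_lt with hY0 | hY0
  · refine Eventually.of_forall fun M => ?_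
    rw [← hY0, mul_zero]
    have hδ : 0 ≤ t / (M : ℝ) := div_nonneg ht (Nat.cast_nonneg _)
    exact Finset.sum_nonneg fun l _ => mul_nonneg (mul_nonneg hc hδ)
      (Real.rpow_nonneg (one_sub_mul_pos hb hbt (min_le_right _ _)).le _)
  · have hlim := riemann_tendsto ht (continuousOn_one_sub_mul_rpow hb hbt (-(4 - N * α) / 2))
    rw [integral_nlRate hb hp ht hbt] at hlim
    have hlt : invRate b ((2 - N * α) / 2) t / (2 - N * α) <
        invRate b ((2 - N * α) / 2) t / ((2 - N * α) / 2) :=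
      div_lt_div_of_pos_left hY0 hp (by linarith)
    filter_upwards [hlim.eventually (lt_mem_nhds hlt)] with M hM
    rw [hsum]
    calc _ = c * (invRate b ((2 - N * α) / 2) t / (2 - N * α)) := by ring
      _ ≤ _ := mul_le_mul_of_nonneg_left hM.le hc

/-- The bounds on the discretized amplitude are uniform in the grid and pass to the limit `M → ∞`,
where that amplitude becomes `|v(t)|^α`. -/
theorem exists_weakDeriv_absPow_bounds (N k m n : ℕ) (hm : 1 ≤ m) (hJ : topOrder k m n ≤ 4 * m + 1)
    (α σ K K₁ : ℝ) (lam : ℂ) (hα : 0 < α) (hp : 0 < 2 - N * α) (hc : 0 < -(α * lam.im))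
    (hσ : 0 ≤ σ) (hσp : 2 * σ ≤ 2 - N * α) (h7 : 7 * σ + (2 - N * α) / (2 * α) < 1)
    (hτ : (N : ℝ) < 2 * (2 * n * α * σ / (2 - N * α))) (hτ2 : 2 ≤ 2 * n * α * σ / (2 - N * α))
    (hK : 0 < K) (hK₁ : 0 ≤ K₁) : ∃ C, 0 ≤ C ∧
    ∀ (b : ℝ) (v₀ : Sp N → ℂ) (T : ℝ) (v : ℝ → Sp N → ℂ) (t : ℝ), 1 ≤ b →
      IsSolution N k m n α lam b T v₀ v → t ∈ Set.Ico 0 T → b * t < 1 →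
      Psi k m n α σ b v t ≤ ENNReal.ofReal K₁ → (∀ x, bracket x ^ n * ‖v₀ x‖ ≤ K) →
      (∀ x, ‖v t x‖ ≤ 2 * ‖v₀ x‖) →
      (∀ β : Fin N → ℕ, order β ≤ 2 * m → ∃ g, IsWeakDeriv β (absPow α (v t)) g ∧
        ∀ᵐ x, |g x| ≤ C * (max 1 (invRate b ((2 - N * α) / 2) t)) ^ (-(1 - 2 * σ / (2 - N * α))) *
          ((1 - b * t) ^ (-σ)) ^ (order β - 1) * bracket x ^ (-(2 * n * α * σ / (2 - N * α)))) ∧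
      (∀ β : Fin N → ℕ, 2 * m + 1 ≤ order β → order β + 2 ≤ topOrder k m n →
        ∃ g, IsWeakDeriv β (absPow α (v t)) g ∧
        eLpNorm (fun x => bracket x ^ weightExp k m n (order β) * ‖v t x‖ * g x) 2 volume ≤
          ENNReal.ofReal (C * (max 1 (invRate b ((2 - N * α) / 2) t)) ^
            (-(1 - 2 * σ / (2 - N * α))) * ((1 - b * t) ^ (-σ)) ^ (order β - 1))) := by
  set γ := (2 - N * α) / (2 * α) with hγ
  have hγ0 : 0 ≤ γ := by positivity
  set c := -(α * lam.im) with hc_def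
  -- The factor `2K` instead of `K` allows for the doubling of `|v₀|` by mollification; `c / (2 -
  -- Nα)` is the eventual lower bound on the nonlinear sum.
  set a := (min ((2 * K) ^ (-α)) (c / (2 - N * α)))⁻¹ with ha
  have ha0 : 0 ≤ a := inv_nonneg.mpr (le_min (by positivity) (by positivity))
  have hC₅ : 0 ≤ 1 / (1 - (7 * σ + γ)) := one_div_nonneg.mpr (by linarith)
  obtain ⟨C, hC, H⟩ := regAmp_bounds N k m n hm hJ α K₁ K (1 / (1 - (7 * σ + γ)))
    (2 * n * α * σ / (2 - N * α)) hα.le hK₁ hK.le hC₅ hτ hτ2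
  refine ⟨C * a, by positivity, fun b v₀ T v t hb1 hv ht hbt hΨ hvK hv2 => ?_⟩
  have hb : 0 < b := one_pos.trans_le hb1
  have hY := invRate_nonneg hb (by linarith : 0 ≤ (2 - N * α) / 2) ht.1 hbt
  set Y := invRate b ((2 - N * α) / 2) t with hY_def
  set dec := (max 1 Y) ^ (-(1 - 2 * σ / (2 - N * α))) with hdec
  have hdec0 : 0 ≤ dec := Real.rpow_nonneg (zero_le_one.trans (le_max_left _ _)) _
  have hyt : 0 < 1 - b * t := one_sub_mul_pos hb hbt le_rfl
  set r := (1 - b * t) ^ (-σ) with hr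
  have hmem : ∀ M l : ℕ, min ((l : ℝ) * (t / M)) t ∈ Set.Icc 0 t := fun M l =>
    ⟨le_min (mul_nonneg (Nat.cast_nonneg _) (div_nonneg ht.1 (Nat.cast_nonneg _))) ht.1,
      min_le_right _ _⟩
  have hsl := fun M l : ℕ => hv.sliceBound hb hσ hK₁ ht.2 hbt hΨ (hmem M l)
  have hslt := hv.sliceBound hb hσ hK₁ ht.2 hbt hΨ ⟨ht.1, le_rfl⟩
  -- At time zero all powers of `1 - bs` equal one, so the initial slice costs no power of `r`.
  have hsl0 : SliceBound k m n K₁ 1 1 v₀ := by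
    have := hv.sliceBound hb hσ hK₁ ht.2 hbt hΨ ⟨le_rfl, ht.1⟩
    simpa [hv.initial] using this
  have hpos : ∀ M l : ℕ, 0 < 1 - b * min ((l : ℝ) * (t / M)) t := fun M l =>
    one_sub_mul_pos hb hbt (hmem M l).2
  have hle1 : ∀ M l : ℕ, 1 - b * min ((l : ℝ) * (t / M)) t ≤ 1 := fun M l => by
    nlinarith [(hmem M l).1]
  have hδ : ∀ M : ℕ, 0 ≤ t / (M : ℝ) := fun M => div_nonneg ht.1 (Nat.cast_nonneg _)
  have hRr : ∀ M l : ℕ, (1 - b * min ((l : ℝ) * (t / M)) t) ^ (-σ) ≤ r := fun M l =>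
    Real.rpow_le_rpow_of_nonpos hyt (by nlinarith [(hmem M l).2]) (by linarith)
  have hpow : ∀ M l : ℕ, t / (M : ℝ) * ((1 - b * min ((l : ℝ) * (t / M)) t) ^ (-σ)) ^ 7 /
      (1 - b * min ((l : ℝ) * (t / M)) t) ^ γ =
      t / M * (1 - b * min ((l : ℝ) * (t / M)) t) ^ (-(7 * σ + γ)) := fun M l => by
    rw [rpow_neg_natCast_mul (hpos M l), mul_div_assoc, ← Real.rpow_sub (hpos M l)]
    congr 2
    push_cast
    ring
  -- Seven powers of `(1 - bs)^{-σ}` and the lower bound weight combine into the exponent `7σ + γ <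
  -- 1`; since `b ≥ 1`, the factor `1/b` is dropped.
  have hs2 : ∀ M : ℕ, ∑ l ∈ Finset.range M, t / (M : ℝ) *
      ((1 - b * min ((l : ℝ) * (t / M)) t) ^ (-σ)) ^ 7 /
      (1 - b * min ((l : ℝ) * (t / M)) t) ^ γ ≤ 1 / (1 - (7 * σ + γ)) := fun M => by
    have h1 := sum_grid_rpow_le (a := 7 * σ + γ) (by positivity) h7 hb ht.1 hbt (le_refl M)
    refine (Finset.sum_congr rfl fun l hl => ?_).trans_le (h1.trans ?_)
    · rw [hpow, min_eq_left (grid_mem ht.1 (Finset.mem_range.mp hl).le).2]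
    · have : 0 < 1 - (7 * σ + γ) := by linarith
      exact one_div_le_one_div_of_le this (le_mul_of_one_le_left this.le hb1)
  have hs1 : ∀ M : ℕ, ∑ l ∈ Finset.range M, t / (M : ℝ) *
      ((1 - b * min ((l : ℝ) * (t / M)) t) ^ (-σ)) ^ 7 ≤ 1 / (1 - (7 * σ + γ)) := fun M => by
    refine (Finset.sum_le_sum fun l _ => ?_).trans (hs2 M)
    exact le_div_self (mul_nonneg (hδ M) (pow_nonneg (Real.rpow_nonneg (hpos M l).le _) 7))
      (Real.rpow_pos_of_pos (hpos M l) _) (Real.rpow_le_one (hpos M l).le (hle1 M l) hγ0)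
  have hlim := hv.tendsto_regAmp hm hb hc.le ht hbt
  have hev := (eventually_le_nlRate_sum (N := N) (α := α) hb (by linarith) hc.le ht.1 hbt).mono
    fun M hM => H r c (t / M) 1 (a * dec)
      (fun l => (1 - b * min (l * (t / M)) t) ^ (-(4 - N * α) / 2))
      (fun l => (1 - b * min (l * (t / M)) t) ^ (-σ))
      (fun l => (1 - b * min (l * (t / M)) t) ^ γ) v₀ (v t)
      (fun l => v (min (l * (t / M)) t)) M hslt.one_le hc.le (hδ M) (by positivity)
      (fun l => Real.rpow_nonneg (hpos M l).le _) (hRr M)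
      (fun l => Real.rpow_pos_of_pos (hpos M l) _) hsl0 (hsl M) (hs1 M) (hs2 M) hvK
      hslt.contDiff.continuous hslt.ne_zero hv2 (fun x y hy hyx => by
        refine inv_add_le_bracket hα.le (by positivity) (by positivity) hY hσ hp hσp hy ?_ hM
        calc _ ≤ bracket x ^ n * (2 * ‖v₀ x‖) :=
              mul_le_mul_of_nonneg_left hyx (pow_nonneg (bracket_pos x).le n)
          _ = 2 * (bracket x ^ n * ‖v₀ x‖) := by ring
          _ ≤ _ := mul_le_mul_of_nonneg_left (hvK x) zero_le_two)
  refine ⟨fun β hβ => ?_, fun β hβ1 hβ2 => ?_⟩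
  · refine exists_isWeakDeriv_abs_le_of_tendsto (B' := C * (a * dec))
      (continuous_const.mul (continuous_bracket_rpow _)) ((memLp_bracket_rpow_neg hτ).const_mul _)
      ?_ hlim
    filter_upwards [hev] with M hM
    refine ⟨?_, hM.1⟩
    simpa only [mul_assoc] using hM.2.1 β hβ
  · refine exists_isWeakDeriv_of_tendsto_eventually (B' := C * (a * dec))
      ((continuous_bracket.pow _).mul hslt.contDiff.continuous.norm)
      (fun x => mul_pos (pow_pos (bracket_pos x) _) (norm_pos_iff.mpr (hslt.ne_zero x))) ?_ hlim
    filter_upwards [hev] with M hM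
    refine ⟨?_, hM.1⟩
    simpa only [mul_assoc] using hM.2.2 β hβ1 hβ2

/-- The last upper bound on `σ` reads `2α(k+2)σ + 2 - Nα < 2α`, and `k + 2 ≥ 7` gives `7σ + γ < 1`.
The lower bound on `σ` says `τ > 2N`, which covers both conditions on `τ`. The lower bound on `m`
says `k + n + 1 < 2m`, hence `J ≤ 4m + 1`. -/
theorem parameter_bounds {N k m n : ℕ} (hN : 1 ≤ N) {α σ : ℝ} (hα₁ : 2 / ((N : ℝ) + 2) < α)
    (hα₂ : α < 2 / (N : ℝ)) (hk : (N : ℝ) / 2 + 4 < k) (hm : ((k : ℝ) + n + 1) / 2 < m)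
    (hσ₁ : (N : ℝ) * (2 - N * α) / (n * α) < σ)
    (hσ₂ : σ < (2 - N * α) / 2) (hσ₃ : σ < 1 / ((k : ℝ) + 4))
    (hσ₄ : σ < ((N + 2) * α - 2) / (2 * α * (k + 2))) (hn : 20 / α ^ 2 < n) :
    0 < α ∧ 0 < 2 - N * α ∧ 0 ≤ σ ∧ 2 * σ < 1 ∧ 2 * σ < 2 - N * α ∧
      7 * σ + (2 - N * α) / (2 * α) < 1 ∧ (N : ℝ) < 2 * (2 * n * α * σ / (2 - N * α)) ∧
      2 ≤ 2 * n * α * σ / (2 - N * α) ∧ 1 ≤ m ∧ topOrder k m n ≤ 4 * m + 1 := by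
  have hN1 : (1 : ℝ) ≤ N := Nat.one_le_cast.mpr hN
  have hα : 0 < α := lt_trans (by positivity) hα₁
  have hp : 0 < 2 - N * α := by
    rw [lt_div_iff₀ (by linarith)] at hα₂
    linarith
  have hn0 : (0 : ℝ) < n := lt_trans (by positivity) hn
  have hσ : 0 < σ := lt_trans (by positivity) hσ₁
  have hk5 : 5 ≤ k := by
    have : (4 : ℝ) < k := by linarith
    exact_mod_cast this
  have hk5' : (5 : ℝ) ≤ k := by exact_mod_cast hk5
  have h2σ : 2 * σ < 1 := by
    rw [lt_div_iff₀ (by linarith)] at hσ₃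
    nlinarith
  have h7 : 7 * σ + (2 - N * α) / (2 * α) < 1 := by
    rw [lt_div_iff₀ (by positivity)] at hσ₄
    rw [← lt_sub_iff_add_lt', div_lt_iff₀ (by positivity)]
    have : 0 ≤ σ * (2 * α) * (k - 5) := mul_nonneg (by positivity) (by linarith)
    nlinarith
  have hτ : 2 * (N : ℝ) < 2 * n * α * σ / (2 - N * α) := by
    rw [div_lt_iff₀ (by positivity)] at hσ₁
    rw [lt_div_iff₀ hp]
    linarith
  have hm' : k + n + 1 < 2 * m := by
    have : (k : ℝ) + n + 1 < 2 * m := by linarith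
    exact_mod_cast this
  refine ⟨hα, hp, hσ.le, h2σ, by linarith, h7, by linarith, by linarith, by omega, ?_⟩
  unfold topOrder
  omega

end Final

/-! ### Choice of constants and the four final estimates. -/

section Main

variable {N k m n : ℕ} {α b T σ t K K₁ : ℝ} {lam : ℂ} {v₀ : Sp N → ℂ} {v : ℝ → Sp N → ℂ}

theorem exists_exp_div_le {κ Q : ℝ} (hκ : 0 ≤ κ) (hQ : 1 < Q) :
    ∃ b₀ : ℝ, 1 < b₀ ∧ ∀ b, b₀ ≤ b → Real.exp (κ / b) ≤ Q := by
  have hlog := Real.log_pos hQ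
  refine ⟨2 + κ / Real.log Q, by have := div_nonneg hκ hlog.le; linarith, fun b hb => ?_⟩
  have h0 := div_nonneg hκ hlog.le
  rw [← Real.le_log_iff_exp_le (by linarith), div_le_iff₀ (by linarith), mul_comm,
    ← div_le_iff₀ hlog]
  linarith

/-- The pointwise bounds, in terms of a factor `Q` close to `1`. -/
theorem pointwise_bounds {Y c p y y₀ Q X : ℝ} (hα : 0 < α) (hy : 0 ≤ y) (hy₀ : 0 < y₀)
    (hX : 0 < X) (hK : 0 ≤ K) (hc : 0 < c) (hp : 0 < p) (hY : 0 ≤ Y) (hQ0 : 0 < Q) (hQ2 : Q ≤ 2)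
    (hQα : Q ≤ 2 ^ α) (hQc : Q * (p / c) ≤ 1 + p / c)
    (hyK : X ^ n * y₀ ≤ K) (h : y ^ α ≤ Q * (y₀ ^ (-α) + c * (Y / p))⁻¹) :
    y ≤ 2 * y₀ ∧ ENNReal.ofReal (y ^ α) ≤ ENNReal.ofReal (1 + p / c) *
      min (ENNReal.ofReal (2 * K ^ α * X ^ (-(n * α)))) (ENNReal.ofReal Y)⁻¹ := by
  have hw := Real.rpow_pos_of_pos hy₀ (-α)
  have h0 : 0 ≤ c * (Y / p) := by positivity
  have h1 : y ^ α ≤ Q * y₀ ^ α := by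
    refine h.trans (mul_le_mul_of_nonneg_left ?_ hQ0.le)
    refine (inv_anti₀ hw (le_add_of_nonneg_right h0)).trans_eq ?_
    rw [Real.rpow_neg hy₀.le, inv_inv]
  have hpc : 0 < p / c := by positivity
  constructor
  · rw [← Real.rpow_le_rpow_iff hy (by positivity) hα, Real.mul_rpow zero_le_two hy₀.le]
    exact h1.trans (mul_le_mul_of_nonneg_right hQα (by positivity))
  · rcases min_choice (ENNReal.ofReal (2 * K ^ α * X ^ (-(n * α)))) (ENNReal.ofReal Y)⁻¹ with e | e
    · rw [e, ← ENNReal.ofReal_mul (by positivity)]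
      refine ENNReal.ofReal_le_ofReal ?_
      have hXn : 0 < X ^ n := pow_pos hX n
      have h2 : y₀ ^ α ≤ K ^ α * X ^ (-(n * α)) := by
        have h3 : y₀ ≤ K / X ^ n := by rw [le_div_iff₀ hXn, mul_comm]; exact hyK
        refine (Real.rpow_le_rpow hy₀.le h3 hα.le).trans_eq ?_
        rw [Real.div_rpow hK hXn.le, Real.rpow_neg hX.le, Real.rpow_mul hX.le, Real.rpow_natCast,
          div_eq_mul_inv]
      calc y ^ α ≤ 2 * (K ^ α * X ^ (-(n * α))) :=
            h1.trans (mul_le_mul hQ2 h2 (by positivity) zero_le_two)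
        _ = 1 * (2 * K ^ α * X ^ (-(n * α))) := by ring
        _ ≤ _ := mul_le_mul_of_nonneg_right (by linarith) (by positivity)
    · rw [e]
      -- When `Y = 0`, as at `t = 0`, the second entry of the minimum is infinite and the bound is
      -- empty.
      rcases hY.eq_or_lt with hY0 | hY0
      · rw [← hY0, ENNReal.ofReal_zero, ENNReal.inv_zero,
          ENNReal.mul_top (ENNReal.ofReal_pos.mpr (by positivity)).ne']
        exact le_top
      · rw [← ENNReal.ofReal_inv_of_pos hY0, ← ENNReal.ofReal_mul (by positivity)]
        refine ENNReal.ofReal_le_ofReal (h.trans ?_)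
        calc _ ≤ Q * (c * (Y / p))⁻¹ := mul_le_mul_of_nonneg_left
              (inv_anti₀ (by positivity) (le_add_of_nonneg_left hw.le)) hQ0.le
          _ = Q * (p / c) * Y⁻¹ := by field_simp
          _ ≤ _ := mul_le_mul_of_nonneg_right hQc (inv_nonneg.mpr hY)

end Main

end DissipativeNLS

theorem proposition3p2
    (N : ℕ) (hN : 1 ≤ N) (lam : ℂ) (hlam : lam.im < 0)
    (α : ℝ) (hα₁ : 2 / ((N : ℝ) + 2) < α) (hα₂ : α < 2 / (N : ℝ))
    (k m n : ℕ)
    (hk : (N : ℝ) / 2 + 4 < k)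
    (hn : max (20 / α ^ 2) (max ((N : ℝ) * (2 - N * α) * (k + 4) / α)
        (2 * N * (k + 2) * (2 - N * α) / ((N + 2) * α - 2))) < n)
    (hm : max (((k : ℝ) + n + 1) / 2)
        (5 * n * α * ‖lam‖ * (1 + α * |lam.im|) / (N * (2 - N * α) * |lam.im|)) < m)
    (σ : ℝ) (hσ₁ : (N : ℝ) * (2 - N * α) / (n * α) < σ)
    (hσ₂ : σ < min (min (N * α / 10) ((2 - N * α) / 2))
        (min (1 / ((k : ℝ) + 4)) (((N + 2) * α - 2) / (2 * α * (k + 2)))))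
    (K : ℝ) (hK : 1 < K) (K₁ : ℝ) (hK₁ : K ≤ K₁) :
    ∃ b₀ : ℝ, 1 < b₀ ∧ ∃ C₀ : ℝ, 0 < C₀ ∧
      ∀ (b : ℝ) (v₀ : DissipativeNLS.Sp N → ℂ) (Tmax : ℝ) (v : ℝ → DissipativeNLS.Sp N → ℂ)
        (T : ℝ),
        b₀ ≤ b →
        DissipativeNLS.MemS k m n v₀ →
        DissipativeNLS.normS k m n v₀ + (DissipativeNLS.lowerBound n v₀)⁻¹ ≤ ENNReal.ofReal K →
        0 < Tmax → Tmax ≤ 1 / b →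
        DissipativeNLS.IsSolution N k m n α lam b Tmax v₀ v →
        0 < T → T < Tmax →
        DissipativeNLS.Psi k m n α σ b v T ≤ ENNReal.ofReal K₁ →
        ∀ t ∈ Set.Icc 0 T,
          (∀ x, ‖v t x‖ ≤ 2 * ‖v₀ x‖) ∧
          (∀ x, ENNReal.ofReal (‖v t x‖ ^ α) ≤
            ENNReal.ofReal (1 + (2 - N * α) / (2 * α * |lam.im|)) *
              min (ENNReal.ofReal (2 * K ^ α * DissipativeNLS.bracket x ^ (-(n * α))))
                (ENNReal.ofReal b * DissipativeNLS.G N α b t)) ∧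
          eLpNorm (DissipativeNLS.absPow α (v t)) 2 volume ≤
            ENNReal.ofReal C₀ * DissipativeNLS.decay N α σ b t ∧
          (∀ β : Fin N → ℕ, 1 ≤ DissipativeNLS.order β → DissipativeNLS.order β ≤ 2 * m →
            DissipativeNLS.HasWeakDeriv β (DissipativeNLS.absPow α (v t)) ∧
            eLpNorm (fun x => DissipativeNLS.bracket x ^ (2 * n * α * σ / (2 - N * α)) *
                DissipativeNLS.weakDeriv β (DissipativeNLS.absPow α (v t)) x) ∞ volume ≤
              ENNReal.ofReal C₀ * DissipativeNLS.decay N α σ b t *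
                ENNReal.ofReal ((1 - b * t) ^ (-(((DissipativeNLS.order β : ℝ) - 1) * σ)))) ∧
          (∀ β : Fin N → ℕ, 2 * m + 1 ≤ DissipativeNLS.order β →
            DissipativeNLS.order β ≤ DissipativeNLS.topOrder k m n - 2 →
            DissipativeNLS.HasWeakDeriv β (DissipativeNLS.absPow α (v t)) ∧
            eLpNorm (fun x =>
                ((DissipativeNLS.bracket x ^
                    DissipativeNLS.weightExp k m n (DissipativeNLS.order β) *
                  DissipativeNLS.weakDeriv β (DissipativeNLS.absPow α (v t)) x : ℝ) : ℂ) *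
                  v t x) 2 volume ≤
              ENNReal.ofReal C₀ *
                ENNReal.ofReal ((1 - b * t) ^ (-(((DissipativeNLS.order β : ℝ) - 1) * σ))) *
                DissipativeNLS.decay N α σ b t) := by
  obtain ⟨hα, hp, hσ, h2σ, hσp, h7, hτ, hτ2, hm1, hJ⟩ := DissipativeNLS.parameter_bounds hN hα₁ hα₂
    hk ((le_max_left _ _).trans_lt hm) hσ₁
    (hσ₂.trans_le ((min_le_left _ _).trans (min_le_right _ _)))
    (hσ₂.trans_le ((min_le_right _ _).trans (min_le_left _ _)))
    (hσ₂.trans_le ((min_le_right _ _).trans (min_le_right _ _))) ((le_max_left _ _).trans_lt hn)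
  have hK0 : 0 < K := one_pos.trans hK
  have hK₁0 : 0 ≤ K₁ := hK0.le.trans hK₁
  have hp2 : 0 < (2 - N * α) / 2 := by linarith
  have hc : 0 < -(α * lam.im) := by nlinarith
  have hceq : (2 - N * α) / (2 * α * |lam.im|) = (2 - N * α) / 2 / -(α * lam.im) := by
    rw [abs_of_neg hlam, div_div]
    congr 1
    ring
  rw [hceq]
  set c := -(α * lam.im) with hc_def
  have hpc : 0 < (2 - N * α) / 2 / c := by positivity
  -- `Q` is the room left by the constants of the statement: `2 ^ α` for item 1, the factor `2` and
  -- the `1` added to `(2 - Nα)/(2α|Im λ|)` for the two entries of the minimum in item 2. Being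
  -- greater than `1`, it can absorb `e^{O(1/b)}`.
  set Q := min 2 (min (2 ^ α) (1 + ((2 - N * α) / 2 / c)⁻¹)) with hQ
  have hQ1 : 1 < Q := lt_min one_lt_two (lt_min (Real.one_lt_rpow one_lt_two hα)
    (lt_add_of_pos_right 1 (inv_pos.mpr hpc)))
  have hQ2 : Q ≤ 2 := min_le_left _ _
  have hQα : Q ≤ 2 ^ α := (min_le_right _ _).trans (min_le_left _ _)
  have hQc : Q * ((2 - N * α) / 2 / c) ≤ 1 + (2 - N * α) / 2 / c := by
    refine (mul_le_mul_of_nonneg_right ((min_le_right _ _).trans (min_le_right _ _)) hpc.le).trans_eq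
      ?_
    rw [add_mul, inv_mul_cancel₀ hpc.ne']
    ring
  have h2σ' : 0 < 1 - 2 * σ := by linarith
  -- The exponent is the doubled phase bound of `IsSolution.absPow_le`; this fixes `b₀`.
  obtain ⟨b₀, hb₀, hexp⟩ := DissipativeNLS.exists_exp_div_le
    (κ := 2 * (α * N * K₁ / (1 - 2 * σ))) (by positivity) hQ1
  obtain ⟨C, hC, HC⟩ := DissipativeNLS.exists_weakDeriv_absPow_bounds N k m n hm1 hJ α σ K K₁ lam hα
    hp hc hσ hσp.le h7 hτ hτ2 hK0 hK₁0
  set a := (min (K ^ (-α)) (c / ((2 - N * α) / 2)))⁻¹ with ha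
  have ha0 : 0 ≤ a := inv_nonneg.mpr (le_min (by positivity) (by positivity))
  set Lτ := (eLpNorm (fun x : DissipativeNLS.Sp N =>
    DissipativeNLS.bracket x ^ (-(2 * n * α * σ / (2 - N * α)))) 2 volume).toReal with hLτ
  have hLτ0 : 0 ≤ Lτ := ENNReal.toReal_nonneg
  -- `C` serves items 4 and 5, and `Q a Lτ` serves item 3, with `Lτ` the `L²` norm of `⟨x⟩^{-τ}`;
  -- the `1` makes the constant positive.
  refine ⟨b₀, hb₀, 1 + C + Q * a * Lτ, by positivity, ?_⟩
  intro b v₀ Tmax v T hb hv₀ hv₀K hTmax hTmaxb hv hT hTT hΨ t ht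
  have hb1 : 1 ≤ b := hb₀.le.trans hb
  have hb0 : 0 < b := one_pos.trans_le hb1
  have htT : t ∈ Set.Ico 0 Tmax := ⟨ht.1, ht.2.trans_lt hTT⟩
  have hbt : b * t < 1 := by
    have := htT.2.trans_le hTmaxb
    rwa [lt_div_iff₀ hb0, mul_comm] at this
  have hy : 0 < 1 - b * t := DissipativeNLS.one_sub_mul_pos hb0 hbt le_rfl
  have hΨt := (DissipativeNLS.Psi_mono ht.2).trans hΨ
  have h0T : (0 : ℝ) ∈ Set.Ico 0 Tmax := ⟨le_rfl, hTmax⟩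
  have hv₀c : Continuous v₀ := by rw [← hv.initial]; exact (hv.contDiff 0 h0T).continuous
  have hv₀ne : ∀ x, 0 < ‖v₀ x‖ := fun x => by
    rw [← hv.initial]; exact norm_pos_iff.mpr (hv.ne_zero h0T x)
  have hv₀b := DissipativeNLS.bracket_pow_mul_norm_le hv₀c hK0.le (le_self_add.trans hv₀K)
  have hY := DissipativeNLS.invRate_nonneg hb0 hp2.le ht.1 hbt
  have hθ : 0 < 1 - 2 * σ / (2 - N * α) := sub_pos.mpr ((div_lt_one hp).mpr hσp)
  rw [DissipativeNLS.ofReal_mul_G hb0 hbt, DissipativeNLS.decay_eq hb0 hbt hθ]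
  set Y := DissipativeNLS.invRate b ((2 - N * α) / 2) t with hY_def
  set dec := (max 1 Y) ^ (-(1 - 2 * σ / (2 - N * α))) with hdec
  have hdec0 : 0 ≤ dec := Real.rpow_nonneg (zero_le_one.trans (le_max_left _ _)) _
  have hamp : ∀ x, ‖v t x‖ ^ α ≤ Q * (‖v₀ x‖ ^ (-α) + c * (Y / ((2 - N * α) / 2)))⁻¹ := by
    intro x
    refine (hv.absPow_le hm1 hb0 hα.le hp2 hc.le hσ h2σ hK₁0 htT hbt hΨt x).trans ?_
    have := Real.rpow_pos_of_pos (hv₀ne x) (-α)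
    exact mul_le_mul_of_nonneg_right (hexp b hb) (inv_nonneg.mpr (by positivity))
  have hpt := fun x => DissipativeNLS.pointwise_bounds hα (norm_nonneg (v t x)) (hv₀ne x)
    (DissipativeNLS.bracket_pos x) hK0.le hc hp2 hY (one_pos.trans hQ1) hQ2 hQα hQc (hv₀b x) (hamp x)
  obtain ⟨hlow, hhigh⟩ := HC b v₀ Tmax v t hb1 hv htT hbt hΨt hv₀b fun x => (hpt x).1
  have hrpow : ∀ β : Fin N → ℕ, 1 ≤ DissipativeNLS.order β →
      ((1 - b * t) ^ (-σ)) ^ (DissipativeNLS.order β - 1) =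
        (1 - b * t) ^ (-(((DissipativeNLS.order β : ℝ) - 1) * σ)) := by
    intro β hβ
    rw [DissipativeNLS.rpow_neg_natCast_mul hy, Nat.cast_sub hβ, Nat.cast_one]
  refine ⟨fun x => (hpt x).1, fun x => (hpt x).2, ?_, fun β hβ1 hβ2 => ?_, fun β hβ1 hβ2 => ?_⟩
  · have hL2 := DissipativeNLS.memLp_bracket_rpow_neg (N := N) hτ
    have h1 : ∀ x, |DissipativeNLS.absPow α (v t) x| ≤ Q * a * dec *
        DissipativeNLS.bracket x ^ (-(2 * n * α * σ / (2 - N * α))) := fun x => by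
      rw [DissipativeNLS.absPow, abs_of_nonneg (Real.rpow_nonneg (norm_nonneg _) _)]
      refine (hamp x).trans ?_
      have h2 := DissipativeNLS.inv_add_le_bracket (d := c / ((2 - N * α) / 2)) (Y := Y)
        (Z := c * (Y / ((2 - N * α) / 2))) hα.le hK0 (by positivity) hY hσ hp hσp.le (hv₀ne x)
        (hv₀b x) (le_of_eq (by ring))
      calc _ ≤ _ := mul_le_mul_of_nonneg_left h2 (one_pos.trans hQ1).le
        _ = _ := by ring
    have h3 := DissipativeNLS.eLpNorm_finset_sum_le (N := N) {()} (fun _ => Q * a * dec)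
      (fun _ => Lτ) (fun _ x => DissipativeNLS.bracket x ^ (-(2 * n * α * σ / (2 - N * α))))
      (fun _ _ => by positivity) (fun _ _ => hLτ0) (fun _ _ => hL2.1)
      (fun _ _ => (ENNReal.ofReal_toReal hL2.eLpNorm_ne_top).ge)
    simp only [Finset.sum_singleton] at h3
    refine (DissipativeNLS.eLpNorm_le_of_abs_le h1).trans (h3.trans ?_)
    rw [← ENNReal.ofReal_mul (by positivity)]
    refine ENNReal.ofReal_le_ofReal ?_
    calc _ = Q * a * Lτ * dec := by ring
      _ ≤ _ := mul_le_mul_of_nonneg_right (by linarith) hdec0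
  · obtain ⟨g, hg, hgb⟩ := hlow β hβ2
    refine ⟨⟨g, hg⟩, ?_⟩
    rw [hrpow β hβ1] at hgb
    have hr := Real.rpow_nonneg hy.le (-(((DissipativeNLS.order β : ℝ) - 1) * σ))
    rw [← ENNReal.ofReal_mul (by positivity), ← ENNReal.ofReal_mul (by positivity),
      eLpNorm_exponent_top]
    refine eLpNormEssSup_le_of_ae_bound ?_
    filter_upwards [hgb, hg.ae_eq_weakDeriv] with x hx hx2
    have hbx := DissipativeNLS.bracket_pos x
    have hbτ := Real.rpow_pos_of_pos hbx (2 * n * α * σ / (2 - N * α))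
    rw [hx2, norm_mul, Real.norm_of_nonneg hbτ.le, Real.norm_eq_abs]
    rw [Real.rpow_neg hbx.le, ← div_eq_mul_inv, le_div_iff₀ hbτ, mul_comm] at hx
    refine hx.trans ?_
    have : C ≤ 1 + C + Q * a * Lτ := by
      have : 0 ≤ Q * a * Lτ := by positivity
      linarith
    gcongr
  · obtain ⟨g, hg, hgb⟩ := hhigh β hβ1 (by unfold DissipativeNLS.topOrder at hβ2 ⊢; omega)
    refine ⟨⟨g, hg⟩, ?_⟩
    rw [hrpow β (by omega)] at hgb
    have hr := Real.rpow_nonneg hy.le (-(((DissipativeNLS.order β : ℝ) - 1) * σ))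
    rw [← ENNReal.ofReal_mul (by positivity), ← ENNReal.ofReal_mul (by positivity)]
    refine (eLpNorm_congr_norm_ae ?_).trans_le (hgb.trans (ENNReal.ofReal_le_ofReal ?_))
    · filter_upwards [hg.ae_eq_weakDeriv] with x hx
      have hw := pow_nonneg (DissipativeNLS.bracket_pos x).le
        (DissipativeNLS.weightExp k m n (DissipativeNLS.order β))
      rw [hx, norm_mul, Complex.norm_real, norm_mul, norm_mul, norm_mul, norm_norm]
      ring
    · have : C ≤ 1 + C + Q * a * Lτ := by
        have : 0 ≤ Q * a * Lτ := by positivity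
        linarith
      calc _ = C * (1 - b * t) ^ (-(((DissipativeNLS.order β : ℝ) - 1) * σ)) * dec := by ring
        _ ≤ _ := by gcongr
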